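/- **Setting.** Let $G=(V,E,\omega)$ be an infinite connected graph without loops or multiple edges, with symmetric weights $\omega_{ij}=\omega_{ji}$, $\omega_{ij}=0$ off the edges, $0<\lambda\le\omega_{ij}\le\Lambda<\infty$ on the edges, and at most $C_V<\infty$ neighbours at each vertex ("locally uniformly finite"). Put $N(i)=\{j: j\sim i\}$ and $\pi_i=\sum_{j\in N(i)}\omega_{ij}$. (Then automatically $\inf_i\pi_i>0$, $\sum_i\pi_i=\infty$, $\pi_j\le K\pi_i$ for $i\sim j$, and $G$ is stochastically complete.) Let $d$ be the graph distance and $o\in V$ a fixed vertex. Let $\Psi:V\to\mathbb R$ satisfy $\Psi_i\to\infty$ as $i\to\infty$, $|\Psi_i-\Psi_j|\le C_\Psi$ for $i\sim j$, and $\sum_i d(o,i)^2e^{-\Psi_i}\pi_i<\infty$. Write $\nabla_G p(i,j)=p_j-p_i$ for $i\sim j$ (and $0$ otherwise) and $\Delta_G\rho_i=\sum_{j\in N(i)}\frac{\omega_{ij}}{\pi_i}(\rho_j-\rho_i)$. For positive $\rho$ and $i\sim j$ let $\hat\rho_{ij}=\frac{\rho_i-\rho_j}{\log\rho_i-\log\rho_j}$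 ($=\rho_i$ if $\rho_i=\rho_j$), $div_G(\rho\Phi)_i=\sum_{j\in N(i)}\frac{\omega_{ij}}{\pi_i}\Phi_{ij}\hat\rho_{ij}$, $B_\rho p=-div_G(\rho\nabla_Gp)$ and $(\Phi,\Phi')_\rho=\frac12\sum_{i}\sum_{j\in N(i)}\omega_{ij}\Phi_{ij}\Phi'_{ij}\hat\rho_{ij}$. Let $\mathcal P_0(G)=\{\rho>0:\sum_i\rho_i\pi_i=1\}$ and $\mathcal P_0^*(G)=\{\rho\in\mathcal P_0(G):\sum_i d(o,i)^2\rho_i\pi_i<\infty\}$. For $\rho\in\mathcal P_0(G)$ let $\mathcal K_\rho=\{p:B_\rho p\in\ell^1(V,\pi)\}$, let $\mathcal D_\rho=\{p\in\mathcal K_\rho:(\nabla_Gp,\nabla_Gp)_\rho<\infty\}$, let $T_\rho=\{\sigma\in B_\rho(\mathcal D_\rho):\sum_i\sigma_i\pi_i=0\}$, and let $g_\rho(B_\rho p,B_\rho q)=(\nabla_Gp,\nabla_Gq)_\rho$ for $p,q\in\mathcal D_\rho$. Let $\mathcal W_2^2(\rho^1,\rho^2)\in[0,\infty]$ be the infimum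 of $\int_0^1g_\gamma(\dot\gamma,\dot\gamma)\,dt$ over all curves $\gamma:[0,1]\to\mathcal P_0(G)$ from $\rho^1$ to $\rho^2$ with continuously differentiable coordinates, where $g_\gamma(\dot\gamma,\dot\gamma)=\infty$ if $\dot\gamma\notin T_\gamma$. Let $\mathcal F(\rho)=\sum_i\pi_i\Psi_i\rho_i+\sum_i\pi_i\rho_i\log\rho_i$. A *first variation* of a functional $J$ at $\rho$ is a function $\frac{\delta J}{\delta\rho}$ on $V$ such that, for all $\sigma$ with $|\sigma|\le C\rho$ for some $C$, the series $\sum_i\frac{\delta J}{\delta\rho_i}\sigma_i\pi_i$ converges absolutely and equals $\frac{d}{d\varepsilon}J(\rho+\varepsilon\sigma)|_{\varepsilon=0}$. A *gradient flow* of $J$ on $(\mathcal P_0^*(G),\mathcal W_2)$ from $\rho^0$ is a curve $\rho:[0,\infty)\to\mathcal P_0^*(G)$, $\rho(0)=\rho^0$, with coordinates continuous on $[0,\infty)$ and differentiable on $(0,\infty)$, such that $\mathcal W_2(\rho(s),\rho(t))<\infty$ for all $s,t\ge0$ and, for every $t>0$, $\dot\rho(t)\in T_{\rho(t)}$, $J$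 has a first variation at $\rho(t)$, and $$g_{\rho(t)}(\dot\rho(t),\sigma)=-\sum_i\frac{\delta J}{\delta\rho_i}(\rho(t))\,\sigma_i\pi_i\quad\text{(absolutely convergent) for all }\sigma\in T_{\rho(t)}.$$ A *global solution in $\mathcal P_0^*(G)$* of the Fokker–Planck equation $$\frac{d\rho}{dt}=div_G(\rho\nabla_G\Psi)+\Delta_G\rho\qquad(\mathrm{FP})$$ from $\rho^0$ is a curve $\rho:[0,\infty)\to\mathcal P_0^*(G)$ with $\rho(0)=\rho^0$ satisfying (FP) at every vertex and every $t\ge0$ (one-sided derivative at $t=0$). **Theorem 1.** (0) For $\rho\in\mathcal P_0(G)$, $g_\rho$ is well defined: for $p,q\in\mathcal D_\rho$ one has $B_\rho p\in T_\rho$, and $B_\rho p=B_\rho q$ if and only if $p-q$ is constant. Moreover $g_\rho(B_\rho p,B_\rho q)=\sum_i(B_\rho p)_iq_i\pi_i$ whenever this series converges absolutely. (1) For $\rho\in\mathcal P_0^*(G)$ both series in $\mathcal F(\rho)$ converge absolutely, $\mathcal F$ has the first variation $\frac{\delta\mathcal F}{\delta\rho_i}=\Psi_i+1+\log\rho_i$,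 this function lies in $\mathcal K_\rho$, and for every $i$ $$div_G(\rho\nabla_G\Psi)_i+\Delta_G\rho_i=-\Big(B_\rho\tfrac{\delta\mathcal F}{\delta\rho}\Big)_i=\sum_{j\in N(i)}\frac{\omega_{ij}}{\pi_i}\big[(\Psi_j+\log\rho_j)-(\Psi_i+\log\rho_i)\big]\hat\rho_{ij}.$$ For every $\rho^0\in\mathcal P_0^*(G)$, a curve is a global solution of (FP) in $\mathcal P_0^*(G)$ from $\rho^0$ if and only if it is a gradient flow of $\mathcal F$ on $(\mathcal P_0^*(G),\mathcal W_2)$ from $\rho^0$. (2) For every $\rho^0\in\mathcal P_0^*(G)$, (FP) has a unique global solution in $\mathcal P_0^*(G)$ from $\rho^0$. (3) The Gibbs density $\rho_i^*=e^{-\Psi_i}/\sum_j\pi_je^{-\Psi_j}$ lies in $\mathcal P_0^*(G)$, and for every $\rho^0\in\mathcal P_0^*(G)$ and every $r\in[2,\infty]$ the global solution $\rho$ satisfies $\|\rho(t)-\rho^*\|_{\ell^r(V,\pi)}\to0$ as $t\to\infty$. -/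

import Mathlib

open Filter Topology MeasureTheory
open scoped ENNReal

/-- A locally uniformly finite weighted graph without loops or multiple edges: symmetric edge
weights which are positive exactly on the edges, bounded above, bounded away from zero on the
edges, and a uniform bound on the number of neighbours. -/
structure WeightedGraph (V : Type*) where
  graph : SimpleGraph V
  ω : V → V → ℝ
  ω_symm : ∀ i j, ω i j = ω j i
  ω_zero : ∀ i j, ¬ graph.Adj i j → ω i j = 0
  ω_lower : ∃ lam : ℝ, 0 < lam ∧ ∀ i j, graph.Adj i j → lam ≤ ω i j
  ω_upper : ∃ Lam : ℝ, ∀ i j, ω i j ≤ Lam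
  nbr_finite : ∀ i, (graph.neighborSet i).Finite
  nbr_bound : ∃ C : ℕ, ∀ i, (nbr_finite i).toFinset.card ≤ C

namespace WeightedGraph

noncomputable section

variable {V : Type*} (G : WeightedGraph V)

/-- The finite set of neighbours of `i`. -/
def nbr (i : V) : Finset V := (G.nbr_finite i).toFinset

/-- The vertex measure `π i = ∑ j ∈ N(i), ω i j`. -/
def π (i : V) : ℝ := ∑ j ∈ G.nbr i, G.ω i j

open Classical in
/-- The graph gradient of a function on vertices. -/
def grad (p : V → ℝ) (i j : V) : ℝ := if G.graph.Adj i j then p j - p i else 0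

/-- The graph Laplacian. -/
def lap (p : V → ℝ) (i : V) : ℝ := ∑ j ∈ G.nbr i, G.ω i j / G.π i * (p j - p i)

open Classical in
/-- The logarithmic mean of `ρ` along edges (its value is the common one where `ρ i = ρ j`). -/
def logMean (ρ : V → ℝ) (i j : V) : ℝ :=
  if G.graph.Adj i j ∧ 0 < ρ i ∧ 0 < ρ j then
    if ρ i = ρ j then ρ i else (ρ i - ρ j) / (Real.log (ρ i) - Real.log (ρ j))
  else 0

/-- The weighted divergence `div_G (ρ Φ)`. -/
def wdiv (ρ : V → ℝ) (Φ : V → V → ℝ) (i : V) : ℝ :=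
  ∑ j ∈ G.nbr i, G.ω i j / G.π i * Φ i j * G.logMean ρ i j

/-- The operator `B_ρ p = - div_G (ρ ∇_G p)`. -/
def B (ρ p : V → ℝ) (i : V) : ℝ := - G.wdiv ρ (G.grad p) i

/-! ### Probability densities -/

/-- The strictly positive probability densities with respect to `π`. -/
def P0 : Set (V → ℝ) := {ρ | (∀ i, 0 < ρ i) ∧ HasSum (fun i => ρ i * G.π i) 1}

/-- The strictly positive probability densities with finite second moment (about `o`). -/
def P0star (o : V) : Set (V → ℝ) :=
  {ρ | ρ ∈ G.P0 ∧ Summable fun i => (G.graph.dist o i : ℝ) ^ 2 * ρ i * G.π i}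

/-! ### The Riemannian structure -/

/-- The domain of `B_ρ`: functions `p` with `div_G (ρ ∇_G p) ∈ ℓ¹(V, π)`. -/
def K (ρ : V → ℝ) : Set (V → ℝ) := {p | Summable fun i => |G.B ρ p i| * G.π i}

/-- The space `L²_ρ(V², π)` of square integrable vector fields. -/
def L2 (ρ : V → ℝ) : Set (V → V → ℝ) :=
  {Φ | Summable fun e : V × V => G.ω e.1 e.2 * Φ e.1 e.2 ^ 2 * G.logMean ρ e.1 e.2}

/-- The inner product `(Φ, Φ')_ρ` of vector fields. -/
def vecInner (ρ : V → ℝ) (Φ Φ' : V → V → ℝ) : ℝ :=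
  1 / 2 * ∑' e : V × V, G.ω e.1 e.2 * Φ e.1 e.2 * Φ' e.1 e.2 * G.logMean ρ e.1 e.2

/-- The potentials of finite energy: those `p ∈ K ρ` whose gradient lies in `L2 ρ`. -/
def potentials (ρ : V → ℝ) : Set (V → ℝ) := {p | p ∈ G.K ρ ∧ G.grad p ∈ G.L2 ρ}

/-- The tangent space at `ρ`: mass-free functions `σ = B_ρ p` with `p` of finite energy. -/
def tangent (ρ : V → ℝ) : Set (V → ℝ) :=
  {σ | (∃ p ∈ G.potentials ρ, G.B ρ p = σ) ∧ HasSum (fun i => σ i * G.π i) 0}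

open Classical in
/-- The inverse operator `B_ρ⁻¹` on the tangent space: a potential `p` with `B_ρ p = σ`. -/
def Binv (ρ σ : V → ℝ) : V → ℝ :=
  if h : ∃ p ∈ G.potentials ρ, G.B ρ p = σ then h.choose else 0

/-- The Riemannian metric `g_ρ(σ₁, σ₂) = (∇_G B_ρ⁻¹ σ₁, ∇_G B_ρ⁻¹ σ₂)_ρ`. -/
def metric (ρ σ₁ σ₂ : V → ℝ) : ℝ :=
  G.vecInner ρ (G.grad (G.Binv ρ σ₁)) (G.grad (G.Binv ρ σ₂))

open Classical in
/-- The squared length of `σ` at `ρ`, infinite if `σ` is not a tangent vector. -/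
def normSq (ρ σ : V → ℝ) : ℝ≥0∞ :=
  if σ ∈ G.tangent ρ then ENNReal.ofReal (G.metric ρ σ σ) else ⊤

/-- `γ : [0,1] → P0` is a continuously differentiable curve from `ρ₁` to `ρ₂`. -/
def IsCurve (ρ₁ ρ₂ : V → ℝ) (γ : ℝ → V → ℝ) : Prop :=
  (∀ t ∈ Set.Icc (0 : ℝ) 1, γ t ∈ G.P0) ∧
    (∀ i, ContDiffOn ℝ 1 (fun t => γ t i) (Set.Icc 0 1)) ∧ γ 0 = ρ₁ ∧ γ 1 = ρ₂

/-- The square of the Wasserstein-type distance: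
the infimum of `∫₀¹ g_γ(γ', γ') dt` over all curves from `ρ₁` to `ρ₂`. -/
def W2sq (ρ₁ ρ₂ : V → ℝ) : ℝ≥0∞ :=
  ⨅ (γ : ℝ → V → ℝ) (_ : G.IsCurve ρ₁ ρ₂ γ), ∫⁻ t in Set.Icc (0 : ℝ) 1,
    G.normSq (γ t) (fun i => derivWithin (fun s => γ s i) (Set.Icc 0 1) t)

/-- The Wasserstein-type distance. -/
def W2 (ρ₁ ρ₂ : V → ℝ) : ℝ≥0∞ := G.W2sq ρ₁ ρ₂ ^ (1 / 2 : ℝ)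

/-! ### Functionals and gradient flows -/

/-- `h` is the first variation of `J` at `ρ`: the directional derivative of `J` at `ρ` is
`⟨h, σ⟩_π` in every direction `σ` for which `ρ + ε σ` stays positive for small `|ε|`
uniformly (`|σ| ≤ C ρ`). -/
def IsFirstVariation (J : (V → ℝ) → ℝ) (ρ h : V → ℝ) : Prop :=
  ∀ σ : V → ℝ, (∃ C : ℝ, ∀ i, |σ i| ≤ C * ρ i) →
    (Summable fun i => h i * σ i * G.π i) ∧
      HasDerivAt (fun ε : ℝ => J (fun i => ρ i + ε * σ i)) (∑' i, h i * σ i * G.π i) 0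

/-- `ρ` is a gradient flow of `J` on `(P0star, W2)` starting from `ρ₀`: a curve in `P0star`,
continuous on `[0, ∞)` and differentiable on `(0, ∞)`, moving at finite `W2`-distance, with
tangential velocity and `g_ρ(ρ', σ) = - ⟨δJ/δρ, σ⟩_π` for all tangent vectors `σ`. -/
structure IsGradientFlow (o : V) (J : (V → ℝ) → ℝ) (ρ₀ : V → ℝ) (ρ : ℝ → V → ℝ) : Prop where
  init : ρ 0 = ρ₀
  mem : ∀ t, 0 ≤ t → ρ t ∈ G.P0star o
  cont : ∀ i, ContinuousOn (fun t => ρ t i) (Set.Ici 0)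
  diff : ∀ t, 0 < t → ∀ i, DifferentiableAt ℝ (fun s => ρ s i) t
  dist_finite : ∀ s t, 0 ≤ s → 0 ≤ t → G.W2 (ρ s) (ρ t) < ⊤
  velocity : ∀ t, 0 < t → (fun i => deriv (fun s => ρ s i) t) ∈ G.tangent (ρ t)
  gradient : ∀ t, 0 < t → ∃ h, G.IsFirstVariation J (ρ t) h ∧
    ∀ σ ∈ G.tangent (ρ t), (Summable fun i => h i * σ i * G.π i) ∧
      G.metric (ρ t) (fun i => deriv (fun s => ρ s i) t) σ = - ∑' i, h i * σ i * G.π i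

/-! ### The Fokker-Planck equation -/

/-- The potential: tends to infinity, has bounded gradient, and grows so rapidly that
`exp (-Ψ)` has finite second moment. -/
structure IsPotential (o : V) (Ψ : V → ℝ) : Prop where
  tendsto : Tendsto Ψ cofinite atTop
  grad_bound : ∃ C : ℝ, ∀ i j, |G.grad Ψ i j| ≤ C
  moment : Summable fun i => (G.graph.dist o i : ℝ) ^ 2 * Real.exp (-Ψ i) * G.π i

/-- The free energy `F(ρ) = ∑ π Ψ ρ + ∑ π ρ log ρ`. -/
def freeEnergy (Ψ ρ : V → ℝ) : ℝ :=
  ∑' i, G.π i * Ψ i * ρ i + ∑' i, G.π i * ρ i * Real.log (ρ i)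

/-- The Gibbs density `exp (-Ψ i) / K` with `K = ∑ j, π j exp (-Ψ j)`. -/
def gibbs (Ψ : V → ℝ) (i : V) : ℝ := Real.exp (-Ψ i) / ∑' j, G.π j * Real.exp (-Ψ j)

/-- The right-hand side `div_G (ρ ∇_G Ψ) + Δ_G ρ` of the Fokker-Planck equation. -/
def fokkerPlanck (Ψ ρ : V → ℝ) (i : V) : ℝ := G.wdiv ρ (G.grad Ψ) i + G.lap ρ i

/-- `ρ` is a global solution in `P0star` of the Fokker-Planck equation with initial value `ρ₀`
(at time `0` the derivative is the right derivative). -/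
structure IsSolution (o : V) (Ψ ρ₀ : V → ℝ) (ρ : ℝ → V → ℝ) : Prop where
  init : ρ 0 = ρ₀
  mem : ∀ t, 0 ≤ t → ρ t ∈ G.P0star o
  eqn : ∀ t, 0 ≤ t → ∀ i,
    HasDerivWithinAt (fun s => ρ s i) (G.fokkerPlanck Ψ (ρ t) i) (Set.Ici 0) t

/-- The `ℓ^r(V, π)` norm, `r ∈ [1, ∞]`: the `L^r` norm for the measure `∑ i, π i δ_i`. -/
def lrNorm (f : V → ℝ) (r : ℝ≥0∞) : ℝ≥0∞ :=
  letI : MeasurableSpace V := ⊤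
  eLpNorm f r (Measure.sum fun i => ENNReal.ofReal (G.π i) • Measure.dirac i)

end

end WeightedGraph

/-! The logarithmic mean satisfies the chain rule `ρ̂ ∇ log ρ = ∇ρ`, so the right-hand side of the
equation is a sum of edge fluxes `q - p + c ρ̂`, where `c` is the potential difference, and equals
`-B_ρ(Ψ + 1 + log ρ)`. Algebraically this already is the gradient flow of the free energy. The
analytic content lies in making it meaningful on an infinite graph, where `log ρ` is unbounded and
the flux is not Lipschitz near zero density.

Metric. Green's formula holds for bounded test functions. The kernel of `B_ρ` is found by testing
`p` against `arctan p` (`eq_const_of_B_eq_zero`), and unbounded test functions are reached by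
truncation (`vecInner_eq_tsum`).

Well-posedness. In the variables `√ρ` the edge flux satisfies a one-sided Lipschitz estimate,
although it is not Lipschitz in `ρ` (`exists_hellinger_edge_le`). Summed against a cutoff of radius
`R`, it bounds the local Hellinger distance of two flows with the same initial value, whose edge
weights agree in the ball of radius `R`, by `O(1/R)` on bounded times (`exists_hellinger_flow_le`).
This gives uniqueness, and also convergence of the flows obtained by switching off all edges outside
growing balls. Outflow from a vertex is at most a multiple of its density, which keeps the limit
positive; uniform second moments prevent loss of mass.

Gradient flow. Tangency of the velocity requires finite dissipation at every `t > 0`, for initial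
data that need not have finite dissipation. The total edge entropy, the sum of `p log((p + q)/q)`
over oriented edges, is bounded by `K/√t` whatever its initial value (`exists_edgeEnt_flow_le`),
since mass arriving at `q` from its neighbour `p` produces a strong negative term when `q` is much
smaller than `p`. The dissipation is then `O(1 + 1/√t)`, integrable down to `t = 0`, so the solution
itself is a curve of finite action (`IsSolution.W2_lt_top`). Conversely, testing a gradient flow
with the potentials `δ_k` recovers the equation vertex by vertex.

Convergence. The functionals `∑ π ρ²/(ρ + cρ*)` have first variations with values in `[0, 1]`, so
they can be differentiated along any solution, and each of them decreases. Large `c` gives uniform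
integrability with respect to `ρ*`. The case `c = 1` gives times along which the dissipation
vanishes; every limit there is proportional to `ρ*`, and uniform integrability fixes the factor to
be 1. For `c = 1` the functional minus 1/2 dominates the squared `ℓ²` distance to `ρ*`, so
monotonicity turns convergence along a sequence into convergence for all `t → ∞`. As `π` is bounded
below, `ℓ²` convergence implies the other exponents. -/

/-! ### The logarithmic mean and the edge flux -/

/-- The analytic function `sinh y / y`. -/
noncomputable def sinhc : ℝ → ℝ := dslope Real.sinh 0

/-- The logarithmic mean of two positive numbers. -/
noncomputable def lm (p q : ℝ) : ℝ := if p = q then p else (p - q) / (Real.log p - Real.log q)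

/-- The flux along an edge with potential difference `c`, from density `q` into density `p`. -/
noncomputable def flux (c p q : ℝ) : ℝ := q - p + c * lm p q

lemma sinhc_of_ne {y : ℝ} (hy : y ≠ 0) : sinhc y = Real.sinh y / y := by
  simp [sinhc, dslope_of_ne _ hy, slope_def_field]

lemma sinhc_zero : sinhc 0 = 1 := by
  simp [sinhc]

lemma contDiff_sinhc : ContDiff ℝ 1 sinhc := by
  rw [contDiff_iff_contDiffAt]
  intro y
  by_cases hy : y = 0
  · subst hy
    have h : AnalyticAt ℝ Real.sinh 0 := Real.analyticAt_sinh
    obtain ⟨p, hp⟩ := h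
    have h2 := hp.has_fpower_series_dslope_fslope
    exact (AnalyticAt.contDiffAt ⟨_, h2⟩)
  · have h1 : ContDiffAt ℝ 1 (fun y => Real.sinh y / y) y :=
      Real.contDiff_sinh.contDiffAt.div contDiffAt_id hy
    refine h1.congr_of_eventuallyEq ?_
    filter_upwards [isOpen_ne.mem_nhds hy] with z hz using sinhc_of_ne hz

lemma lm_comm (p q : ℝ) : lm p q = lm q p := by
  unfold lm
  by_cases h : p = q
  · simp [h]
  · rw [if_neg h, if_neg (Ne.symm h), ← neg_sub q p, ← neg_sub (Real.log q), neg_div_neg_eq]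

lemma log_ne_of_ne {p q : ℝ} (hp : 0 < p) (hq : 0 < q) (h : p ≠ q) :
    Real.log p ≠ Real.log q := fun h' => h (Real.log_injOn_pos hp hq h')

lemma lm_mul_log_sub {p q : ℝ} (hp : 0 < p) (hq : 0 < q) :
    lm p q * (Real.log q - Real.log p) = q - p := by
  unfold lm
  split_ifs with h
  · simp [h]
  · have : Real.log p - Real.log q ≠ 0 := sub_ne_zero.2 (log_ne_of_ne hp hq h)
    field_simp
    ring

/-- Geometric mean times an entire function of the log-ratio: this form has no singularity on the
diagonal and yields the smoothness of `lm`. -/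
lemma lm_eq_exp_mul_sinhc {p q : ℝ} (hp : 0 < p) (hq : 0 < q) :
    lm p q = Real.exp ((Real.log p + Real.log q) / 2) * sinhc ((Real.log q - Real.log p) / 2) := by
  unfold lm
  split_ifs with h
  · subst h
    simp [sinhc_zero, Real.exp_log hp]
  · have hne : Real.log q - Real.log p ≠ 0 := sub_ne_zero.2 (log_ne_of_ne hq hp (Ne.symm h))
    rw [sinhc_of_ne (by simpa using hne), Real.sinh_eq]
    have e1 : Real.exp ((Real.log p + Real.log q) / 2) * Real.exp ((Real.log q - Real.log p) / 2)
        = q := by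
      rw [← Real.exp_add]; ring_nf; exact Real.exp_log hq
    have e2 : Real.exp ((Real.log p + Real.log q) / 2) * Real.exp (-((Real.log q - Real.log p) / 2))
        = p := by
      rw [← Real.exp_add]; ring_nf; exact Real.exp_log hp
    rw [← mul_div_assoc, ← mul_div_assoc, mul_sub, e1, e2, ← neg_sub q p, ← neg_sub (Real.log q),
      neg_div_neg_eq]
    field_simp

lemma lm_pos {p q : ℝ} (hp : 0 < p) (hq : 0 < q) : 0 < lm p q := by
  unfold lm
  split_ifs with h
  · exact hp
  · rcases lt_or_gt_of_ne h with h | h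
    · exact div_pos_of_neg_of_neg (by linarith) (by linarith [Real.log_lt_log hp h])
    · exact div_pos (by linarith) (by linarith [Real.log_lt_log hq h])

lemma lm_le_right_of_le {p q : ℝ} (hp : 0 < p) (hq : 0 < q) (h : p ≤ q) : lm p q ≤ q := by
  rcases h.eq_or_lt with rfl | h
  · simp [lm]
  · have h0 : 0 < Real.log q - Real.log p := by linarith [Real.log_lt_log hp h]
    have h1 := lm_mul_log_sub hp hq
    have h2 : 1 - p / q ≤ Real.log q - Real.log p := by
      rw [← Real.log_div hq.ne' hp.ne']
      have := Real.one_sub_inv_le_log_of_pos (div_pos hq hp)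
      rwa [inv_div] at this
    have h3 : q - p ≤ q * (Real.log q - Real.log p) := by
      calc q - p = q * (1 - p / q) := by field_simp
        _ ≤ _ := by gcongr
    nlinarith

lemma lm_le_max {p q : ℝ} (hp : 0 < p) (hq : 0 < q) : lm p q ≤ max p q := by
  rcases le_total p q with h | h
  · exact (lm_le_right_of_le hp hq h).trans (le_max_right _ _)
  · rw [lm_comm]; exact (lm_le_right_of_le hq hp h).trans (le_max_left _ _)

lemma lm_le_add {p q : ℝ} (hp : 0 < p) (hq : 0 < q) : lm p q ≤ p + q :=
  (lm_le_max hp hq).trans (max_le (by linarith) (by linarith))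

/-- If `q ≥ e^{2C} p`, the log-ratio is at least `2C`, so `2C lm ≤ q - p`. Otherwise `lm` is at most
`max p q ≤ e^{2C} p`. The factor 1/2 in front of `q` leaves half of the diffusive inflow to spare.
-/
lemma mul_lm_le {C p q : ℝ} (hC : 0 ≤ C) (hp : 0 < p) (hq : 0 < q) :
    C * lm p q ≤ q / 2 + C * Real.exp (2 * C) * p := by
  rcases hC.eq_or_lt with rfl | hC'
  · simp; positivity
  by_cases h : p * Real.exp (2 * C) ≤ q
  · have h1 : 2 * C ≤ Real.log q - Real.log p := by
      have := Real.log_le_log (by positivity) h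
      rw [Real.log_mul hp.ne' (Real.exp_pos _).ne', Real.log_exp] at this
      linarith
    have h2 := lm_mul_log_sub hp hq
    have h3 := lm_pos hp hq
    have : 0 ≤ C * Real.exp (2 * C) * p := by positivity
    nlinarith
  · push Not at h
    have h1 : lm p q ≤ p * Real.exp (2 * C) := by
      refine (lm_le_max hp hq).trans (max_le ?_ h.le)
      have : 1 ≤ Real.exp (2 * C) := Real.one_le_exp (by linarith)
      nlinarith
    have : C * lm p q ≤ C * (p * Real.exp (2 * C)) := by gcongr
    nlinarith

lemma flux_neg (c p q : ℝ) : flux (-c) q p = -flux c p q := by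
  unfold flux; rw [lm_comm]; ring

lemma flux_eq_mul {c p q : ℝ} (hp : 0 < p) (hq : 0 < q) :
    flux c p q = lm p q * (c + (Real.log q - Real.log p)) := by
  rw [mul_add, lm_mul_log_sub hp hq, flux]; ring

lemma abs_flux_le {C c p q : ℝ} (hc : |c| ≤ C) (hp : 0 < p) (hq : 0 < q) :
    |flux c p q| ≤ (1 + C) * (p + q) := by
  have h1 : |c * lm p q| ≤ C * (p + q) := by
    rw [abs_mul, abs_of_pos (lm_pos hp hq)]
    exact mul_le_mul hc (lm_le_add hp hq) (lm_pos hp hq).le ((abs_nonneg _).trans hc)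
  have h2 : |q - p| ≤ p + q := by rw [abs_le]; constructor <;> linarith
  calc _ ≤ |q - p| + |c * lm p q| := abs_add_le _ _
    _ ≤ _ := by linarith

/-- The rate constant bounding the outflow along an edge. -/
noncomputable def rateBound (C : ℝ) : ℝ := 1 + C * Real.exp (2 * C)

lemma rateBound_pos {C : ℝ} (hC : 0 ≤ C) : 0 < rateBound C := by
  unfold rateBound; positivity

/-- Whatever the sign of the drift, half of the inflow `q` survives and the loss is charged to `p`
alone. This drives positivity, the edge entropy estimate and the spreading of positivity in the
limit. -/
lemma le_flux {C c p q : ℝ} (hc : |c| ≤ C) (hp : 0 < p) (hq : 0 < q) :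
    q / 2 - rateBound C * p ≤ flux c p q := by
  have h1 := mul_lm_le ((abs_nonneg _).trans hc) hp hq
  have h2 : -(C * lm p q) ≤ c * lm p q := by
    have := lm_pos hp hq
    have := neg_le_of_abs_le hc
    nlinarith
  unfold flux rateBound
  linarith

lemma neg_le_flux {C c p q : ℝ} (hc : |c| ≤ C) (hp : 0 < p) (hq : 0 < q) :
    -(rateBound C * p) ≤ flux c p q := by
  linarith [le_flux hc hp hq]

lemma contDiffOn_lm : ContDiffOn ℝ 1 (fun x : ℝ × ℝ => lm x.1 x.2) (Set.Ioi 0 ×ˢ Set.Ioi 0) := by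
  have h1 : ContDiffOn ℝ 1 (fun x : ℝ × ℝ => Real.log x.1) (Set.Ioi 0 ×ˢ Set.Ioi 0) :=
    contDiffOn_fst.log fun x hx => (ne_of_gt hx.1)
  have h2 : ContDiffOn ℝ 1 (fun x : ℝ × ℝ => Real.log x.2) (Set.Ioi 0 ×ˢ Set.Ioi 0) :=
    contDiffOn_snd.log fun x hx => (ne_of_gt hx.2)
  have h3 : ContDiffOn ℝ 1 (fun x : ℝ × ℝ => Real.exp ((Real.log x.1 + Real.log x.2) / 2) *
      sinhc ((Real.log x.2 - Real.log x.1) / 2)) (Set.Ioi 0 ×ˢ Set.Ioi 0) :=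
    (((h1.add h2).div_const 2).exp).mul (contDiff_sinhc.comp_contDiffOn ((h2.sub h1).div_const 2))
  exact h3.congr fun x hx => lm_eq_exp_mul_sinhc hx.1 hx.2

lemma contDiffOn_flux (c : ℝ) :
    ContDiffOn ℝ 1 (fun x : ℝ × ℝ => flux c x.1 x.2) (Set.Ioi 0 ×ˢ Set.Ioi 0) :=
  (contDiffOn_snd.sub contDiffOn_fst).add (contDiffOn_const.mul contDiffOn_lm)

lemma Filter.Tendsto.flux {α : Type*} {l : Filter α} {f g : α → ℝ} {c p q : ℝ} (hp : 0 < p)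
    (hq : 0 < q) (hf : Tendsto f l (𝓝 p)) (hg : Tendsto g l (𝓝 q)) :
    Tendsto (fun x => flux c (f x) (g x)) l (𝓝 (_root_.flux c p q)) := by
  have h : ContinuousAt (fun x : ℝ × ℝ => _root_.flux c x.1 x.2) (p, q) :=
    (contDiffOn_flux c).continuousOn.continuousAt
      ((isOpen_Ioi.prod isOpen_Ioi).mem_nhds ⟨hp, hq⟩)
  exact h.tendsto.comp (hf.prodMk_nhds hg)

/-! ### One-sided Lipschitz estimates in Hellinger coordinates -/

/-- The flux in Hellinger coordinates as a function of the logarithm of the ratio. -/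
noncomputable def fluxRatio (c y : ℝ) : ℝ := 2 * Real.sinh y + c * sinhc y

/-- The flux is homogeneous of degree one, so with `p = a²`, `q = b²` it is `ab` times a function of
the log-ratio only. -/
lemma flux_sq {c a b : ℝ} (ha : 0 < a) (hb : 0 < b) :
    flux c (a ^ 2) (b ^ 2) = a * b * fluxRatio c (Real.log b - Real.log a) := by
  have h1 : lm (a ^ 2) (b ^ 2) = a * b * sinhc (Real.log b - Real.log a) := by
    rw [lm_eq_exp_mul_sinhc (by positivity) (by positivity), Real.log_pow, Real.log_pow]
    congr 1
    · rw [show ((2 : ℕ) * Real.log a + (2 : ℕ) * Real.log b) / 2 = Real.log a + Real.log b by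
        push_cast; ring, Real.exp_add, Real.exp_log ha, Real.exp_log hb]
    · congr 1; push_cast; ring
  have h2 : b ^ 2 - a ^ 2 = a * b * (2 * Real.sinh (Real.log b - Real.log a)) := by
    rw [Real.sinh_eq, neg_sub, Real.exp_sub, Real.exp_sub, Real.exp_log ha, Real.exp_log hb]
    field_simp
  rw [flux, h1, h2, fluxRatio]; ring

lemma abs_deriv_sinhc_le {y : ℝ} (hy : y ≠ 0) : |deriv sinhc y| ≤ Real.cosh y / |y| := by
  have h1 : deriv sinhc y = (Real.cosh y * y - Real.sinh y) / y ^ 2 := by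
    have : HasDerivAt (fun y => Real.sinh y / y) ((Real.cosh y * y - Real.sinh y * 1) / y ^ 2) y :=
      (Real.hasDerivAt_sinh y).div (hasDerivAt_id y) hy
    rw [mul_one] at this
    refine (this.congr_of_eventuallyEq ?_).deriv
    filter_upwards [isOpen_ne.mem_nhds hy] with z hz using sinhc_of_ne hz
  have key : ∀ z : ℝ, 0 ≤ z → Real.sinh z ≤ 2 * (z * Real.cosh z) := by
    intro z hz
    rw [Real.sinh_eq, Real.cosh_eq]
    have h2 : 1 - 2 * z ≤ Real.exp (-(2 * z)) := by
      linarith [Real.add_one_le_exp (-(2 * z))]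
    have h3 : Real.exp (-z) = Real.exp z * Real.exp (-(2 * z)) := by
      rw [← Real.exp_add]; ring_nf
    have h4 : Real.exp z * (1 - 2 * z) ≤ Real.exp (-z) := by rw [h3]; gcongr
    have := mul_nonneg hz (Real.exp_pos (-z)).le
    linarith
  have key2 : |Real.cosh y * y - Real.sinh y| ≤ |y| * Real.cosh y := by
    have hc := Real.cosh_pos y
    rcases le_total 0 y with h | h
    · have := key y h
      have := Real.sinh_nonneg_iff.2 h
      rw [abs_of_nonneg h, abs_le]; constructor <;> nlinarith
    · have := key (-y) (by linarith)
      rw [Real.sinh_neg, Real.cosh_neg] at this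
      have := Real.sinh_nonpos_iff.2 h
      rw [abs_of_nonpos h, abs_le]; constructor <;> nlinarith
  rw [h1, abs_div, abs_of_nonneg (sq_nonneg y), ← sq_abs y]
  have hy' : 0 < |y| := abs_pos.2 hy
  rw [div_le_div_iff₀ (by positivity) hy']
  nlinarith

/-- Since `|sinhc' y| ≤ cosh y / |y|`, the derivative `2 cosh y` of the diffusive part wins once
`|y| > C/2`. On the remaining compact interval `sinhc'` is bounded by `L`, and the logistic
function, whose slope there is at least `1/(4 e^C)`, compensates. The logistic correction is chosen
because at `y = log(b/a)` it equals `b/(a + b)`. -/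
lemma exists_monotone_fluxRatio (C : ℝ) : ∃ K : ℝ, 0 ≤ K ∧ ∀ c : ℝ, |c| ≤ C →
    Monotone fun y => fluxRatio c y + K * (Real.exp y / (1 + Real.exp y)) := by
  have hcont : Continuous (deriv sinhc) := contDiff_sinhc.continuous_deriv le_rfl
  obtain ⟨L, hL⟩ := (isCompact_Icc (a := -(C / 2)) (b := C / 2)).exists_bound_of_continuousOn
    hcont.continuousOn
  refine ⟨|C| * |L| * (4 * Real.exp |C|), by positivity, fun c hc => ?_⟩
  set K := |C| * |L| * (4 * Real.exp |C|) with hK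
  have hC : 0 ≤ C := (abs_nonneg _).trans hc
  have hd : ∀ y, HasDerivAt (fun y => fluxRatio c y + K * (Real.exp y / (1 + Real.exp y)))
      (2 * Real.cosh y + c * deriv sinhc y + K * (Real.exp y / (1 + Real.exp y) ^ 2)) y := by
    intro y
    have h1 := (contDiff_sinhc.differentiable (by simp) y).hasDerivAt
    have h2 : HasDerivAt (fun y => Real.exp y / (1 + Real.exp y))
      ((Real.exp y * (1 + Real.exp y) - Real.exp y * Real.exp y) / (1 + Real.exp y) ^ 2) y :=
      (Real.hasDerivAt_exp y).div ((Real.hasDerivAt_exp y).const_add 1) (by positivity)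
    rw [show Real.exp y * (1 + Real.exp y) - Real.exp y * Real.exp y = Real.exp y by ring] at h2
    have h3 := ((((Real.hasDerivAt_sinh y).const_mul 2).add (h1.const_mul c)).add (h2.const_mul K))
    exact h3
  refine monotone_of_deriv_nonneg (fun y => (hd y).differentiableAt) fun y => ?_
  rw [(hd y).deriv]
  have hcosh := Real.one_le_cosh y
  have hK0 : 0 ≤ K := by positivity
  have hb : -(C * |deriv sinhc y|) ≤ c * deriv sinhc y := by
    have := neg_abs_le (c * deriv sinhc y)
    rw [abs_mul] at this
    nlinarith [abs_nonneg (deriv sinhc y)]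
  by_cases hy : |y| ≤ C / 2
  · have h1 : |deriv sinhc y| ≤ |L| := (hL y (abs_le.1 hy)).trans (le_abs_self L)
    have h2 : 1 / (4 * Real.exp |C|) ≤ Real.exp y / (1 + Real.exp y) ^ 2 := by
      rw [div_le_div_iff₀ (by positivity) (by positivity)]
      have hCe : |C| = C := abs_of_nonneg hC
      have hy1 := abs_le.1 hy
      rcases le_total 0 y with h | h
      · have e1 : 1 ≤ Real.exp y := Real.one_le_exp h
        have e2 : Real.exp y ≤ Real.exp |C| := Real.exp_le_exp.2 (by linarith)
        nlinarith
      · have e1 : Real.exp y ≤ 1 := Real.exp_le_one_iff.2 h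
        have e2 : 1 ≤ Real.exp y * Real.exp |C| := by
          rw [← Real.exp_add]; exact Real.one_le_exp (by linarith)
        nlinarith [Real.exp_pos y]
    have h3 : |C| * |L| ≤ K * (Real.exp y / (1 + Real.exp y) ^ 2) := by
      calc |C| * |L| = K * (1 / (4 * Real.exp |C|)) := by rw [hK]; field_simp
        _ ≤ _ := by gcongr
    have h4 : C * |deriv sinhc y| ≤ |C| * |L| := by
      rw [abs_of_nonneg hC]; gcongr
    linarith
  · push Not at hy
    have hy0 : 0 < |y| := by linarith
    have h1 := abs_deriv_sinhc_le (abs_pos.1 hy0)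
    have h2 : C * |deriv sinhc y| ≤ 2 * Real.cosh y := by
      calc C * |deriv sinhc y| ≤ C * (Real.cosh y / |y|) := by gcongr
        _ = C / |y| * Real.cosh y := by ring
        _ ≤ 2 * Real.cosh y := by
          gcongr
          rw [div_le_iff₀ hy0]; linarith
    have : 0 ≤ K * (Real.exp y / (1 + Real.exp y) ^ 2) := by positivity
    linarith

/-- The left side is `-d (fluxRatio y - fluxRatio y')` with `d = a'b - ab'`, which has the sign of
`y - y'`. Up to the logistic correction `fluxRatio` is monotone, so only that correction
contributes, and its increment is exactly `d / ((a + b)(a' + b'))`. -/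
lemma exists_hellinger_edge_le (C : ℝ) : ∃ K : ℝ, 0 ≤ K ∧ ∀ c : ℝ, |c| ≤ C →
    ∀ a b a' b' : ℝ, 0 < a → 0 < b → 0 < a' → 0 < b' →
      (a - a') * (flux c (a ^ 2) (b ^ 2) / a - flux c (a' ^ 2) (b' ^ 2) / a') -
        (b - b') * (flux c (a ^ 2) (b ^ 2) / b - flux c (a' ^ 2) (b' ^ 2) / b') ≤
      K * ((a - a') ^ 2 + (b - b') ^ 2) := by
  obtain ⟨K, hK0, hK⟩ := exists_monotone_fluxRatio C
  refine ⟨K, hK0, fun c hc a b a' b' ha hb ha' hb' => ?_⟩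
  rw [flux_sq ha hb, flux_sq ha' hb']
  set y := Real.log b - Real.log a with hy
  set y' := Real.log b' - Real.log a' with hy'
  have hey : Real.exp y / (1 + Real.exp y) = b / (a + b) := by
    rw [hy, Real.exp_sub, Real.exp_log ha, Real.exp_log hb]; field_simp
  have hey' : Real.exp y' / (1 + Real.exp y') = b' / (a' + b') := by
    rw [hy', Real.exp_sub, Real.exp_log ha', Real.exp_log hb']; field_simp
  have hT : (a - a') * (a * b * fluxRatio c y / a - a' * b' * fluxRatio c y' / a') -
        (b - b') * (a * b * fluxRatio c y / b - a' * b' * fluxRatio c y' / b') =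
      -((a' * b - a * b') * (fluxRatio c y - fluxRatio c y')) := by
    field_simp; ring
  rw [hT]
  set d := a' * b - a * b' with hd
  have hdiff : b / (a + b) - b' / (a' + b') = d / ((a + b) * (a' + b')) := by
    rw [hd]; field_simp; ring
  have hle : -(d * (fluxRatio c y - fluxRatio c y')) ≤ K * (d ^ 2 / ((a + b) * (a' + b'))) := by
    have hmono := hK c hc
    have e : K * (d ^ 2 / ((a + b) * (a' + b'))) =
        d * (K * (b / (a + b)) - K * (b' / (a' + b'))) := by
      rw [← mul_sub, hdiff]; ring
    rw [e]
    rcases le_total y y' with h | h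
    · have h1 := hmono h
      simp only [hey, hey'] at h1
      have h2 : d ≤ 0 := by
        have : b / a ≤ b' / a' := by
          rw [← Real.log_le_log_iff (by positivity) (by positivity), Real.log_div hb.ne' ha.ne',
            Real.log_div hb'.ne' ha'.ne']
          exact h
        rw [div_le_div_iff₀ ha ha'] at this
        rw [hd]; linarith
      nlinarith
    · have h1 := hmono h
      simp only [hey, hey'] at h1
      have h2 : 0 ≤ d := by
        have : b' / a' ≤ b / a := by
          rw [← Real.log_le_log_iff (by positivity) (by positivity), Real.log_div hb.ne' ha.ne',
            Real.log_div hb'.ne' ha'.ne']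
          exact h
        rw [div_le_div_iff₀ ha' ha] at this
        rw [hd]; linarith
      nlinarith
  refine hle.trans ?_
  gcongr
  rw [div_le_iff₀ (by positivity)]
  -- Two expansions of `d`, one with coefficients `a, b` and one with `a', b'`, cancel both factors
  -- of the denominator.
  set m := max |a - a'| |b - b'| with hm
  have hu : |a - a'| ≤ m := le_max_left _ _
  have hv : |b - b'| ≤ m := le_max_right _ _
  have hm0 : 0 ≤ m := (abs_nonneg _).trans hu
  have hm2 : m ^ 2 ≤ (a - a') ^ 2 + (b - b') ^ 2 := by
    rcases max_cases |a - a'| |b - b'| with h | h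
    · rw [hm, h.1, sq_abs]; nlinarith [sq_nonneg (b - b')]
    · rw [hm, h.1, sq_abs]; nlinarith [sq_nonneg (a - a')]
  have hd1 : |d| ≤ (a + b) * m := by
    have : d = a * (b - b') - b * (a - a') := by rw [hd]; ring
    rw [this]
    calc _ ≤ |a * (b - b')| + |b * (a - a')| := abs_sub _ _
      _ = a * |b - b'| + b * |a - a'| := by rw [abs_mul, abs_mul, abs_of_pos ha, abs_of_pos hb]
      _ ≤ _ := by nlinarith
  have hd2 : |d| ≤ (a' + b') * m := by
    have : d = a' * (b - b') - b' * (a - a') := by rw [hd]; ring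
    rw [this]
    calc _ ≤ |a' * (b - b')| + |b' * (a - a')| := abs_sub _ _
      _ = a' * |b - b'| + b' * |a - a'| := by rw [abs_mul, abs_mul, abs_of_pos ha', abs_of_pos hb']
      _ ≤ _ := by nlinarith
  calc d ^ 2 = |d| * |d| := by rw [← sq_abs, sq]
    _ ≤ ((a + b) * m) * ((a' + b') * m) := by gcongr
    _ = m ^ 2 * ((a + b) * (a' + b')) := by ring
    _ ≤ _ := by gcongr

/-- Crude one-sided bound by masses for one endpoint alone. It is needed when a cutoff takes
different values at the two ends of an edge and the cancellation between the ends is incomplete. The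
dangerous quotients `F/a` enter with a minus sign, so a lower bound for the flux suffices. -/
lemma hellinger_vertex_le {C c a b a' b' : ℝ} (hc : |c| ≤ C) (ha : 0 < a) (hb : 0 < b)
    (ha' : 0 < a') (hb' : 0 < b') :
    (a - a') * (flux c (a ^ 2) (b ^ 2) / a - flux c (a' ^ 2) (b' ^ 2) / a') ≤
      (1 + C + rateBound C) * (a ^ 2 + b ^ 2 + (a' ^ 2 + b' ^ 2)) := by
  have h1 := (abs_le.1 (abs_flux_le hc (pow_pos ha 2) (pow_pos hb 2))).2
  have h2 := (abs_le.1 (abs_flux_le hc (pow_pos ha' 2) (pow_pos hb' 2))).2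
  have h3 := neg_le_flux hc (pow_pos ha 2) (pow_pos hb 2)
  have h4 := neg_le_flux hc (pow_pos ha' 2) (pow_pos hb' 2)
  set F := flux c (a ^ 2) (b ^ 2)
  set F' := flux c (a' ^ 2) (b' ^ 2)
  set M := rateBound C with hM
  have hM0 : 0 < M := rateBound_pos ((abs_nonneg _).trans hc)
  have e : (a - a') * (F / a - F' / a') = F + F' - a' * (F / a) - a * (F' / a') := by
    field_simp
    ring
  have h5 : -(M * a) ≤ F / a := by
    rw [le_div_iff₀ ha]; nlinarith
  have h6 : -(M * a') ≤ F' / a' := by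
    rw [le_div_iff₀ ha']; nlinarith
  have h7 : a' * (-(M * a)) ≤ a' * (F / a) := by gcongr
  have h8 : a * (-(M * a')) ≤ a * (F' / a') := by gcongr
  rw [e]
  nlinarith [mul_nonneg hM0.le (sq_nonneg (a - a')), mul_nonneg hM0.le (sq_nonneg b),
    mul_nonneg hM0.le (sq_nonneg b')]

namespace WeightedGraph

noncomputable section

variable {V : Type*} (G : WeightedGraph V)

/-! ### Weights and sums over edges -/

lemma mem_nbr {i j : V} : j ∈ G.nbr i ↔ G.graph.Adj i j := by
  simp [nbr]

lemma omega_nonneg (i j : V) : 0 ≤ G.ω i j := by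
  by_cases h : G.graph.Adj i j
  · obtain ⟨l, hl, h'⟩ := G.ω_lower
    exact hl.le.trans (h' i j h)
  · rw [G.ω_zero i j h]

lemma omega_eq_zero {i j : V} (h : j ∉ G.nbr i) : G.ω i j = 0 :=
  G.ω_zero i j fun h' => h (G.mem_nbr.2 h')

lemma omega_le_pi (i j : V) : G.ω i j ≤ G.π i := by
  by_cases h : j ∈ G.nbr i
  · exact Finset.single_le_sum (f := fun j => G.ω i j) (fun k _ => G.omega_nonneg i k) h
  · rw [G.omega_eq_zero h]
    exact Finset.sum_nonneg fun k _ => G.omega_nonneg i k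

lemma exists_pi_lower [Nontrivial V] (hconn : G.graph.Connected) :
    ∃ l : ℝ, 0 < l ∧ (∀ i j, G.graph.Adj i j → l ≤ G.ω i j) ∧ ∀ i, l ≤ G.π i := by
  obtain ⟨l, hl, h⟩ := G.ω_lower
  refine ⟨l, hl, h, fun i => ?_⟩
  obtain ⟨j, hj⟩ := hconn.preconnected.exists_adj_of_nontrivial i
  exact (h i j hj).trans (G.omega_le_pi i j)

lemma exists_pi_upper : ∃ P : ℝ, 0 < P ∧ ∀ i, G.π i ≤ P := by
  obtain ⟨L, hL⟩ := G.ω_upper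
  obtain ⟨N, hN⟩ := G.nbr_bound
  refine ⟨N * |L| + 1, by positivity, fun i => ?_⟩
  have h1 : G.π i ≤ (G.nbr i).card • |L| :=
    Finset.sum_le_card_nsmul _ _ _ fun j _ => (hL i j).trans (le_abs_self L)
  have h2 : ((G.nbr i).card : ℝ) ≤ N := by exact_mod_cast hN i
  rw [nsmul_eq_mul] at h1
  nlinarith [abs_nonneg L]

lemma pi_pos [Nontrivial V] (hconn : G.graph.Connected) (i : V) : 0 < G.π i := by
  obtain ⟨l, hl, -, h⟩ := G.exists_pi_lower hconn
  exact hl.trans_le (h i)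

lemma hasSum_row {f : V → V → ℝ} (i : V) (hf : ∀ j, j ∉ G.nbr i → f i j = 0) :
    HasSum (f i) (∑ j ∈ G.nbr i, f i j) :=
  hasSum_sum_of_ne_finset_zero hf

lemma hasSum_omega_row (g : V → ℝ) (i : V) :
    HasSum (fun j => G.ω i j * g i) (g i * G.π i) := by
  have h := G.hasSum_row (f := fun i j => G.ω i j * g i) i
    (fun j hj => by rw [G.omega_eq_zero hj, zero_mul])
  rwa [← Finset.sum_mul, mul_comm] at h

lemma hasSum_rows {f : V → V → ℝ} (hf : ∀ i j, j ∉ G.nbr i → f i j = 0)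
    (hs : Summable fun e : V × V => f e.1 e.2) :
    HasSum (fun i => ∑ j ∈ G.nbr i, f i j) (∑' e : V × V, f e.1 e.2) :=
  hs.hasSum.prod_fiberwise fun i => G.hasSum_row i (hf i)

lemma summable_omega_fst {g : V → ℝ} (hg : ∀ i, 0 ≤ g i) (hs : Summable fun i => g i * G.π i) :
    Summable fun e : V × V => G.ω e.1 e.2 * g e.1 := by
  refine (summable_prod_of_nonneg fun e => mul_nonneg (G.omega_nonneg _ _) (hg _)).2
    ⟨fun i => (G.hasSum_omega_row g i).summable, ?_⟩
  exact hs.congr fun i => (G.hasSum_omega_row g i).tsum_eq.symm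

lemma summable_omega_snd {g : V → ℝ} (hg : ∀ i, 0 ≤ g i) (hs : Summable fun i => g i * G.π i) :
    Summable fun e : V × V => G.ω e.1 e.2 * g e.2 := by
  have h := (Equiv.prodComm V V).summable_iff.2 (G.summable_omega_fst hg hs)
  refine h.congr fun e => ?_
  simp [G.ω_symm e.2 e.1]

lemma tsum_omega_fst {g : V → ℝ} (hg : ∀ i, 0 ≤ g i) (hs : Summable fun i => g i * G.π i) :
    ∑' e : V × V, G.ω e.1 e.2 * g e.1 = ∑' i, g i * G.π i := by
  have h := (G.summable_omega_fst hg hs).hasSum.prod_fiberwise fun i => G.hasSum_omega_row g i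
  exact h.tsum_eq.symm

/-! ### The logarithmic mean on edges -/

section
variable {ρ : V → ℝ}

lemma logMean_of_adj (hρ : ∀ i, 0 < ρ i) {i j : V} (h : G.graph.Adj i j) :
    G.logMean ρ i j = lm (ρ i) (ρ j) := by
  simp [logMean, lm, h, hρ i, hρ j]

lemma logMean_nonneg (ρ : V → ℝ) (i j : V) : 0 ≤ G.logMean ρ i j := by
  unfold logMean
  split_ifs with h h'
  · exact h.2.1.le
  · have := lm_pos h.2.1 h.2.2
    rw [lm, if_neg h'] at this
    exact this.le
  · exact le_rfl

lemma logMean_pos (hρ : ∀ i, 0 < ρ i) {i j : V} (h : G.graph.Adj i j) : 0 < G.logMean ρ i j := by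
  rw [G.logMean_of_adj hρ h]
  exact lm_pos (hρ i) (hρ j)

lemma logMean_symm (ρ : V → ℝ) (i j : V) : G.logMean ρ i j = G.logMean ρ j i := by
  have h := lm_comm (ρ i) (ρ j)
  unfold lm at h
  unfold logMean
  by_cases h1 : G.graph.Adj i j ∧ 0 < ρ i ∧ 0 < ρ j
  · have h2 : G.graph.Adj j i ∧ 0 < ρ j ∧ 0 < ρ i := ⟨h1.1.symm, h1.2.2, h1.2.1⟩
    exact ((if_pos h1).trans h).trans (if_pos h2).symm
  · rw [if_neg h1, if_neg fun h2 => h1 ⟨h2.1.symm, h2.2.2, h2.2.1⟩]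

lemma logMean_le_add (hρ : ∀ i, 0 < ρ i) (i j : V) : G.logMean ρ i j ≤ ρ i + ρ j := by
  by_cases h : G.graph.Adj i j
  · rw [G.logMean_of_adj hρ h]; exact lm_le_add (hρ i) (hρ j)
  · simp only [logMean, h, false_and, if_false]
    linarith [hρ i, hρ j]

lemma grad_of_adj (p : V → ℝ) {i j : V} (h : G.graph.Adj i j) : G.grad p i j = p j - p i := by
  simp [grad, h]

lemma grad_neg_symm (p : V → ℝ) (i j : V) : G.grad p i j = - G.grad p j i := by
  by_cases h : G.graph.Adj i j
  · rw [G.grad_of_adj p h, G.grad_of_adj p h.symm]; ring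
  · have h' : ¬ G.graph.Adj j i := fun h' => h h'.symm
    simp [grad, h, h']

lemma omega_mul_grad (p : V → ℝ) (i j : V) : G.ω i j * G.grad p i j = G.ω i j * (p j - p i) := by
  by_cases h : G.graph.Adj i j
  · rw [G.grad_of_adj p h]
  · rw [G.ω_zero i j h]; simp

lemma B_mul_pi (hπ : ∀ i, 0 < G.π i) (ρ p : V → ℝ) (i : V) :
    G.B ρ p i * G.π i = ∑ j ∈ G.nbr i, -(G.ω i j * G.grad p i j * G.logMean ρ i j) := by
  rw [B, wdiv, ← Finset.sum_neg_distrib, Finset.sum_mul]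
  refine Finset.sum_congr rfl fun j _ => ?_
  have := (hπ i).ne'
  field_simp

lemma B_add_const (ρ p : V → ℝ) (c : ℝ) : G.B ρ (fun i => p i + c) = G.B ρ p := by
  have : G.grad (fun i => p i + c) = G.grad p := by
    funext i j; simp [grad]
  funext i
  simp [B, this]

lemma B_neg (ρ p : V → ℝ) : G.B ρ (fun i => - p i) = fun i => - G.B ρ p i := by
  funext i
  simp only [B, wdiv, neg_neg]
  rw [← Finset.sum_neg_distrib]
  refine Finset.sum_congr rfl fun j hj => ?_
  rw [G.grad_of_adj _ (G.mem_nbr.1 hj), G.grad_of_adj _ (G.mem_nbr.1 hj)]; ring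

lemma B_sub (ρ p q : V → ℝ) : G.B ρ (fun i => p i - q i) = fun i => G.B ρ p i - G.B ρ q i := by
  funext i
  simp only [B, wdiv]
  rw [neg_sub_neg, ← Finset.sum_sub_distrib, ← Finset.sum_neg_distrib]
  refine Finset.sum_congr rfl fun j hj => ?_
  simp only [G.grad_of_adj _ (G.mem_nbr.1 hj)]; ring

lemma summable_omega_logMean (hρ : ρ ∈ G.P0) :
    Summable fun e : V × V => G.ω e.1 e.2 * G.logMean ρ e.1 e.2 := by
  have h1 := G.summable_omega_fst (fun i => (hρ.1 i).le) hρ.2.summable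
  have h2 := G.summable_omega_snd (fun i => (hρ.1 i).le) hρ.2.summable
  refine Summable.of_nonneg_of_le
    (fun e => mul_nonneg (G.omega_nonneg _ _) (G.logMean_nonneg _ _ _)) (fun e => ?_) (h1.add h2)
  rw [← mul_add]
  exact mul_le_mul_of_nonneg_left (G.logMean_le_add hρ.1 _ _) (G.omega_nonneg _ _)

lemma summable_mul_of_sq {a b : V × V → ℝ}
    (ha : Summable fun e : V × V => G.ω e.1 e.2 * a e ^ 2 * G.logMean ρ e.1 e.2)
    (hb : Summable fun e : V × V => G.ω e.1 e.2 * b e ^ 2 * G.logMean ρ e.1 e.2) :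
    Summable fun e : V × V => G.ω e.1 e.2 * a e * b e * G.logMean ρ e.1 e.2 := by
  refine Summable.of_norm_bounded (ha.add hb) fun e => ?_
  have h1 := G.omega_nonneg e.1 e.2
  have h2 := G.logMean_nonneg ρ e.1 e.2
  have h3 : |a e * b e| ≤ a e ^ 2 + b e ^ 2 := by
    rw [abs_le]; constructor <;> nlinarith [sq_nonneg (a e + b e), sq_nonneg (a e - b e)]
  rw [Real.norm_eq_abs, mul_assoc (G.ω e.1 e.2), abs_mul, abs_mul, abs_of_nonneg h1,
    abs_of_nonneg h2, ← add_mul, ← mul_add]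
  gcongr

lemma summable_omega_mul_logMean (hρ : ρ ∈ G.P0) {a : V × V → ℝ}
    (ha : Summable fun e : V × V => G.ω e.1 e.2 * a e ^ 2 * G.logMean ρ e.1 e.2) :
    Summable fun e : V × V => G.ω e.1 e.2 * a e * G.logMean ρ e.1 e.2 := by
  have h := G.summable_mul_of_sq (b := fun _ => 1) ha
    (by simpa using G.summable_omega_logMean hρ)
  simpa using h

/-- Green's formula. -/
lemma hasSum_B_mul (hπ : ∀ i, 0 < G.π i) {p q : V → ℝ}
    (hs : Summable fun e : V × V => G.ω e.1 e.2 * G.grad p e.1 e.2 * q e.1 * G.logMean ρ e.1 e.2) :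
    HasSum (fun i => G.B ρ p i * q i * G.π i) (G.vecInner ρ (G.grad p) (G.grad q)) := by
  set f : V → V → ℝ := fun i j => -(G.ω i j * G.grad p i j * q i * G.logMean ρ i j) with hf
  have hs' : Summable fun e : V × V => f e.1 e.2 := hs.neg
  have h1 := G.hasSum_rows (f := f) (fun i j h => by simp [hf, G.omega_eq_zero h]) hs'
  -- Symmetrise over edge reversal: the gradient is antisymmetric and the logarithmic mean
  -- symmetric, so the values of `q` at the two ends combine into its gradient.
  have hswap : HasSum (fun e : V × V => f e.2 e.1) (∑' e : V × V, f e.1 e.2) :=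
    (Equiv.prodComm V V).hasSum_iff.2 hs'.hasSum
  have h2 := hs'.hasSum.add hswap
  have h3 : G.vecInner ρ (G.grad p) (G.grad q) = ∑' e : V × V, f e.1 e.2 := by
    have : ∀ e : V × V, f e.1 e.2 + f e.2 e.1 =
        G.ω e.1 e.2 * G.grad p e.1 e.2 * G.grad q e.1 e.2 * G.logMean ρ e.1 e.2 := by
      intro e
      simp only [hf]
      rw [G.ω_symm e.2 e.1, G.grad_neg_symm p e.2 e.1, G.logMean_symm ρ e.2 e.1]
      have := G.omega_mul_grad q e.1 e.2
      linear_combination -(G.grad p e.1 e.2 * G.logMean ρ e.1 e.2) * this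
    rw [vecInner, ← tsum_congr this, h2.tsum_eq]
    ring
  rw [h3]
  refine h1.congr_fun fun i => ?_ 
  rw [mul_right_comm, G.B_mul_pi hπ, Finset.sum_mul]
  exact Finset.sum_congr rfl fun j _ => by simp only [hf]; ring


/-! ### The metric -/

lemma potentials_sub {p q : V → ℝ} (hπ : ∀ i, 0 < G.π i) (hp : p ∈ G.potentials ρ)
    (hq : q ∈ G.potentials ρ) :
    (fun i => p i - q i) ∈ G.potentials ρ := by
  refine ⟨?_, ?_⟩
  · refine Summable.of_nonneg_of_le (fun i => mul_nonneg (abs_nonneg _) (hπ i).le) (fun i => ?_)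
      (hp.1.add hq.1)
    rw [B_sub, ← add_mul]
    exact mul_le_mul_of_nonneg_right (abs_sub _ _) (hπ i).le
  · have h : Summable fun e : V × V =>
        2 * (G.ω e.1 e.2 * G.grad p e.1 e.2 ^ 2 * G.logMean ρ e.1 e.2 +
          G.ω e.1 e.2 * G.grad q e.1 e.2 ^ 2 * G.logMean ρ e.1 e.2) :=
      (hp.2.add hq.2).mul_left 2
    refine Summable.of_nonneg_of_le (fun e => ?_) (fun e => ?_) h
    · exact mul_nonneg (mul_nonneg (G.omega_nonneg _ _) (sq_nonneg _)) (G.logMean_nonneg _ _ _)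
    · have h1 := G.omega_nonneg e.1 e.2
      have h2 := G.logMean_nonneg ρ e.1 e.2
      have h3 : G.grad (fun i => p i - q i) e.1 e.2 = G.grad p e.1 e.2 - G.grad q e.1 e.2 := by
        unfold grad; split_ifs <;> ring
      rw [h3, ← add_mul, ← mul_add, ← mul_assoc 2, ← mul_assoc 2, mul_comm 2, mul_assoc (G.ω _ _) 2]
      gcongr
      nlinarith [sq_nonneg (G.grad p e.1 e.2 + G.grad q e.1 e.2)]

/-- `ω ρ̂` has finite total mass on edges, so square integrable fields are integrable and may be
paired with bounded functions. -/
lemma summable_of_bounded {p q : V → ℝ} (hρ : ρ ∈ G.P0) (hp : G.grad p ∈ G.L2 ρ) {C : ℝ}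
    (hq : ∀ i, |q i| ≤ C) :
    Summable fun e : V × V => G.ω e.1 e.2 * G.grad p e.1 e.2 * q e.1 * G.logMean ρ e.1 e.2 := by
  have h := (G.summable_omega_mul_logMean hρ hp).norm.mul_right C
  refine Summable.of_norm_bounded h fun e => ?_
  rw [mul_right_comm, norm_mul]
  exact mul_le_mul_of_nonneg_left (hq _) (norm_nonneg _)

lemma B_mem_tangent {p : V → ℝ} (hπ : ∀ i, 0 < G.π i) (hρ : ρ ∈ G.P0)
    (hp : p ∈ G.potentials ρ) : G.B ρ p ∈ G.tangent ρ := by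
  refine ⟨⟨p, hp, rfl⟩, ?_⟩
  have hs := G.summable_of_bounded (p := p) (q := fun _ => 1) (C := 1) hρ hp.2 (by simp)
  have h := G.hasSum_B_mul (q := fun _ => 1) hπ hs
  have h0 : G.vecInner ρ (G.grad p) (G.grad fun _ => 1) = 0 := by
    simp [vecInner, grad]
  simpa [h0] using h

/-- Green's formula cannot be tested with `p` itself, which may be unbounded. Testing with `arctan
p` is legitimate, and `∇p · ∇arctan p ≥ 0` with equality only where `∇p = 0`; connectedness then
finishes. -/
lemma eq_const_of_B_eq_zero {p : V → ℝ} (hπ : ∀ i, 0 < G.π i) (hconn : G.graph.Connected)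
    (hρ : ρ ∈ G.P0) (hp : G.grad p ∈ G.L2 ρ) (h0 : ∀ i, G.B ρ p i = 0) (i j : V) :
    p i = p j := by
  set q : V → ℝ := fun i => Real.arctan (p i) with hq
  have hb : ∀ i, |q i| ≤ Real.pi / 2 := fun i =>
    abs_le.2 ⟨(Real.neg_pi_div_two_lt_arctan _).le, (Real.arctan_lt_pi_div_two _).le⟩
  have hs := G.summable_of_bounded hρ hp hb
  have h := G.hasSum_B_mul hπ hs
  have hz : G.vecInner ρ (G.grad p) (G.grad q) = 0 := by
    rw [← h.tsum_eq]; simp [h0]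
  have hnn : ∀ e : V × V, 0 ≤
      G.ω e.1 e.2 * G.grad p e.1 e.2 * G.grad q e.1 e.2 * G.logMean ρ e.1 e.2 := by
    intro e
    refine mul_nonneg ?_ (G.logMean_nonneg _ _ _)
    rw [mul_assoc]
    refine mul_nonneg (G.omega_nonneg _ _) ?_
    unfold grad
    split_ifs
    · rcases le_total (p e.1) (p e.2) with h | h
      · have := Real.arctan_strictMono.monotone h
        exact mul_nonneg (by linarith) (by simp only [hq]; linarith)
      · have := Real.arctan_strictMono.monotone h
        exact mul_nonneg_of_nonpos_of_nonpos (by linarith) (by simp only [hq]; linarith)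
    · simp
  have hsum : Summable fun e : V × V =>
      G.ω e.1 e.2 * G.grad p e.1 e.2 * G.grad q e.1 e.2 * G.logMean ρ e.1 e.2 := by
    have h := ((G.summable_omega_mul_logMean hρ hp).norm.mul_right Real.pi)
    refine Summable.of_norm_bounded h fun e => ?_
    rw [mul_right_comm, norm_mul]
    refine mul_le_mul_of_nonneg_left ?_ (norm_nonneg _)
    unfold grad
    split_ifs
    · rw [Real.norm_eq_abs]
      calc _ ≤ |q e.2| + |q e.1| := abs_sub _ _
        _ ≤ _ := by linarith [hb e.1, hb e.2]
    · simpa using Real.pi_pos.le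
  have hall : ∀ e : V × V,
      G.ω e.1 e.2 * G.grad p e.1 e.2 * G.grad q e.1 e.2 * G.logMean ρ e.1 e.2 = 0 := by
    have h1 : ∑' e : V × V,
      G.ω e.1 e.2 * G.grad p e.1 e.2 * G.grad q e.1 e.2 * G.logMean ρ e.1 e.2 = 0 := by
      unfold vecInner at hz; linarith
    have h2 := (hasSum_zero_iff_of_nonneg hnn).1 (h1 ▸ hsum.hasSum)
    exact fun e => congrFun h2 e
  have hadj : ∀ i j, G.graph.Adj i j → p i = p j := by
    intro i j hij
    have h1 := hall (i, j)
    have h2 := (G.logMean_pos hρ.1 hij).ne'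
    have h3 : G.ω i j ≠ 0 := by
      obtain ⟨l, hl, h'⟩ := G.ω_lower
      exact (hl.trans_le (h' i j hij)).ne'
    simp only [G.grad_of_adj _ hij, mul_eq_zero, h2, h3, or_false, false_or, hq, sub_eq_zero] at h1
    rcases h1 with h1 | h1
    · exact h1.symm
    · exact (Real.arctan_injective h1).symm
  obtain ⟨w⟩ := hconn.preconnected i j
  induction w with
  | nil => rfl
  | cons h _ ih => exact (hadj _ _ h).trans ih

lemma B_eq_iff {p q : V → ℝ} [Nonempty V] (hπ : ∀ i, 0 < G.π i) (hconn : G.graph.Connected)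
    (hρ : ρ ∈ G.P0) (hp : p ∈ G.potentials ρ) (hq : q ∈ G.potentials ρ) :
    G.B ρ p = G.B ρ q ↔ ∃ c : ℝ, ∀ i, p i = q i + c := by
  constructor
  · intro h
    have h1 := G.eq_const_of_B_eq_zero hπ hconn hρ (G.potentials_sub hπ hp hq).2
      (fun i => by rw [B_sub, h]; simp)
    obtain ⟨o⟩ := ‹Nonempty V›
    exact ⟨p o - q o, fun i => by linarith [h1 i o]⟩
  · rintro ⟨c, hc⟩
    rw [← G.B_add_const ρ q c]
    congr 1
    exact funext hc

lemma grad_Binv {p : V → ℝ} [Nonempty V] (hπ : ∀ i, 0 < G.π i) (hconn : G.graph.Connected)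
    (hρ : ρ ∈ G.P0) (hp : p ∈ G.potentials ρ) : G.grad (G.Binv ρ (G.B ρ p)) = G.grad p := by
  have h : ∃ q ∈ G.potentials ρ, G.B ρ q = G.B ρ p := ⟨p, hp, rfl⟩
  rw [Binv, dif_pos h]
  obtain ⟨c, hc⟩ := (G.B_eq_iff hπ hconn hρ h.choose_spec.1 hp).1 h.choose_spec.2
  funext i j
  simp [grad, hc]

lemma metric_B {p q : V → ℝ} [Nonempty V] (hπ : ∀ i, 0 < G.π i) (hconn : G.graph.Connected)
    (hρ : ρ ∈ G.P0) (hp : p ∈ G.potentials ρ) (hq : q ∈ G.potentials ρ) :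
    G.metric ρ (G.B ρ p) (G.B ρ q) = G.vecInner ρ (G.grad p) (G.grad q) := by
  rw [metric, G.grad_Binv hπ hconn hρ hp, G.grad_Binv hπ hconn hρ hq]

lemma vecInner_comm (ρ : V → ℝ) (Φ Φ' : V → V → ℝ) :
    G.vecInner ρ Φ Φ' = G.vecInner ρ Φ' Φ := by
  unfold vecInner
  congr 1
  exact tsum_congr fun e => by ring

/-- Truncations `T n` of `q` at heights `±n` are bounded, so Green's formula holds for them. They
satisfy `|T n| ≤ |q|` and `|∇T n| ≤ |∇q|`, so dominated convergence applies on both sides. -/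
lemma vecInner_eq_tsum {p q : V → ℝ} (hπ : ∀ i, 0 < G.π i)
    (hρ : ρ ∈ G.P0) (hp : G.grad p ∈ G.L2 ρ) (hq : G.grad q ∈ G.L2 ρ)
    (hs : Summable fun i => G.B ρ p i * q i * G.π i) :
    G.vecInner ρ (G.grad p) (G.grad q) = ∑' i, G.B ρ p i * q i * G.π i := by
  set T : ℕ → V → ℝ := fun n i => max (-n) (min (q i) n) with hT
  have hTb : ∀ n i, |T n i| ≤ n := fun n i => by
    rw [abs_le]
    exact ⟨le_max_left _ _, max_le (by simp) (min_le_right _ _)⟩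
  have hTq : ∀ n i, |T n i| ≤ |q i| := fun n i => by
    simp only [hT]
    have hn : (0 : ℝ) ≤ n := n.cast_nonneg
    rcases max_cases (-(n : ℝ)) (min (q i) n) with h | h <;>
    rcases min_cases (q i) (n : ℝ) with h' | h' <;>
    rcases abs_cases (q i) with h'' | h'' <;>
    rw [abs_le] <;> constructor <;> linarith
  have hTd : ∀ n i j, |T n j - T n i| ≤ |q j - q i| := fun n i j => by
    simp only [hT]
    calc _ ≤ |min (q j) n - min (q i) n| := by
          simpa using abs_max_sub_max_le_max (-(n : ℝ)) (min (q j) n) (-n) (min (q i) n)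
      _ ≤ _ := by simpa using abs_min_sub_min_le_max (q j) n (q i) n
  have hTlim : ∀ i, Tendsto (fun n => T n i) atTop (𝓝 (q i)) := fun i => by
    refine tendsto_const_nhds.congr' ?_
    filter_upwards [eventually_ge_atTop ⌈|q i|⌉₊] with n hn
    have h1 : |q i| ≤ n := (Nat.le_ceil _).trans (by exact_mod_cast hn)
    rw [abs_le] at h1
    simp only [hT]
    rw [min_eq_left h1.2, max_eq_right h1.1]
  have hgreen : ∀ n, G.vecInner ρ (G.grad p) (G.grad (T n)) = ∑' i, G.B ρ p i * T n i * G.π i :=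
    fun n => (G.hasSum_B_mul hπ (G.summable_of_bounded hρ hp (hTb n))).tsum_eq.symm
  have hl : Tendsto (fun n => ∑' i, G.B ρ p i * T n i * G.π i) atTop
      (𝓝 (∑' i, G.B ρ p i * q i * G.π i)) := by
    refine tendsto_tsum_of_dominated_convergence hs.norm
      (fun i => ((hTlim i).const_mul _).mul_const _) (Eventually.of_forall fun n i => ?_)
    rw [norm_mul, norm_mul, norm_mul, norm_mul]
    gcongr
    exact hTq n i
  have hr : Tendsto (fun n => G.vecInner ρ (G.grad p) (G.grad (T n))) atTop
      (𝓝 (G.vecInner ρ (G.grad p) (G.grad q))) := by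
    refine Tendsto.const_mul _ (tendsto_tsum_of_dominated_convergence
      (G.summable_mul_of_sq hp hq).norm (fun e => ?_) (Eventually.of_forall fun n e => ?_))
    · refine Tendsto.mul_const _ (Tendsto.const_mul _ ?_)
      unfold grad
      split_ifs
      · exact (hTlim _).sub (hTlim _)
      · exact tendsto_const_nhds
    · rw [norm_mul, norm_mul, norm_mul (_ * _), norm_mul (_ * _)]
      gcongr
      unfold grad
      split_ifs
      · exact hTd n _ _
      · simp
  exact tendsto_nhds_unique hr (hl.congr fun n => (hgreen n).symm)

end

end

end WeightedGraph

namespace WeightedGraph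

noncomputable section

variable {V : Type*} (G : WeightedGraph V)

/-! ### Moments of densities -/

variable {G}

lemma IsPotential.exists_bound {o : V} {Ψ : V → ℝ} (hΨ : G.IsPotential o Ψ) :
    ∃ C : ℝ, 0 ≤ C ∧ ∀ i j, G.graph.Adj i j → |Ψ j - Ψ i| ≤ C := by
  obtain ⟨C, hC⟩ := hΨ.grad_bound
  refine ⟨C, (abs_nonneg _).trans (hC o o), fun i j h => ?_⟩
  rw [← G.grad_of_adj Ψ h]
  exact hC i j

lemma abs_sub_le_dist (hconn : G.graph.Connected) {Ψ : V → ℝ} {C : ℝ}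
    (hC : ∀ i j, G.graph.Adj i j → |Ψ j - Ψ i| ≤ C) (i j : V) :
    |Ψ j - Ψ i| ≤ C * G.graph.dist i j := by
  obtain ⟨w, hw⟩ := hconn.exists_walk_length_eq_dist i j
  rw [← hw]
  clear hw
  induction w with
  | nil => simp
  | @cons u v x h p ih =>
    rw [SimpleGraph.Walk.length_cons]
    push_cast
    calc |Ψ x - Ψ u| ≤ |Ψ x - Ψ v| + |Ψ v - Ψ u| := abs_sub_le _ _ _
      _ ≤ _ := by linarith [hC u v h]

/-- A potential with bounded gradient grows at most linearly in the distance, so its square is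
controlled by the second moment weight. -/
lemma IsPotential.exists_sq_le {o : V} {Ψ : V → ℝ} (hΨ : G.IsPotential o Ψ)
    (hconn : G.graph.Connected) :
    ∃ A : ℝ, 0 ≤ A ∧ ∀ i, Ψ i ^ 2 ≤ A * (1 + (G.graph.dist o i : ℝ) ^ 2) := by
  obtain ⟨C, hC0, hC⟩ := hΨ.exists_bound
  refine ⟨2 * Ψ o ^ 2 + 2 * C ^ 2, by positivity, fun i => ?_⟩
  have h := abs_sub_le_dist hconn hC o i
  have h2 : (Ψ i - Ψ o) ^ 2 ≤ (C * G.graph.dist o i) ^ 2 := by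
    rw [← sq_abs]; gcongr
  nlinarith [sq_nonneg (Ψ i - 2 * Ψ o), sq_nonneg (Ψ o * (G.graph.dist o i : ℝ)), sq_nonneg C]

lemma summable_weight {o : V} {ρ : V → ℝ} (hρ : ρ ∈ G.P0star o) :
    Summable fun i => (1 + (G.graph.dist o i : ℝ) ^ 2) * ρ i * G.π i := by
  refine (hρ.1.2.summable.add hρ.2).congr fun i => ?_
  ring

lemma summable_sq_potential {o : V} {Ψ : V → ℝ} (hΨ : G.IsPotential o Ψ)
    (hconn : G.graph.Connected) (hπ : ∀ i, 0 < G.π i) {ρ : V → ℝ} (hρ : ρ ∈ G.P0star o) :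
    Summable fun i => Ψ i ^ 2 * ρ i * G.π i := by
  obtain ⟨A, -, hA⟩ := hΨ.exists_sq_le hconn
  have h := (summable_weight hρ).mul_left A
  refine Summable.of_nonneg_of_le (fun i => ?_) (fun i => ?_) h
  · have := hπ i; have := hρ.1.1 i; positivity
  · have h1 := hπ i
    have h2 := hρ.1.1 i
    rw [← mul_assoc, ← mul_assoc]
    gcongr
    exact hA i

lemma summable_exp_neg {o : V} {Ψ : V → ℝ} (hΨ : G.IsPotential o Ψ)
    (hconn : G.graph.Connected) (hπ : ∀ i, 0 < G.π i) :
    Summable fun i => Real.exp (-Ψ i) * G.π i := by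
  classical
  have h0 : Summable fun i => if i = o then Real.exp (-Ψ o) * G.π o else 0 :=
    (hasSum_ite_eq o _).summable
  refine Summable.of_nonneg_of_le (fun i => ?_) (fun i => ?_) (hΨ.moment.add h0)
  · have := hπ i; positivity
  · have h1 := hπ i
    by_cases h : i = o
    · subst h; simp
    · have : 1 ≤ (G.graph.dist o i : ℝ) := by
        exact_mod_cast hconn.pos_dist_of_ne (Ne.symm h)
      have h2 : 1 ≤ (G.graph.dist o i : ℝ) ^ 2 := one_le_pow₀ this
      rw [if_neg h, add_zero]
      have : 0 < Real.exp (-Ψ i) * G.π i := by positivity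
      nlinarith

lemma mul_pi_le_one {ρ : V → ℝ} (hπ : ∀ i, 0 < G.π i) (hρ : ρ ∈ G.P0) (i : V) :
    ρ i * G.π i ≤ 1 :=
  le_hasSum hρ.2 i fun j _ => mul_nonneg (hρ.1 j).le (hπ j).le

lemma density_le {ρ : V → ℝ} {l : ℝ} (hl : 0 < l) (hπ : ∀ i, l ≤ G.π i) (hρ : ρ ∈ G.P0) (i : V) :
    ρ i ≤ 1 / l := by
  have h := mul_pi_le_one (fun i => hl.trans_le (hπ i)) hρ i
  rw [le_div_iff₀ hl]
  nlinarith [hπ i, hρ.1 i]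

/-- Three regimes. For `x ≥ 1` the upper bound on `x` controls the logarithm. For `|log x| ≤ 2|y|`
the second term suffices. For smaller `x`, with `L = -log x`, write `x = e^{-L/2} e^{-L/2}`: one
factor is at most `e^{-y}`, the other absorbs `L²`. It is applied with `y = Ψ i`, where `e^{-Ψ}` is
summable. -/
lemma mul_sq_log_le {x l y : ℝ} (hx : 0 < x) (hxl : x ≤ 1 / l) :
    x * Real.log x ^ 2 ≤ Real.log l ^ 2 * x + 4 * (y ^ 2 * x) + 8 * Real.exp (-y) := by
  rcases le_total 1 x with h | h
  · have h1 : 0 ≤ Real.log x := Real.log_nonneg h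
    have h2 : Real.log x ≤ -Real.log l := by
      have := Real.log_le_log hx hxl
      rwa [one_div, Real.log_inv] at this
    have h3 : Real.log x ^ 2 ≤ Real.log l ^ 2 := by nlinarith
    have : 0 ≤ y ^ 2 * x := by positivity
    have := Real.exp_pos (-y)
    nlinarith
  · have h1 : Real.log x ≤ 0 := Real.log_nonpos hx.le h
    have h0 : 0 ≤ Real.log l ^ 2 * x := by positivity
    by_cases hL : -Real.log x ≤ 2 * |y|
    · have h3 : Real.log x ^ 2 ≤ 4 * y ^ 2 := by rw [← sq_abs y]; nlinarith [abs_nonneg y]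
      have := Real.exp_pos (-y)
      nlinarith
    · push Not at hL
      set L := -Real.log x with hLd
      have hL0 : 0 < L := lt_of_le_of_lt (by positivity) hL
      have hxe : x = Real.exp (-(L / 2)) * Real.exp (-(L / 2)) := by
        rw [← Real.exp_add, hLd]; ring_nf; rw [Real.exp_log hx]
      have h4 : Real.exp (-(L / 2)) ≤ Real.exp (-y) :=
        Real.exp_le_exp.2 (by linarith [le_abs_self y])
      have h5 : Real.exp (-(L / 2)) * L ^ 2 ≤ 8 := by
        have := Real.quadratic_le_exp_of_nonneg (x := L / 2) (by positivity)
        rw [Real.exp_neg, inv_mul_le_iff₀ (Real.exp_pos _)]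
        nlinarith
      have h6 : x * Real.log x ^ 2 ≤ 8 * Real.exp (-y) := by
        calc x * Real.log x ^ 2 = Real.exp (-(L / 2)) * (Real.exp (-(L / 2)) * L ^ 2) := by
              rw [hLd, neg_sq, ← hLd]; nth_rw 1 [hxe]; ring
          _ ≤ Real.exp (-y) * 8 := by gcongr
          _ = _ := by ring
      have : 0 ≤ y ^ 2 * x := by positivity
      linarith

lemma summable_sq_log {o : V} {Ψ : V → ℝ} [Nontrivial V] (hΨ : G.IsPotential o Ψ)
    (hconn : G.graph.Connected) {ρ : V → ℝ} (hρ : ρ ∈ G.P0star o) :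
    Summable fun i => Real.log (ρ i) ^ 2 * ρ i * G.π i := by
  obtain ⟨l, hl, -, hlπ⟩ := G.exists_pi_lower hconn
  have hπ := G.pi_pos hconn
  have h := ((hρ.1.2.summable.mul_left (Real.log l ^ 2)).add
    ((summable_sq_potential hΨ hconn hπ hρ).mul_left 4)).add
      ((summable_exp_neg hΨ hconn hπ).mul_left 8)
  refine Summable.of_nonneg_of_le (fun i => ?_) (fun i => ?_) h
  · have := hπ i; have := hρ.1.1 i; positivity
  · have h1 := mul_sq_log_le (y := Ψ i) (hρ.1.1 i) (density_le hl hlπ hρ.1 i)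
    have h2 := hπ i
    calc _ = ρ i * Real.log (ρ i) ^ 2 * G.π i := by ring
      _ ≤ (Real.log l ^ 2 * ρ i + 4 * (Ψ i ^ 2 * ρ i) + 8 * Real.exp (-Ψ i)) * G.π i := by gcongr
      _ = _ := by ring

lemma summable_abs_of_sq {ρ a : V → ℝ} (hπ : ∀ i, 0 < G.π i) (hρ : ρ ∈ G.P0)
    (h : Summable fun i => a i ^ 2 * ρ i * G.π i) : Summable fun i => |a i| * ρ i * G.π i := by
  refine Summable.of_nonneg_of_le (fun i => ?_) (fun i => ?_) (hρ.2.summable.add h)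
  · have := hπ i; have := hρ.1 i; positivity
  · have h1 := hπ i
    have h2 := hρ.1 i
    have h3 : |a i| ≤ 1 + a i ^ 2 := by rw [← sq_abs]; nlinarith [sq_nonneg (|a i| - 1)]
    calc _ ≤ (1 + a i ^ 2) * ρ i * G.π i := by gcongr
      _ = _ := by ring

lemma summable_abs_potential {o : V} {Ψ : V → ℝ} (hΨ : G.IsPotential o Ψ)
    (hconn : G.graph.Connected) (hπ : ∀ i, 0 < G.π i) {ρ : V → ℝ} (hρ : ρ ∈ G.P0star o) :
    Summable fun i => |Ψ i| * ρ i * G.π i :=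
  summable_abs_of_sq hπ hρ.1 (summable_sq_potential hΨ hconn hπ hρ)

lemma summable_abs_log {o : V} {Ψ : V → ℝ} [Nontrivial V] (hΨ : G.IsPotential o Ψ)
    (hconn : G.graph.Connected) {ρ : V → ℝ} (hρ : ρ ∈ G.P0star o) :
    Summable fun i => |Real.log (ρ i)| * ρ i * G.π i :=
  summable_abs_of_sq (G.pi_pos hconn) hρ.1 (summable_sq_log hΨ hconn hρ)

lemma summable_potential_energy {o : V} {Ψ : V → ℝ} (hΨ : G.IsPotential o Ψ)
    (hconn : G.graph.Connected) (hπ : ∀ i, 0 < G.π i) {ρ : V → ℝ} (hρ : ρ ∈ G.P0star o) :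
    Summable fun i => G.π i * Ψ i * ρ i := by
  refine Summable.of_norm_bounded (summable_abs_potential hΨ hconn hπ hρ) fun i => le_of_eq ?_
  rw [norm_mul, norm_mul, Real.norm_of_nonneg (hπ i).le, Real.norm_of_nonneg (hρ.1.1 i).le,
    Real.norm_eq_abs]
  ring

lemma summable_entropy {o : V} {Ψ : V → ℝ} [Nontrivial V] (hΨ : G.IsPotential o Ψ)
    (hconn : G.graph.Connected) {ρ : V → ℝ} (hρ : ρ ∈ G.P0star o) :
    Summable fun i => G.π i * ρ i * Real.log (ρ i) := by
  refine Summable.of_norm_bounded (summable_abs_log hΨ hconn hρ) fun i => le_of_eq ?_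
  rw [norm_mul, norm_mul, Real.norm_of_nonneg (G.pi_pos hconn i).le,
    Real.norm_of_nonneg (hρ.1.1 i).le, Real.norm_eq_abs]
  ring

/-! ### The first variation of the free energy -/

/-- The first variation `Ψ + 1 + log ρ` of the free energy. -/
def chem (Ψ ρ : V → ℝ) (i : V) : ℝ := Ψ i + 1 + Real.log (ρ i)

lemma abs_log_add_le {x s : ℝ} (hx : 0 < x) (hs : |s| ≤ x / 2) :
    |Real.log (x + s)| ≤ |Real.log x| + Real.log 2 := by
  obtain ⟨h1, h2⟩ := abs_le.1 hs
  have h3 : Real.log (x + s) ≤ Real.log x + Real.log 2 := by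
    rw [← Real.log_mul hx.ne' two_ne_zero]
    exact Real.log_le_log (by linarith) (by linarith)
  have h4 : Real.log x - Real.log 2 ≤ Real.log (x + s) := by
    rw [← Real.log_div hx.ne' two_ne_zero]
    exact Real.log_le_log (by linarith) (by linarith)
  rw [abs_le]
  constructor
  · linarith [neg_abs_le (Real.log x)]
  · linarith [le_abs_self (Real.log x)]

/-- Both series are differentiated term by term. The entropy part needs a dominating series, which
exists because `|σ| ≤ Cρ` makes `log (ρ + εσ)` comparable to `log ρ` for small `ε`. -/
lemma isFirstVariation_freeEnergy {o : V} {Ψ : V → ℝ} [Nontrivial V] (hΨ : G.IsPotential o Ψ)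
    (hconn : G.graph.Connected) {ρ : V → ℝ} (hρ : ρ ∈ G.P0star o) :
    G.IsFirstVariation (G.freeEnergy Ψ) ρ (chem Ψ ρ) := by
  have hπ := G.pi_pos hconn
  rintro σ ⟨C', hC'⟩
  obtain ⟨C, hC0, hC⟩ : ∃ C : ℝ, 0 < C ∧ ∀ i, |σ i| ≤ C * ρ i :=
    ⟨|C'| + 1, by positivity, fun i => (hC' i).trans
      (mul_le_mul_of_nonneg_right (by linarith [le_abs_self C']) (hρ.1.1 i).le)⟩
  have hS1 := summable_abs_potential hΨ hconn hπ hρ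
  have hS2 := summable_abs_log hΨ hconn hρ
  have hS0 := hρ.1.2.summable
  have hd1s : Summable fun i => G.π i * Ψ i * σ i := by
    refine Summable.of_norm_bounded (hS1.mul_left C) fun i => ?_
    rw [norm_mul, norm_mul, Real.norm_of_nonneg (hπ i).le, Real.norm_eq_abs, Real.norm_eq_abs]
    calc _ ≤ G.π i * |Ψ i| * (C * ρ i) := by
          have := hπ i
          gcongr; exact hC i
      _ = _ := by ring
  have hd2s : Summable fun i => G.π i * (σ i * (Real.log (ρ i) + 1)) := by
    refine Summable.of_norm_bounded ((hS2.add hS0).mul_left C) fun i => ?_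
    rw [norm_mul, norm_mul, Real.norm_of_nonneg (hπ i).le, Real.norm_eq_abs, Real.norm_eq_abs]
    have h1 := hπ i
    have h2 := hρ.1.1 i
    calc _ ≤ G.π i * ((C * ρ i) * (|Real.log (ρ i)| + 1)) := by
          gcongr
          · exact hC i
          · exact (abs_add_le _ _).trans (by simp)
      _ = _ := by ring
  have hsum : ∀ i, chem Ψ ρ i * σ i * G.π i =
      G.π i * Ψ i * σ i + G.π i * (σ i * (Real.log (ρ i) + 1)) := fun i => by
    simp only [chem]; ring
  refine ⟨(hd1s.add hd2s).congr fun i => (hsum i).symm, ?_⟩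
  rw [tsum_congr hsum, hd1s.tsum_add hd2s]
  -- Within radius `1/(2C)` the perturbation is at most half of `ρ`, so the logarithm changes by at
  -- most `log 2`.
  have hball : ∀ ε ∈ Metric.ball (0 : ℝ) (1 / (2 * C)), ∀ i, |ε * σ i| ≤ ρ i / 2 := by
    intro ε hε i
    rw [mem_ball_zero_iff, Real.norm_eq_abs] at hε
    rw [abs_mul]
    calc _ ≤ 1 / (2 * C) * (C * ρ i) := by gcongr; exact hC i
      _ = ρ i / 2 := by field_simp
  have h0 : (0 : ℝ) ∈ Metric.ball (0 : ℝ) (1 / (2 * C)) := Metric.mem_ball_self (by positivity)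
  refine HasDerivAt.add ?_ ?_
  · refine hasDerivAt_tsum_of_isPreconnected (g' := fun i _ => G.π i * Ψ i * σ i) hd1s.norm
      (t := Set.univ) isOpen_univ isPreconnected_univ (fun i ε _ => ?_) (fun i _ _ => le_rfl)
      (y₀ := 0) trivial ?_ trivial
    · have := (((hasDerivAt_id ε).mul_const (σ i)).const_add (ρ i)).const_mul (G.π i * Ψ i)
      simpa using this
    · simpa using summable_potential_energy hΨ hconn hπ hρ
  · have hu : Summable fun i => C * ((|Real.log (ρ i)| * ρ i * G.π i) +
        (Real.log 2 + 1) * (ρ i * G.π i)) := (hS2.add (hS0.mul_left _)).mul_left C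
    have := hasDerivAt_tsum_of_isPreconnected
      (g := fun i ε => G.π i * (ρ i + ε * σ i) * Real.log (ρ i + ε * σ i))
      (g' := fun i ε => G.π i * (σ i * (Real.log (ρ i + ε * σ i) + 1))) hu Metric.isOpen_ball
      (convex_ball 0 (1 / (2 * C))).isPreconnected (fun i ε hε => ?_) (fun i ε hε => ?_)
      (y₀ := 0) h0 (by simpa using summable_entropy hΨ hconn hρ) h0
    · simpa using this
    · have hpos : ρ i + ε * σ i ≠ 0 := by
        have := abs_le.1 (hball ε hε i)
        have := hρ.1.1 i
        linarith
      have h1 : HasDerivAt (fun ε => ρ i + ε * σ i) (σ i) ε := by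
        simpa using ((hasDerivAt_id ε).mul_const (σ i)).const_add (ρ i)
      have h2 := ((Real.hasDerivAt_mul_log hpos).comp ε h1).const_mul (G.π i)
      exact (h2.congr_deriv (by ring)).congr_of_eventuallyEq
        (Eventually.of_forall fun x => by simp [mul_assoc])
    · have h1 := hπ i
      have h2 := hρ.1.1 i
      have h3 := abs_log_add_le h2 (hball ε hε i)
      rw [norm_mul, norm_mul, Real.norm_of_nonneg h1.le, Real.norm_eq_abs, Real.norm_eq_abs]
      calc _ ≤ G.π i * ((C * ρ i) * (|Real.log (ρ i)| + Real.log 2 + 1)) := by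
            gcongr
            · exact hC i
            · exact (abs_add_le _ _).trans (by simpa using h3)
        _ = _ := by ring

/-- The direction `ρ k` at the single vertex `k` is admissible and reads off the value at `k`. -/
lemma IsFirstVariation.unique {J : (V → ℝ) → ℝ} {ρ h h' : V → ℝ} (hπ : ∀ i, 0 < G.π i)
    (hρ : ∀ i, 0 < ρ i) (h1 : G.IsFirstVariation J ρ h) (h2 : G.IsFirstVariation J ρ h') :
    h = h' := by
  classical
  funext k
  have hb : ∃ C : ℝ, ∀ i, |(Pi.single k (ρ k) : V → ℝ) i| ≤ C * ρ i := by
    refine ⟨1, fun i => ?_⟩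
    by_cases hi : i = k
    · subst hi; simp [abs_of_pos (hρ i)]
    · simp [hi, (hρ i).le]
  have e := (h1 _ hb).2.unique (h2 _ hb).2
  have : ∀ f : V → ℝ, ∑' i, f i * (Pi.single k (ρ k) : V → ℝ) i * G.π i = f k * ρ k * G.π k := by
    intro f
    rw [tsum_eq_single k fun i hi => by simp [hi]]
    simp
  rw [this, this] at e
  have h3 := (hρ k).ne'
  have h4 := (hπ k).ne'
  exact mul_right_cancel₀ h3 (mul_right_cancel₀ h4 e)

/-! ### The Fokker-Planck field as a sum of edge fluxes -/

variable (G) in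
/-- The rate of change of the density `ρ` for the edge weights `w`. -/
def flowRate (w : V → V → ℝ) (Ψ ρ : V → ℝ) (i : V) : ℝ :=
  ∑ j ∈ G.nbr i, w i j / G.π i * flux (Ψ j - Ψ i) (ρ i) (ρ j)

lemma fokkerPlanck_eq_flowRate {ρ : V → ℝ} (Ψ : V → ℝ) (hρ : ∀ i, 0 < ρ i) (i : V) :
    G.fokkerPlanck Ψ ρ i = G.flowRate G.ω Ψ ρ i := by
  rw [fokkerPlanck, wdiv, lap, flowRate, ← Finset.sum_add_distrib]
  refine Finset.sum_congr rfl fun j hj => ?_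
  have h := G.mem_nbr.1 hj
  rw [G.grad_of_adj _ h, G.logMean_of_adj hρ h, flux]
  ring

/-- This is the chain rule for which the logarithmic mean is designed: multiplied by it, the
gradient of `log ρ` becomes the gradient of `ρ`. -/
lemma grad_chem_mul_logMean {ρ : V → ℝ} (Ψ : V → ℝ) (hρ : ∀ i, 0 < ρ i) {i j : V}
    (h : G.graph.Adj i j) :
    G.grad (chem Ψ ρ) i j * G.logMean ρ i j = flux (Ψ j - Ψ i) (ρ i) (ρ j) := by
  rw [G.grad_of_adj _ h, G.logMean_of_adj hρ h, flux_eq_mul (hρ i) (hρ j)]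
  simp only [chem]; ring

lemma fokkerPlanck_eq_neg_B {ρ : V → ℝ} (Ψ : V → ℝ) (hρ : ∀ i, 0 < ρ i) (i : V) :
    G.fokkerPlanck Ψ ρ i = - G.B ρ (chem Ψ ρ) i := by
  rw [fokkerPlanck_eq_flowRate Ψ hρ, B, neg_neg, wdiv, flowRate]
  refine Finset.sum_congr rfl fun j hj => ?_
  rw [mul_assoc, grad_chem_mul_logMean Ψ hρ (G.mem_nbr.1 hj)]

lemma fokkerPlanck_eq_sum {ρ : V → ℝ} (Ψ : V → ℝ) (hρ : ∀ i, 0 < ρ i) (i : V) :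
    G.fokkerPlanck Ψ ρ i = ∑ j ∈ G.nbr i, G.ω i j / G.π i *
      ((Ψ j + Real.log (ρ j)) - (Ψ i + Real.log (ρ i))) * G.logMean ρ i j := by
  rw [fokkerPlanck_eq_flowRate Ψ hρ, flowRate]
  refine Finset.sum_congr rfl fun j hj => ?_
  rw [G.logMean_of_adj hρ (G.mem_nbr.1 hj), flux_eq_mul (hρ i) (hρ j)]
  ring

lemma flowRate_mul_pi (hπ : ∀ i, 0 < G.π i) (w : V → V → ℝ) (Ψ ρ : V → ℝ) (i : V) :
    G.flowRate w Ψ ρ i * G.π i = ∑ j ∈ G.nbr i, w i j * flux (Ψ j - Ψ i) (ρ i) (ρ j) := by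
  rw [flowRate, Finset.sum_mul]
  refine Finset.sum_congr rfl fun j _ => ?_
  have := (hπ i).ne'
  field_simp

lemma abs_flowRate_mul_pi_le (hπ : ∀ i, 0 < G.π i) {w : V → V → ℝ} {Ψ ρ : V → ℝ} {C : ℝ}
    (hC : ∀ i j, G.graph.Adj i j → |Ψ j - Ψ i| ≤ C) (hw0 : ∀ i j, 0 ≤ w i j)
    (hw : ∀ i j, w i j ≤ G.ω i j) (hρ : ∀ i, 0 < ρ i) (i : V) :
    |G.flowRate w Ψ ρ i| * G.π i ≤ (1 + C) * ∑ j ∈ G.nbr i, G.ω i j * (ρ i + ρ j) := by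
  have h0 : |G.flowRate w Ψ ρ i| * G.π i = |G.flowRate w Ψ ρ i * G.π i| := by
    rw [abs_mul, abs_of_pos (hπ i)]
  rw [h0, flowRate_mul_pi hπ, Finset.mul_sum]
  refine (Finset.abs_sum_le_sum_abs _ _).trans (Finset.sum_le_sum fun j hj => ?_)
  have h1 := abs_flux_le (hC i j (G.mem_nbr.1 hj)) (hρ i) (hρ j)
  rw [abs_mul, abs_of_nonneg (hw0 i j)]
  calc _ ≤ G.ω i j * ((1 + C) * (ρ i + ρ j)) :=
        mul_le_mul (hw i j) h1 (abs_nonneg _) (G.omega_nonneg i j)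
    _ = _ := by ring

lemma summable_sum_omega_add {ρ : V → ℝ} (hρ0 : ∀ i, 0 ≤ ρ i)
    (hρ : Summable fun i => ρ i * G.π i) :
    Summable fun i => ∑ j ∈ G.nbr i, G.ω i j * (ρ i + ρ j) := by
  refine (G.hasSum_rows (f := fun i j => G.ω i j * (ρ i + ρ j))
    (fun i j h => by rw [G.omega_eq_zero h, zero_mul]) ?_).summable
  refine ((G.summable_omega_fst hρ0 hρ).add (G.summable_omega_snd hρ0 hρ)).congr fun e => ?_
  ring

lemma chem_mem_K (hπ : ∀ i, 0 < G.π i) {o : V} {Ψ : V → ℝ} (hΨ : G.IsPotential o Ψ)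
    {ρ : V → ℝ} (hρ : ρ ∈ G.P0) : chem Ψ ρ ∈ G.K ρ := by
  obtain ⟨C, hC0, hC⟩ := hΨ.exists_bound
  refine Summable.of_nonneg_of_le (fun i => mul_nonneg (abs_nonneg _) (hπ i).le) (fun i => ?_)
    ((summable_sum_omega_add (fun i => (hρ.1 i).le) hρ.2.summable).mul_left (1 + C))
  have h := fokkerPlanck_eq_neg_B (G := G) Ψ hρ.1 i
  rw [fokkerPlanck_eq_flowRate Ψ hρ.1] at h
  rw [← abs_neg, ← h]
  exact abs_flowRate_mul_pi_le hπ hC G.omega_nonneg (fun _ _ => le_rfl) hρ.1 i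

end

end WeightedGraph

/-! ### A Grönwall inequality with constant forcing -/

lemma le_of_deriv_le_mul_add {E E' : ℝ → ℝ} {K ε T : ℝ} (hK : 0 ≤ K) (hε : 0 ≤ ε)
    (hd : ∀ t ∈ Set.Icc 0 T, HasDerivWithinAt E (E' t) (Set.Icc 0 T) t)
    (hb : ∀ t ∈ Set.Icc 0 T, E' t ≤ K * E t + ε) {t : ℝ} (ht : t ∈ Set.Icc 0 T) :
    E t ≤ (E 0 + ε * t) * Real.exp (K * t) := by
  have hT : 0 ≤ T := ht.1.trans ht.2
  have hg : ∀ t ∈ Set.Icc 0 T, HasDerivWithinAt (fun t => Real.exp (-(K * t)) * E t - ε * t)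
      (Real.exp (-(K * t)) * (-K) * E t + Real.exp (-(K * t)) * E' t - ε) (Set.Icc 0 T) t := by
    intro t ht
    have h1 : HasDerivAt (fun t => Real.exp (-(K * t))) (Real.exp (-(K * t)) * (-K)) t := by
      have := ((hasDerivAt_id t).const_mul K).neg.exp
      simpa using this
    have h2 : HasDerivAt (fun t => ε * t) ε t := by
      simpa using (hasDerivAt_id t).const_mul ε
    exact (h1.hasDerivWithinAt.mul (hd t ht)).sub h2.hasDerivWithinAt
  have hanti : AntitoneOn (fun t => Real.exp (-(K * t)) * E t - ε * t) (Set.Icc 0 T) := by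
    refine antitoneOn_of_hasDerivWithinAt_nonpos (convex_Icc 0 T)
      (fun t ht => (hg t ht).continuousWithinAt)
      (fun t ht => (hg t (interior_subset ht)).mono interior_subset) fun t ht => ?_
    have ht' := interior_subset ht
    have h1 := hb t ht'
    have h2 : Real.exp (-(K * t)) ≤ 1 :=
      Real.exp_le_one_iff.2 (by have := mul_nonneg hK ht'.1; linarith)
    have h3 := Real.exp_pos (-(K * t))
    nlinarith [mul_le_mul_of_nonneg_left h1 h3.le]
  have h := hanti ⟨le_rfl, hT⟩ ht ht.1
  simp only [mul_zero, neg_zero, Real.exp_zero, one_mul, sub_zero] at h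
  have h3 := Real.exp_pos (K * t)
  rw [Real.exp_neg] at h
  have h4 : (Real.exp (K * t))⁻¹ * E t ≤ E 0 + ε * t := by linarith
  rwa [inv_mul_le_iff₀ h3, mul_comm] at h4

namespace WeightedGraph

noncomputable section

variable {V : Type*} {G : WeightedGraph V}

/-! ### Balls -/

lemma finite_ball (hconn : G.graph.Connected) (o : V) (n : ℕ) :
    {i | G.graph.dist o i ≤ n}.Finite := by
  induction n with
  | zero =>
    refine (Set.finite_singleton o).subset fun i hi => ?_
    have : G.graph.dist o i = 0 := Nat.le_zero.1 hi
    exact (hconn.dist_eq_zero_iff.1 this).symm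
  | succ n ih =>
    refine ((ih.biUnion fun i _ => G.nbr_finite i).union ih).subset fun i hi => ?_
    by_cases h : G.graph.dist o i ≤ n
    · exact Or.inr h
    · left
      obtain ⟨w, hw⟩ := hconn.exists_walk_length_eq_dist i o
      cases w with
      | nil => simp at h
      | @cons _ k _ hik p =>
        refine Set.mem_biUnion (x := k) ?_ hik.symm
        have h1 := SimpleGraph.dist_le p
        rw [SimpleGraph.Walk.length_cons, SimpleGraph.dist_comm] at hw
        rw [SimpleGraph.dist_comm] at h1
        have h2 : G.graph.dist o i ≤ n + 1 := hi
        show G.graph.dist o k ≤ n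
        omega

/-- The finite ball of radius `n` about `o`. -/
def ball (hconn : G.graph.Connected) (o : V) (n : ℕ) : Finset V := (finite_ball hconn o n).toFinset

lemma mem_ball (hconn : G.graph.Connected) {o : V} {n : ℕ} {i : V} :
    i ∈ ball hconn o n ↔ G.graph.dist o i ≤ n := by
  simp [ball]

lemma dist_le_succ (hconn : G.graph.Connected) (o : V) {i j : V} (h : G.graph.Adj i j) :
    G.graph.dist o j ≤ G.graph.dist o i + 1 := by
  have h1 := hconn.dist_triangle (u := o) (v := i) (w := j)
  rwa [SimpleGraph.dist_eq_one_iff_adj.2 h] at h1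

/-! ### Flows with reduced weights -/

variable (G) in
/-- Symmetric edge weights dominated by those of the graph. -/
structure IsWeight (w : V → V → ℝ) : Prop where
  nonneg : ∀ i j, 0 ≤ w i j
  le : ∀ i j, w i j ≤ G.ω i j
  symm : ∀ i j, w i j = w j i

lemma isWeight_omega : G.IsWeight G.ω := ⟨G.omega_nonneg, fun _ _ => le_rfl, G.ω_symm⟩

lemma IsWeight.eq_zero {w : V → V → ℝ} (hw : G.IsWeight w) {i j : V} (h : j ∉ G.nbr i) :
    w i j = 0 :=
  le_antisymm ((hw.le i j).trans (G.omega_eq_zero h).le) (hw.nonneg i j)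

lemma IsWeight.sum_le {w : V → V → ℝ} (hw : G.IsWeight w) (S : Finset V) (i : V) :
    ∑ j ∈ S, w i j ≤ G.π i := by
  have h := G.hasSum_row (f := w) i fun j hj => hw.eq_zero hj
  exact (sum_le_hasSum S (fun j _ => hw.nonneg i j) h).trans
    (Finset.sum_le_sum fun j _ => hw.le i j)

lemma IsWeight.sum_sum_le {w : V → V → ℝ} (hw : G.IsWeight w) (S : Finset V) {g : V → ℝ}
    (hg : ∀ i, 0 ≤ g i) :
    ∑ i ∈ S, ∑ j ∈ S, w i j * (g i + g j) ≤ 2 * ∑ i ∈ S, g i * G.π i := by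
  have h1 : ∑ i ∈ S, ∑ j ∈ S, w i j * g i ≤ ∑ i ∈ S, g i * G.π i := by
    refine Finset.sum_le_sum fun i _ => ?_
    rw [← Finset.sum_mul, mul_comm]
    exact mul_le_mul_of_nonneg_left (hw.sum_le S i) (hg i)
  have h2 : ∑ i ∈ S, ∑ j ∈ S, w i j * g j = ∑ i ∈ S, ∑ j ∈ S, w i j * g i := by
    rw [Finset.sum_comm]
    exact Finset.sum_congr rfl fun i _ => Finset.sum_congr rfl fun j _ => by rw [hw.symm]
  simp only [mul_add, Finset.sum_add_distrib]
  linarith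

lemma IsWeight.sum_nbr_eq {w : V → V → ℝ} (hw : G.IsWeight w) {S : Finset V} {i : V}
    (hS : ∀ j ∈ G.nbr i, w i j ≠ 0 → j ∈ S) (f : V → ℝ) :
    ∑ j ∈ G.nbr i, w i j * f j = ∑ j ∈ S, w i j * f j := by
  classical
  rw [← Finset.sum_filter_of_ne (s := G.nbr i) (p := fun j => j ∈ S)
      (fun j hj hne => hS j hj (left_ne_zero_of_mul hne)),
    ← Finset.sum_filter_of_ne (s := S) (p := fun j => j ∈ G.nbr i)
      (fun j _ hne => by
        by_contra h
        exact hne (by rw [hw.eq_zero h, zero_mul])),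
    Finset.filter_mem_eq_inter, Finset.filter_mem_eq_inter, Finset.inter_comm]

variable (G) in
/-- A solution on `[0, T]` of the equation with edge weights `w`, in the probability densities. -/
structure IsFlow (w : V → V → ℝ) (Ψ : V → ℝ) (T : ℝ) (ρ : ℝ → V → ℝ) : Prop where
  mem : ∀ t ∈ Set.Icc 0 T, ρ t ∈ G.P0
  eqn : ∀ t ∈ Set.Icc 0 T, ∀ i,
    HasDerivWithinAt (fun s => ρ s i) (G.flowRate w Ψ (ρ t) i) (Set.Icc 0 T) t

lemma IsFlow.mono {w : V → V → ℝ} {Ψ : V → ℝ} {T T' : ℝ} {ρ : ℝ → V → ℝ}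
    (h : G.IsFlow w Ψ T ρ) (hT : T' ≤ T) : G.IsFlow w Ψ T' ρ :=
  ⟨fun t ht => h.mem t ⟨ht.1, ht.2.trans hT⟩, fun t ht i =>
    (h.eqn t ⟨ht.1, ht.2.trans hT⟩ i).mono (Set.Icc_subset_Icc_right hT)⟩

lemma le_flowRate {w : V → V → ℝ} (hw : G.IsWeight w) (hπ : ∀ i, 0 < G.π i) {Ψ ρ : V → ℝ} {C : ℝ}
    (hC0 : 0 ≤ C) (hC : ∀ i j, G.graph.Adj i j → |Ψ j - Ψ i| ≤ C) (hρ : ∀ i, 0 < ρ i) (i : V) :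
    -(rateBound C * ρ i) ≤ G.flowRate w Ψ ρ i := by
  have h1 : ∑ j ∈ G.nbr i, w i j / G.π i * (-(rateBound C * ρ i)) ≤ G.flowRate w Ψ ρ i := by
    refine Finset.sum_le_sum fun j hj => ?_
    have := neg_le_flux (hC i j (G.mem_nbr.1 hj)) (hρ i) (hρ j)
    exact mul_le_mul_of_nonneg_left this (div_nonneg (hw.nonneg i j) (hπ i).le)
  refine le_trans ?_ h1
  rw [← Finset.sum_mul, ← Finset.sum_div]
  have h2 : (∑ j ∈ G.nbr i, w i j) / G.π i ≤ 1 := (div_le_one (hπ i)).2 (hw.sum_le _ i)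
  have h3 : 0 ≤ rateBound C * ρ i := mul_nonneg (rateBound_pos hC0).le (hρ i).le
  nlinarith

/-- The outflow from a vertex is at most `rateBound C` times its density, so `e^{Mt} ρ` is
nondecreasing. Used forwards it gives positivity; used backwards it dominates the densities at all
earlier times by the final one. -/
lemma IsFlow.le_exp_mul {w : V → V → ℝ} (hw : G.IsWeight w) (hπ : ∀ i, 0 < G.π i) {Ψ : V → ℝ}
    {C : ℝ} (hC0 : 0 ≤ C) (hC : ∀ i j, G.graph.Adj i j → |Ψ j - Ψ i| ≤ C) {T : ℝ}
    {ρ : ℝ → V → ℝ} (h : G.IsFlow w Ψ T ρ) (i : V) {s t : ℝ} (hs : 0 ≤ s) (hst : s ≤ t)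
    (ht : t ≤ T) : ρ s i ≤ Real.exp (rateBound C * (t - s)) * ρ t i := by
  set M := rateBound C
  have hg : ∀ t ∈ Set.Icc 0 T, HasDerivWithinAt (fun t => Real.exp (M * t) * ρ t i)
      (Real.exp (M * t) * M * ρ t i + Real.exp (M * t) * G.flowRate w Ψ (ρ t) i)
        (Set.Icc 0 T) t := by
    intro t ht
    have h1 : HasDerivAt (fun t => Real.exp (M * t)) (Real.exp (M * t) * M) t := by
      have := ((hasDerivAt_id t).const_mul M).exp
      simpa using this
    exact h1.hasDerivWithinAt.mul (h.eqn t ht i)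
  have hmono : MonotoneOn (fun t => Real.exp (M * t) * ρ t i) (Set.Icc 0 T) := by
    refine monotoneOn_of_hasDerivWithinAt_nonneg (convex_Icc 0 T)
      (fun t ht => (hg t ht).continuousWithinAt)
      (fun t ht => (hg t (interior_subset ht)).mono interior_subset) fun t ht => ?_
    have ht' := interior_subset ht
    have h1 := le_flowRate hw hπ hC0 hC (h.mem t ht').1 i
    rw [mul_assoc, ← mul_add]
    exact mul_nonneg (Real.exp_pos _).le (by linarith)
  have h1 := hmono ⟨hs, hst.trans ht⟩ ⟨hs.trans hst, ht⟩ hst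
  simp only at h1
  rw [mul_sub, Real.exp_sub, div_mul_eq_mul_div, le_div_iff₀ (Real.exp_pos _), mul_comm]
  exact h1

/-! ### Comparison of flows in the Hellinger distance -/

/-- Apply the joint bound on `T + T'` with the smaller cutoff value; the excess, at most `ε`,
multiplies one single term, which is at most `m`. -/
lemma cutoff_combination_le {η η' T T' D D' ε m : ℝ} (hη : 0 ≤ η) (hη' : 0 ≤ η')
    (hd : |η - η'| ≤ ε) (hD : 0 ≤ D) (hD' : 0 ≤ D') (hm : 0 ≤ m) (hTT : T + T' ≤ D + D')
    (hT : T ≤ m) (hT' : T' ≤ m) : η * T + η' * T' ≤ (η * D + η' * D') + ε * m := by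
  obtain ⟨h1, h2⟩ := abs_le.1 hd
  rcases le_total η η' with h | h
  · have e1 : (η' - η) * T' ≤ (η' - η) * m := mul_le_mul_of_nonneg_left hT' (by linarith)
    have e2 : (η' - η) * m ≤ ε * m := mul_le_mul_of_nonneg_right (by linarith) hm
    have e3 : η * (T + T') ≤ η * (D + D') := mul_le_mul_of_nonneg_left hTT hη
    have e4 : η * D' ≤ η' * D' := mul_le_mul_of_nonneg_right h hD'
    nlinarith
  · have e1 : (η - η') * T ≤ (η - η') * m := mul_le_mul_of_nonneg_left hT (by linarith)
    have e2 : (η - η') * m ≤ ε * m := mul_le_mul_of_nonneg_right (by linarith) hm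
    have e3 : η' * (T + T') ≤ η' * (D + D') := mul_le_mul_of_nonneg_left hTT hη'
    have e4 : η' * D ≤ η * D := mul_le_mul_of_nonneg_right h hD
    nlinarith

/-- The piecewise linear cutoff of radius `R`. -/
def cutoff (G : WeightedGraph V) (o : V) (R : ℕ) (i : V) : ℝ :=
  max 0 (1 - (G.graph.dist o i : ℝ) / R)

lemma cutoff_nonneg (o : V) (R : ℕ) (i : V) : 0 ≤ G.cutoff o R i := le_max_left _ _

lemma abs_cutoff_sub_le (hconn : G.graph.Connected) (o : V) (R : ℕ) {i j : V}
    (h : G.graph.Adj i j) : |G.cutoff o R i - G.cutoff o R j| ≤ 1 / R := by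
  have h1 : (G.graph.dist o j : ℝ) ≤ G.graph.dist o i + 1 := by
    exact_mod_cast dist_le_succ hconn o h
  have h2 : (G.graph.dist o i : ℝ) ≤ G.graph.dist o j + 1 := by
    exact_mod_cast dist_le_succ hconn o h.symm
  have h3 : |(G.graph.dist o j : ℝ) - G.graph.dist o i| ≤ 1 := by
    rw [abs_le]; constructor <;> linarith
  calc _ ≤ |(1 - (G.graph.dist o i : ℝ) / R) - (1 - (G.graph.dist o j : ℝ) / R)| := by
        simpa [cutoff] using abs_max_sub_max_le_max (0 : ℝ) (1 - (G.graph.dist o i : ℝ) / R) 0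
          (1 - (G.graph.dist o j : ℝ) / R)
    _ = |(G.graph.dist o j : ℝ) - G.graph.dist o i| / R := by
        rw [sub_sub_sub_cancel_left, ← sub_div, abs_div, Nat.abs_cast]
    _ ≤ _ := by gcongr

lemma cutoff_eq_zero {o : V} {R : ℕ} (hR : 0 < R) {i : V} (h : R ≤ G.graph.dist o i) :
    G.cutoff o R i = 0 := by
  refine max_eq_left ?_
  have h1 : (R : ℝ) ≤ G.graph.dist o i := by exact_mod_cast h
  have h2 : (0 : ℝ) < R := by exact_mod_cast hR
  rw [sub_nonpos, le_div_iff₀ h2]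
  linarith

/-- Grönwall for the cutoff-weighted squared Hellinger distance. Pairing the two orientations of an
edge, the one-sided edge estimate produces the rate `K`. The variation `1/R` of the cutoff leaves an
error of at most a constant times the masses of the two densities, divided by `R`. The constants do
not depend on the weights, the densities, `T` or `R`. -/
lemma exists_hellinger_flow_le (hπ : ∀ i, 0 < G.π i) (hconn : G.graph.Connected) {Ψ : V → ℝ}
    {C : ℝ} (hC0 : 0 ≤ C) (hC : ∀ i j, G.graph.Adj i j → |Ψ j - Ψ i| ≤ C) (o : V) :
    ∃ K A : ℝ, 0 ≤ K ∧ 0 ≤ A ∧ ∀ (w w' : V → V → ℝ) (T : ℝ) (ρ ρ' : ℝ → V → ℝ) (R : ℕ),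
      G.IsWeight w → G.IsWeight w' → G.IsFlow w Ψ T ρ → G.IsFlow w' Ψ T ρ' → 0 < R →
      (∀ i j, G.graph.dist o i ≤ R → G.graph.dist o j ≤ R → w i j = w' i j) → ρ 0 = ρ' 0 →
      ∀ t ∈ Set.Icc 0 T, ∀ i,
        G.cutoff o R i * ((√(ρ t i) - √(ρ' t i)) ^ 2 * G.π i) ≤ A / R * t * Real.exp (K * t) := by
  obtain ⟨K, hK0, hK⟩ := exists_hellinger_edge_le C
  set K2 := 1 + C + rateBound C with hK2
  have hK2p : 0 ≤ K2 := by have := rateBound_pos hC0; positivity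
  refine ⟨K, 2 * K2, hK0, by positivity, ?_⟩
  intro w w' T ρ ρ' R hw hw' hρ hρ' hR hag h0 t ht i
  set S := ball hconn o R with hS
  set η := G.cutoff o R with hη
  have hη0 : ∀ i, 0 ≤ η i := cutoff_nonneg o R
  set δ : ℝ → V → ℝ := fun t i => √(ρ t i) - √(ρ' t i) with hδ
  set F : ℝ → V → V → ℝ := fun t i j => flux (Ψ j - Ψ i) (ρ t i) (ρ t j) with hF
  set F' : ℝ → V → V → ℝ := fun t i j => flux (Ψ j - Ψ i) (ρ' t i) (ρ' t j) with hF'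
  set X : ℝ → V → V → ℝ := fun t i j =>
    δ t i * (F t i j / √(ρ t i) - F' t i j / √(ρ' t i)) with hX
  set E : ℝ → ℝ := fun t => ∑ i ∈ S, η i * (δ t i ^ 2 * G.π i) with hE
  have hderiv : ∀ t ∈ Set.Icc 0 T, HasDerivWithinAt E
      (∑ i ∈ S, η i * ((2 * δ t i * (G.flowRate w Ψ (ρ t) i / (2 * √(ρ t i)) -
        G.flowRate w' Ψ (ρ' t) i / (2 * √(ρ' t i)))) * G.π i)) (Set.Icc 0 T) t := by
    intro t ht
    refine HasDerivWithinAt.fun_sum fun i _ => ?_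
    have h1 := (hρ.eqn t ht i).sqrt ((hρ.mem t ht).1 i).ne'
    have h2 := (hρ'.eqn t ht i).sqrt ((hρ'.mem t ht).1 i).ne'
    have h3 := (((h1.sub h2).pow 2).mul_const (G.π i)).const_mul (η i)
    refine h3.congr_deriv ?_
    simp [hδ]
  have hE' : ∀ t ∈ Set.Icc 0 T,
      (∑ i ∈ S, η i * ((2 * δ t i * (G.flowRate w Ψ (ρ t) i / (2 * √(ρ t i)) -
        G.flowRate w' Ψ (ρ' t) i / (2 * √(ρ' t i)))) * G.π i)) =
      ∑ i ∈ S, ∑ j ∈ S, w i j * (η i * X t i j) := by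
    intro t ht
    refine Finset.sum_congr rfl fun i hi => ?_
    have hiR := (mem_ball hconn).1 hi
    -- The cutoff vanishes on the sphere of radius `R`; a vertex strictly inside has all its
    -- neighbours in `S`, where the two weights agree.
    by_cases hi0 : R ≤ G.graph.dist o i
    · simp [hη, cutoff_eq_zero hR hi0]
    have hnb : ∀ j ∈ G.nbr i, j ∈ S := fun j hj => by
      have := dist_le_succ hconn o (G.mem_nbr.1 hj)
      exact (mem_ball hconn).2 (by omega)
    have ha := Real.sqrt_pos.2 ((hρ.mem t ht).1 i)
    have ha' := Real.sqrt_pos.2 ((hρ'.mem t ht).1 i)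
    have e1 := flowRate_mul_pi hπ w Ψ (ρ t) i
    have e2 := flowRate_mul_pi hπ w' Ψ (ρ' t) i
    have e2' : ∑ j ∈ G.nbr i, w' i j * flux (Ψ j - Ψ i) (ρ' t i) (ρ' t j) =
        ∑ j ∈ G.nbr i, w i j * flux (Ψ j - Ψ i) (ρ' t i) (ρ' t j) :=
      Finset.sum_congr rfl fun j hj => by
        rw [hag i j hiR ((mem_ball hconn).1 (hnb j hj))]
    rw [e2'] at e2
    rw [← hw.sum_nbr_eq (fun j hj _ => hnb j hj) fun j => η i * X t i j]
    calc _ = η i * (δ t i * (G.flowRate w Ψ (ρ t) i * G.π i / √(ρ t i) -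
          G.flowRate w' Ψ (ρ' t) i * G.π i / √(ρ' t i))) := by
            field_simp
      _ = _ := by
        rw [e1, e2, Finset.sum_div, Finset.sum_div, ← Finset.sum_sub_distrib, Finset.mul_sum,
          Finset.mul_sum]
        refine Finset.sum_congr rfl fun j _ => ?_
        simp only [hX, hF, hF']
        ring
  have hbound : ∀ t ∈ Set.Icc 0 T, ∑ i ∈ S, ∑ j ∈ S, w i j * (η i * X t i j) ≤
      K * E t + 2 * K2 / R := by
    intro t ht
    have hp := (hρ.mem t ht).1
    have hp' := (hρ'.mem t ht).1
    have hsw : ∑ i ∈ S, ∑ j ∈ S, w i j * (η i * X t i j) =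
        ∑ i ∈ S, ∑ j ∈ S, w i j * (η j * X t j i) := by
      rw [Finset.sum_comm]
      exact Finset.sum_congr rfl fun i _ => Finset.sum_congr rfl fun j _ => by rw [hw.symm]
    have hm : ∀ i, 0 ≤ K * (η i * δ t i ^ 2) + K2 / R * (ρ t i + ρ' t i) := fun i => by
      have := hη0 i; have := hp i; have := hp' i; positivity
    have hedge : ∀ i j, w i j * (η i * X t i j) + w i j * (η j * X t j i) ≤
        w i j * ((K * (η i * δ t i ^ 2) + K2 / R * (ρ t i + ρ' t i)) +
          (K * (η j * δ t j ^ 2) + K2 / R * (ρ t j + ρ' t j))) := by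
      intro i j
      by_cases hij : j ∈ G.nbr i
      swap
      · rw [hw.eq_zero hij]; simp
      have hadj := G.mem_nbr.1 hij
      rw [← mul_add]
      refine mul_le_mul_of_nonneg_left ?_ (hw.nonneg i j)
      have hsym : ∀ (f : V → ℝ), flux (Ψ i - Ψ j) (f j) (f i) = - flux (Ψ j - Ψ i) (f i) (f j) :=
        fun f => by rw [← flux_neg]; congr 1; ring
      have q1 := Real.sqrt_pos.2 (hp i)
      have q2 := Real.sqrt_pos.2 (hp j)
      have q3 := Real.sqrt_pos.2 (hp' i)
      have q4 := Real.sqrt_pos.2 (hp' j)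
      have s1 := Real.sq_sqrt (hp i).le
      have s2 := Real.sq_sqrt (hp j).le
      have s3 := Real.sq_sqrt (hp' i).le
      have s4 := Real.sq_sqrt (hp' j).le
      have i1 := hK _ (hC i j hadj) _ _ _ _ q1 q2 q3 q4
      have i2 := hellinger_vertex_le (hC i j hadj) q1 q2 q3 q4
      have i3 := hellinger_vertex_le (hC j i hadj.symm) q2 q1 q4 q3
      rw [s1, s2, s3, s4] at i1 i2 i3
      have hXX : X t i j + X t j i ≤ K * δ t i ^ 2 + K * δ t j ^ 2 := by
        simp only [hX, hF, hF', hδ, hsym]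
        rw [mul_add] at i1
        refine le_trans (le_of_eq ?_) i1
        ring
      have hmm : 0 ≤ K2 * (ρ t i + ρ t j + (ρ' t i + ρ' t j)) := by
        have := hp i; have := hp j; have := hp' i; have := hp' j; positivity
      have := cutoff_combination_le (hη0 i) (hη0 j) (abs_cutoff_sub_le hconn o R hadj)
        (mul_nonneg hK0 (sq_nonneg (δ t i))) (mul_nonneg hK0 (sq_nonneg (δ t j))) hmm hXX i2
        (i3.trans (le_of_eq (by ring)))
      refine this.trans (le_of_eq ?_)
      ring
    -- The double sum is taken twice, once with the orientation reversed, so that the paired edge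
    -- bound `hedge` can be used.
    have h1 : 2 * ∑ i ∈ S, ∑ j ∈ S, w i j * (η i * X t i j) ≤
        2 * ∑ i ∈ S, (K * (η i * δ t i ^ 2) + K2 / R * (ρ t i + ρ' t i)) * G.π i := by
      refine le_trans ?_ (hw.sum_sum_le S hm)
      rw [two_mul]
      nth_rw 2 [hsw]
      rw [← Finset.sum_add_distrib]
      refine Finset.sum_le_sum fun i _ => ?_
      rw [← Finset.sum_add_distrib]
      exact Finset.sum_le_sum fun j _ => hedge i j
    have h2 : ∑ i ∈ S, ρ t i * G.π i ≤ 1 :=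
      sum_le_hasSum S (fun j _ => mul_nonneg (hp j).le (hπ j).le) (hρ.mem t ht).2
    have h3 : ∑ i ∈ S, ρ' t i * G.π i ≤ 1 :=
      sum_le_hasSum S (fun j _ => mul_nonneg (hp' j).le (hπ j).le) (hρ'.mem t ht).2
    have h4 : ∑ i ∈ S, (K * (η i * δ t i ^ 2) + K2 / R * (ρ t i + ρ' t i)) * G.π i =
        K * E t + K2 / R * (∑ i ∈ S, ρ t i * G.π i + ∑ i ∈ S, ρ' t i * G.π i) := by
      rw [hE, Finset.mul_sum, ← Finset.sum_add_distrib, Finset.mul_sum, ← Finset.sum_add_distrib]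
      exact Finset.sum_congr rfl fun i _ => by ring
    rw [h4] at h1
    have h5 : K2 / R * (∑ i ∈ S, ρ t i * G.π i + ∑ i ∈ S, ρ' t i * G.π i) ≤ K2 / R * 2 := by
      gcongr; linarith
    have h6 : K2 / R * 2 = 2 * K2 / R := by ring
    linarith
  have hG := le_of_deriv_le_mul_add hK0 (by positivity : 0 ≤ 2 * K2 / (R : ℝ)) hderiv
    (fun t ht => (hE' t ht).le.trans (hbound t ht)) ht
  have hE0 : E 0 = 0 := by simp [hE, hδ, h0]
  rw [hE0, zero_add] at hG
  refine le_trans ?_ hG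
  by_cases hi : i ∈ S
  · exact Finset.single_le_sum (f := fun i => η i * (δ t i ^ 2 * G.π i))
      (fun j _ => mul_nonneg (hη0 j) (mul_nonneg (sq_nonneg _) (hπ j).le)) hi
  · have : R ≤ G.graph.dist o i := by
      rw [mem_ball hconn] at hi; omega
    rw [hη, cutoff_eq_zero hR this, zero_mul]
    exact Finset.sum_nonneg fun j _ => mul_nonneg (hη0 j) (mul_nonneg (sq_nonneg _) (hπ j).le)

/-- The cutoff is centred at the vertex where equality is to be shown, and its radius tends to
infinity. -/
lemma IsFlow.unique (hπ : ∀ i, 0 < G.π i) (hconn : G.graph.Connected) {Ψ : V → ℝ}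
    {C : ℝ} (hC0 : 0 ≤ C) (hC : ∀ i j, G.graph.Adj i j → |Ψ j - Ψ i| ≤ C) {T : ℝ}
    {ρ ρ' : ℝ → V → ℝ} (hρ : G.IsFlow G.ω Ψ T ρ) (hρ' : G.IsFlow G.ω Ψ T ρ') (h0 : ρ 0 = ρ' 0)
    {t : ℝ} (ht : t ∈ Set.Icc 0 T) : ρ t = ρ' t := by
  funext o
  obtain ⟨K, A, hK, hA, h⟩ := exists_hellinger_flow_le hπ hconn hC0 hC o
  have h1 : ∀ n : ℕ, (√(ρ t o) - √(ρ' t o)) ^ 2 * G.π o ≤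
      1 / ((n : ℝ) + 1) * (A * t * Real.exp (K * t)) := by
    intro n
    have h2 := h G.ω G.ω T ρ ρ' (n + 1) isWeight_omega isWeight_omega hρ hρ' n.succ_pos
      (fun _ _ _ _ => rfl) h0 t ht o
    simp only [cutoff, SimpleGraph.dist_self, Nat.cast_zero, zero_div, sub_zero,
      max_eq_right zero_le_one, one_mul, Nat.cast_add, Nat.cast_one] at h2
    refine h2.trans (le_of_eq ?_)
    ring
  have h2 : Tendsto (fun n : ℕ => 1 / ((n : ℝ) + 1) * (A * t * Real.exp (K * t))) atTop (𝓝 0) := by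
    simpa using tendsto_one_div_add_atTop_nhds_zero_nat.mul_const (A * t * Real.exp (K * t))
  have h3 := ge_of_tendsto' h2 h1
  have h4 : (√(ρ t o) - √(ρ' t o)) ^ 2 = 0 := by
    have := hπ o
    have h5 := sq_nonneg (√(ρ t o) - √(ρ' t o))
    nlinarith
  have h5 : √(ρ t o) = √(ρ' t o) := by
    have := pow_eq_zero_iff (two_ne_zero) |>.1 h4
    linarith
  exact (Real.sqrt_inj ((hρ.mem t ht).1 o).le ((hρ'.mem t ht).1 o).le).1 h5

end

end WeightedGraph

/-! ### Picard–Lindelöf on a prescribed interval for bounded Lipschitz fields -/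

lemma exists_solution_of_lipschitz_bounded {E : Type*} [NormedAddCommGroup E] [NormedSpace ℝ E]
    [CompleteSpace E] {f : E → E} {K : NNReal} {L : ℝ} (hf : LipschitzWith K f)
    (hL : ∀ x, ‖f x‖ ≤ L) (x₀ : E) {T : ℝ} (hT : 0 ≤ T) :
    ∃ α : ℝ → E, α 0 = x₀ ∧
      ∀ t ∈ Set.Icc 0 T, HasDerivWithinAt α (f (α t)) (Set.Icc 0 T) t := by
  have hL0 : 0 ≤ L := (norm_nonneg _).trans (hL x₀)
  -- A solution cannot leave the ball of radius `L T` before time `T`, so one application covers the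
  -- whole interval.
  have h : IsPicardLindelof (fun _ => f) (tmin := 0) (tmax := T) ⟨0, le_rfl, hT⟩ x₀
      (L.toNNReal * T.toNNReal) 0 L.toNNReal K :=
    { lipschitzOnWith := fun t _ => hf.lipschitzOnWith
      continuousOn := fun x _ => continuousOn_const
      norm_le := fun t _ x _ => by rw [Real.coe_toNNReal _ hL0]; exact hL x
      mul_max_le := by simp [hT] }
  exact h.exists_eq_forall_mem_Icc_hasDerivWithinAt₀

namespace WeightedGraph

noncomputable section

variable {V : Type*} {G : WeightedGraph V}

/-! ### Existence of flows on finite subgraphs -/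

/-- Discrete integration by parts on a set that no active edge leaves, from the antisymmetry of the
flux. Constant `g` gives conservation of mass. -/
lemma IsWeight.sum_mul_flowRate {w : V → V → ℝ} (hw : G.IsWeight w) (hπ : ∀ i, 0 < G.π i)
    (Ψ ρ g : V → ℝ) {S : Finset V} (hS : ∀ i ∈ S, ∀ j, w i j ≠ 0 → j ∈ S) :
    2 * ∑ i ∈ S, g i * (G.flowRate w Ψ ρ i * G.π i) =
      ∑ i ∈ S, ∑ j ∈ S, w i j * (flux (Ψ j - Ψ i) (ρ i) (ρ j) * (g i - g j)) := by
  have h1 : ∑ i ∈ S, g i * (G.flowRate w Ψ ρ i * G.π i) =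
      ∑ i ∈ S, ∑ j ∈ S, w i j * (flux (Ψ j - Ψ i) (ρ i) (ρ j) * g i) := by
    refine Finset.sum_congr rfl fun i hi => ?_
    rw [flowRate_mul_pi hπ, hw.sum_nbr_eq (fun j _ hne => hS i hi j hne), Finset.mul_sum]
    exact Finset.sum_congr rfl fun j _ => by ring
  have h2 : ∑ i ∈ S, ∑ j ∈ S, w i j * (flux (Ψ j - Ψ i) (ρ i) (ρ j) * g i) =
      ∑ i ∈ S, ∑ j ∈ S, w i j * (-flux (Ψ j - Ψ i) (ρ i) (ρ j) * g j) := by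
    rw [Finset.sum_comm]
    refine Finset.sum_congr rfl fun i _ => Finset.sum_congr rfl fun j _ => ?_
    rw [hw.symm, ← flux_neg, neg_sub]
  rw [two_mul]
  nth_rw 2 [h1]
  rw [h1, h2, ← h2]
  nth_rw 2 [h2]
  rw [← Finset.sum_add_distrib]
  refine Finset.sum_congr rfl fun i _ => ?_
  rw [← Finset.sum_add_distrib]
  exact Finset.sum_congr rfl fun j _ => by ring

open Classical in
variable (G) in
/-- The edge weights inside a finite set of vertices. -/
def innerWeight (A : Finset V) (i j : V) : ℝ := if i ∈ A ∧ j ∈ A then G.ω i j else 0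

lemma isWeight_innerWeight (A : Finset V) : G.IsWeight (G.innerWeight A) := by
  refine ⟨fun i j => ?_, fun i j => ?_, fun i j => ?_⟩ <;> unfold innerWeight
  · split_ifs
    exacts [G.omega_nonneg i j, le_rfl]
  · split_ifs
    exacts [le_rfl, G.omega_nonneg i j]
  · rw [G.ω_symm i j]
    by_cases hi : i ∈ A <;> by_cases hj : j ∈ A <;> simp [hi, hj]

lemma mem_of_innerWeight_ne {A : Finset V} {i j : V} (h : G.innerWeight A i j ≠ 0) :
    i ∈ A ∧ j ∈ A := by
  by_contra h'
  exact h (if_neg h')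

open Classical in
/-- Extension of a function on `A` by `ρ₀`. -/
def extendBy (A : Finset V) (ρ₀ : V → ℝ) (x : A → ℝ) (i : V) : ℝ :=
  if h : i ∈ A then x ⟨i, h⟩ else ρ₀ i

lemma extendBy_mem {A : Finset V} (ρ₀ : V → ℝ) (x : A → ℝ) (i : A) :
    extendBy A ρ₀ x i = x i := by
  simp [extendBy]

lemma extendBy_not_mem {A : Finset V} (ρ₀ : V → ℝ) (x : A → ℝ) {i : V} (h : i ∉ A) :
    extendBy A ρ₀ x i = ρ₀ i := by
  simp [extendBy, h]

lemma extendBy_pos {A : Finset V} {ρ₀ : V → ℝ} (hρ : ∀ i, 0 < ρ₀ i) {x : A → ℝ}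
    (hx : ∀ i, 0 < x i) (i : V) : 0 < extendBy A ρ₀ x i := by
  unfold extendBy
  split_ifs
  exacts [hx _, hρ _]

lemma contDiff_extendBy (A : Finset V) (ρ₀ : V → ℝ) (i : V) :
    ContDiff ℝ 1 fun x : A → ℝ => extendBy A ρ₀ x i := by
  unfold extendBy
  split_ifs with h
  · exact contDiff_apply ℝ ℝ _
  · exact contDiff_const

lemma contDiffOn_flowRate_extendBy (w : V → V → ℝ) (Ψ : V → ℝ) (A : Finset V) {ρ₀ : V → ℝ}
    (hρ : ∀ i, 0 < ρ₀ i) : ContDiffOn ℝ 1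
      (fun (x : A → ℝ) (i : A) => G.flowRate w Ψ (extendBy A ρ₀ x) i) {x | ∀ i, 0 < x i} := by
  rw [contDiffOn_pi]
  intro i
  unfold flowRate
  refine ContDiffOn.sum fun j _ => contDiffOn_const.mul ?_
  have h1 : ContDiffOn ℝ 1 (fun x : A → ℝ => (extendBy A ρ₀ x i, extendBy A ρ₀ x j))
      {x | ∀ i, 0 < x i} :=
    ((contDiff_extendBy A ρ₀ i).prodMk (contDiff_extendBy A ρ₀ j)).contDiffOn
  exact (contDiffOn_flux _).comp h1 fun x hx => ⟨extendBy_pos hρ hx _, extendBy_pos hρ hx _⟩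

/-- The field is smooth only for positive densities, so its argument is first clipped to the box
with sides `[δ, D]`, which makes it bounded and globally Lipschitz. The solution of the clipped
system is then shown to stay in the box. -/
lemma exists_flow_innerWeight [Nontrivial V] (hconn : G.graph.Connected) {Ψ : V → ℝ}
    {C : ℝ} (hC0 : 0 ≤ C) (hC : ∀ i j, G.graph.Adj i j → |Ψ j - Ψ i| ≤ C) {ρ₀ : V → ℝ}
    (hρ₀ : ρ₀ ∈ G.P0) (A : Finset V) {T : ℝ} (hT : 0 ≤ T) :
    ∃ ρ : ℝ → V → ℝ, G.IsFlow (G.innerWeight A) Ψ T ρ ∧ ρ 0 = ρ₀ ∧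
      ∀ t, ∀ i ∉ A, ρ t i = ρ₀ i := by
  obtain ⟨l, hl, -, hlπ⟩ := G.exists_pi_lower hconn
  have hπ := G.pi_pos hconn
  set w := G.innerWeight A with hwdef
  have hw : G.IsWeight w := isWeight_innerWeight A
  set M := rateBound C with hM
  have hM0 : 0 < M := rateBound_pos hC0
  -- `δ` lies strictly below the barrier `ρ₀ e^{-(M+1)t}` on all of `[0, T]`, so that the clip from
  -- below is inactive while the solution touches the barrier.
  obtain ⟨δ, ⟨hδ, hδD⟩, hδ0⟩ : ∃ δ : ℝ, ((∀ i ∈ A, δ < ρ₀ i * Real.exp (-((M + 1) * T))) ∧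
      δ < 1 / l) ∧ 0 < δ := by
    have h1 : ∀ᶠ δ : ℝ in 𝓝[>] 0, ∀ i ∈ A, δ < ρ₀ i * Real.exp (-((M + 1) * T)) := by
      rw [Filter.eventually_all_finset]
      intro i _
      exact nhdsWithin_le_nhds (eventually_lt_nhds (mul_pos (hρ₀.1 i) (Real.exp_pos _)))
    have h2 : ∀ᶠ δ : ℝ in 𝓝[>] 0, δ < 1 / l :=
      nhdsWithin_le_nhds (eventually_lt_nhds (by positivity))
    exact ((h1.and h2).and self_mem_nhdsWithin).exists
  set D := 1 / l with hD
  set F : (A → ℝ) → (A → ℝ) := fun x i => G.flowRate w Ψ (extendBy A ρ₀ x) i with hF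
  set box : Set (A → ℝ) := Set.pi Set.univ fun _ => Set.Icc δ D with hbox
  have hboxc : IsCompact box := isCompact_univ_pi fun _ => isCompact_Icc
  have hboxv : Convex ℝ box := convex_pi fun _ _ => convex_Icc _ _
  have hFbox : ContDiffOn ℝ 1 F box :=
    (contDiffOn_flowRate_extendBy w Ψ A hρ₀.1).mono fun x hx i =>
      hδ0.trans_le (hx i trivial).1
  obtain ⟨K, hK⟩ := (hFbox.locallyLipschitzOn hboxv).exists_lipschitzOnWith_of_compact hboxc
  obtain ⟨L, hL⟩ := hboxc.exists_bound_of_continuousOn hFbox.continuousOn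
  set c : (A → ℝ) → (A → ℝ) := fun x i => max δ (min D (x i)) with hc
  have hcbox : ∀ x, c x ∈ box := fun x i _ =>
    ⟨le_max_left _ _, max_le hδD.le (min_le_left _ _)⟩
  have hclip : LipschitzWith 1 c := by
    refine LipschitzWith.of_dist_le_mul fun x y => ?_
    rw [NNReal.coe_one, one_mul, dist_pi_le_iff dist_nonneg]
    intro i
    refine le_trans ?_ (dist_le_pi_dist x y i)
    rw [Real.dist_eq, Real.dist_eq]
    calc _ ≤ |min D (x i) - min D (y i)| := by
          simpa using abs_max_sub_max_le_max δ (min D (x i)) δ (min D (y i))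
      _ ≤ _ := by simpa using abs_min_sub_min_le_max D (x i) D (y i)
  have hFc : LipschitzWith (K * 1) (F ∘ c) := by
    rw [← lipschitzOnWith_univ]
    exact hK.comp hclip.lipschitzOnWith fun x _ => hcbox x
  obtain ⟨α, hα0, hα⟩ := exists_solution_of_lipschitz_bounded hFc (fun x => hL _ (hcbox x))
    (fun i : A => ρ₀ i) hT
  have hαi : ∀ t ∈ Set.Icc 0 T, ∀ i, HasDerivWithinAt (fun s => α s i)
      (G.flowRate w Ψ (extendBy A ρ₀ (c (α t))) i) (Set.Icc 0 T) t := fun t ht i =>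
    hasDerivWithinAt_pi.1 (hα t ht) i
  have hcpos : ∀ x i, 0 < c x i := fun x i => hδ0.trans_le (hcbox x i trivial).1
  -- The barrier decays at rate `M + 1` rather than `M` to get the strict inequality at a touching
  -- point that the comparison theorem requires.
  have hlow : ∀ i : A, ∀ t ∈ Set.Icc 0 T, ρ₀ i * Real.exp (-((M + 1) * t)) ≤ α t i := by
    intro i t ht
    have hB : ∀ t : ℝ, HasDerivAt (fun t => -(ρ₀ i * Real.exp (-((M + 1) * t))))
        ((M + 1) * (ρ₀ i * Real.exp (-((M + 1) * t)))) t := by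
      intro t
      have h1 : HasDerivAt (fun t => -((M + 1) * t)) (-(M + 1)) t := by
        simpa using ((hasDerivAt_id t).const_mul (M + 1)).fun_neg
      exact ((h1.exp.const_mul (ρ₀ i)).neg).congr_deriv (by ring)
    have key := image_le_of_deriv_right_lt_deriv_boundary'
      (f := fun t => - α t i) (f' := fun t => -G.flowRate w Ψ (extendBy A ρ₀ (c (α t))) i)
      (a := 0) (b := T)
      (fun t ht => (hαi t ht i).neg.continuousWithinAt)
      (fun t ht => ((hαi t ⟨ht.1, ht.2.le⟩ i).neg).mono_of_mem_nhdsWithin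
        (Icc_mem_nhdsGE_of_mem ht))
      (B := fun t => -(ρ₀ i * Real.exp (-((M + 1) * t))))
      (B' := fun t => (M + 1) * (ρ₀ i * Real.exp (-((M + 1) * t))))
      (by simp [hα0])
      (fun t _ => (hB t).continuousAt.continuousWithinAt)
      (fun t _ => (hB t).hasDerivWithinAt) ?_ ht
    · simpa using key
    · intro s hs heq
      have heq' : α s i = ρ₀ i * Real.exp (-((M + 1) * s)) := by
        have h : -α s i = -(ρ₀ i * Real.exp (-((M + 1) * s))) := heq
        linarith
      have h1 : δ < α s i := by
        rw [heq']
        refine (hδ i i.2).trans_le ?_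
        have := hs.2.le
        have := (hρ₀.1 i).le
        gcongr
      have h2 : c (α s) i ≤ α s i := max_le h1.le (min_le_right _ _)
      have h3 := le_flowRate hw hπ hC0 hC (extendBy_pos hρ₀.1 (hcpos (α s))) i
      rw [extendBy_mem] at h3
      rw [← heq']
      have h4 : rateBound C * c (α s) i ≤ M * α s i := by rw [hM]; gcongr
      show -G.flowRate w Ψ (extendBy A ρ₀ (c (α s))) i < _
      have : 0 < α s i := hδ0.trans h1
      linarith
  have hαpos : ∀ t ∈ Set.Icc 0 T, ∀ i, 0 < α t i := fun t ht i =>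
    (mul_pos (hρ₀.1 i) (Real.exp_pos _)).trans_le (hlow i t ht)
  -- Mass is conserved by the clipped system too: the cancellation over edges holds for the fluxes
  -- of any density.
  have hmass : ∀ t ∈ Set.Icc 0 T,
      ∑ i ∈ A, extendBy A ρ₀ (α t) i * G.π i = ∑ i ∈ A, ρ₀ i * G.π i := by
    have hd : ∀ t ∈ Set.Icc 0 T, HasDerivWithinAt
        (fun t => ∑ i ∈ A, extendBy A ρ₀ (α t) i * G.π i) 0 (Set.Icc 0 T) t := by
      intro t ht
      have h1 : HasDerivWithinAt (fun t => ∑ i ∈ A, extendBy A ρ₀ (α t) i * G.π i)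
          (∑ i ∈ A, G.flowRate w Ψ (extendBy A ρ₀ (c (α t))) i * G.π i) (Set.Icc 0 T) t := by
        refine HasDerivWithinAt.fun_sum fun i hi => HasDerivWithinAt.mul_const ?_ _
        have := hαi t ht ⟨i, hi⟩
        simpa [extendBy, hi] using this
      refine h1.congr_deriv ?_
      have h2 := hw.sum_mul_flowRate hπ Ψ (extendBy A ρ₀ (c (α t))) (fun _ => 1) (S := A)
        fun i _ j hne => (mem_of_innerWeight_ne hne).2
      simpa using h2
    intro t ht
    have := constant_of_derivWithin_zero (fun s hs => (hd s hs).differentiableWithinAt)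
      (fun s hs => (hd s ⟨hs.1, hs.2.le⟩).derivWithin
        (uniqueDiffOn_Icc (hs.1.trans_lt hs.2) s ⟨hs.1, hs.2.le⟩)) t ht
    rw [this]
    refine Finset.sum_congr rfl fun i hi => ?_
    rw [hα0, extendBy, dif_pos hi]
  -- Mass at most one and `π ≥ l` force `ρ ≤ 1/l = D`.
  have hup : ∀ t ∈ Set.Icc 0 T, ∀ i, α t i ≤ D := by
    intro t ht i
    have hp := extendBy_pos hρ₀.1 (hαpos t ht)
    have h1 : extendBy A ρ₀ (α t) i * G.π i ≤ ∑ i ∈ A, extendBy A ρ₀ (α t) i * G.π i :=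
      Finset.single_le_sum (f := fun i => extendBy A ρ₀ (α t) i * G.π i)
        (fun j _ => mul_nonneg (hp j).le (hπ j).le) i.2
    rw [hmass t ht, extendBy_mem] at h1
    have h2 : ∑ i ∈ A, ρ₀ i * G.π i ≤ 1 :=
      sum_le_hasSum A (fun j _ => mul_nonneg (hρ₀.1 j).le (hπ j).le) hρ₀.2
    rw [hD, le_div_iff₀ hl]
    nlinarith [hlπ i, hαpos t ht i]
  have hcα : ∀ t ∈ Set.Icc 0 T, c (α t) = α t := by
    intro t ht
    funext i
    have h1 : δ ≤ α t i := by
      refine (hδ i i.2).le.trans (le_trans ?_ (hlow i t ht))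
      have := ht.2
      have := (hρ₀.1 i).le
      gcongr
    simp only [hc]
    rw [min_eq_right (hup t ht i), max_eq_right h1]
  refine ⟨fun t => extendBy A ρ₀ (α t), ⟨fun t ht => ⟨extendBy_pos hρ₀.1 (hαpos t ht), ?_⟩, ?_⟩,
    ?_, fun t i hi => extendBy_not_mem _ _ hi⟩
  · have h1 : HasSum (fun i => (extendBy A ρ₀ (α t) i - ρ₀ i) * G.π i)
        (∑ i ∈ A, (extendBy A ρ₀ (α t) i - ρ₀ i) * G.π i) :=
      hasSum_sum_of_ne_finset_zero fun i hi => by rw [extendBy_not_mem _ _ hi]; simp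
    have h2 : ∑ i ∈ A, (extendBy A ρ₀ (α t) i - ρ₀ i) * G.π i = 0 := by
      simp only [sub_mul, Finset.sum_sub_distrib, hmass t ht, sub_self]
    rw [h2] at h1
    simpa [sub_mul] using h1.add hρ₀.2
  · intro t ht i
    by_cases hi : i ∈ A
    · have := hαi t ht ⟨i, hi⟩
      rw [hcα t ht] at this
      simpa [extendBy, hi] using this
    · have h0 : G.flowRate w Ψ (extendBy A ρ₀ (α t)) i = 0 := by
        refine Finset.sum_eq_zero fun j _ => ?_
        have : w i j = 0 := if_neg fun h => hi h.1
        rw [this]; simp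
      simp only [h0, extendBy_not_mem _ _ hi]
      exact hasDerivWithinAt_const _ _ _
  · funext i
    by_cases hi : i ∈ A
    · simp [hα0, extendBy, hi]
    · exact extendBy_not_mem _ _ hi

end

end WeightedGraph

namespace WeightedGraph

noncomputable section

variable {V : Type*} {G : WeightedGraph V}

/-! ### Second moments along flows -/

variable (G) in
/-- The weight `1 + d(o, i)²`. -/
def momentWeight (o i : V) : ℝ := 1 + (G.graph.dist o i : ℝ) ^ 2

lemma momentWeight_pos (o i : V) : 0 < G.momentWeight o i := by
  unfold momentWeight; positivity

/-- Distances of neighbours differ by at most one, so the change of `1 + d²` along an edge is at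
most twice its value at either end. -/
lemma mul_abs_momentWeight_sub_le (hconn : G.graph.Connected) (o : V) {i j : V}
    (h : G.graph.Adj i j) {x y : ℝ} (hx : 0 ≤ x) (hy : 0 ≤ y) :
    (x + y) * |G.momentWeight o i - G.momentWeight o j| ≤
      2 * (x * G.momentWeight o i + y * G.momentWeight o j) := by
  have h1 : (G.graph.dist o j : ℝ) ≤ G.graph.dist o i + 1 := by
    exact_mod_cast dist_le_succ hconn o h
  have h2 : (G.graph.dist o i : ℝ) ≤ G.graph.dist o j + 1 := by
    exact_mod_cast dist_le_succ hconn o h.symm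
  have h3 : (0 : ℝ) ≤ G.graph.dist o i := Nat.cast_nonneg _
  have h4 : (0 : ℝ) ≤ G.graph.dist o j := Nat.cast_nonneg _
  unfold momentWeight
  set a := (G.graph.dist o i : ℝ)
  set b := (G.graph.dist o j : ℝ)
  have e1 : |1 + a ^ 2 - (1 + b ^ 2)| ≤ 2 * (1 + a ^ 2) := by
    rw [abs_le]; constructor <;> nlinarith [sq_nonneg (a - 1)]
  have e2 : |1 + a ^ 2 - (1 + b ^ 2)| ≤ 2 * (1 + b ^ 2) := by
    rw [abs_le]; constructor <;> nlinarith [sq_nonneg (b - 1)]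
  have := mul_le_mul_of_nonneg_left e1 hx
  have := mul_le_mul_of_nonneg_left e2 hy
  linarith

/-- Integration by parts moves the difference onto the moment weight, where it is bounded by the
weight itself. The growth rate does not depend on `A`, so the bound survives the limit of growing
balls. -/
lemma IsFlow.sum_momentWeight_le (hπ : ∀ i, 0 < G.π i) (hconn : G.graph.Connected) {Ψ : V → ℝ}
    {C : ℝ} (hC0 : 0 ≤ C) (hC : ∀ i j, G.graph.Adj i j → |Ψ j - Ψ i| ≤ C) {A : Finset V} {T : ℝ}
    {ρ : ℝ → V → ℝ} (h : G.IsFlow (G.innerWeight A) Ψ T ρ) {o : V}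
    (hs : Summable fun i => G.momentWeight o i * ρ 0 i * G.π i)
    (hA : ∀ t, ∀ i ∉ A, ρ t i = ρ 0 i) {t : ℝ} (ht : t ∈ Set.Icc 0 T) (S : Finset V) :
    ∑ i ∈ S, G.momentWeight o i * ρ t i * G.π i ≤
      (∑' i, G.momentWeight o i * ρ 0 i * G.π i) * Real.exp (2 * (1 + C) * t) := by
  classical
  set w := G.innerWeight A
  have hw : G.IsWeight w := isWeight_innerWeight A
  set g := G.momentWeight o
  have hg : ∀ i, 0 < g i := momentWeight_pos o
  have hd : ∀ t ∈ Set.Icc 0 T, HasDerivWithinAt (fun t => ∑ i ∈ A, g i * ρ t i * G.π i)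
      (∑ i ∈ A, g i * (G.flowRate w Ψ (ρ t) i * G.π i)) (Set.Icc 0 T) t := by
    intro t ht
    refine HasDerivWithinAt.fun_sum fun i _ => ?_
    exact (((h.eqn t ht i).const_mul (g i)).mul_const (G.π i)).congr_deriv (by ring)
  have hb : ∀ t ∈ Set.Icc 0 T, ∑ i ∈ A, g i * (G.flowRate w Ψ (ρ t) i * G.π i) ≤
      2 * (1 + C) * (∑ i ∈ A, g i * ρ t i * G.π i) + 0 := by
    intro t ht
    have hp := (h.mem t ht).1
    have h1 := hw.sum_mul_flowRate hπ Ψ (ρ t) g (S := A)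
      fun i _ j hne => (mem_of_innerWeight_ne hne).2
    have hm : ∀ i, 0 ≤ (1 + C) * (2 * (g i * ρ t i)) := fun i => by
      have := hg i; have := hp i; positivity
    have h2 := hw.sum_sum_le A hm
    have h3 : ∑ i ∈ A, ∑ j ∈ A, w i j * (flux (Ψ j - Ψ i) (ρ t i) (ρ t j) * (g i - g j)) ≤
        ∑ i ∈ A, ∑ j ∈ A,
          w i j * ((1 + C) * (2 * (g i * ρ t i)) + (1 + C) * (2 * (g j * ρ t j))) := by
      refine Finset.sum_le_sum fun i _ => Finset.sum_le_sum fun j _ => ?_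
      by_cases hij : j ∈ G.nbr i
      swap
      · rw [hw.eq_zero hij]; simp
      have hadj := G.mem_nbr.1 hij
      refine mul_le_mul_of_nonneg_left ?_ (hw.nonneg i j)
      have e1 := abs_flux_le (hC i j hadj) (hp i) (hp j)
      have e2 := mul_abs_momentWeight_sub_le hconn o hadj (hp i).le (hp j).le
      calc _ ≤ |flux (Ψ j - Ψ i) (ρ t i) (ρ t j)| * |g i - g j| := by
            rw [← abs_mul]; exact le_abs_self _
        _ ≤ (1 + C) * (ρ t i + ρ t j) * |g i - g j| := by gcongr
        _ = (1 + C) * ((ρ t i + ρ t j) * |g i - g j|) := by ring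
        _ ≤ (1 + C) * (2 * (ρ t i * g i + ρ t j * g j)) := by gcongr
        _ = _ := by ring
    have h4 : ∑ i ∈ A, (1 + C) * (2 * (g i * ρ t i)) * G.π i =
        2 * (1 + C) * ∑ i ∈ A, g i * ρ t i * G.π i := by
      rw [Finset.mul_sum]; exact Finset.sum_congr rfl fun i _ => by ring
    rw [h4] at h2
    linarith
  have h1 := le_of_deriv_le_mul_add (by positivity) le_rfl hd hb ht
  rw [zero_mul, add_zero] at h1
  have hp := (h.mem t ht).1
  have hp0 := (h.mem 0 ⟨le_rfl, ht.1.trans ht.2⟩).1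
  have hnn : ∀ i, 0 ≤ g i * ρ 0 i * G.π i := fun i => by
    have := hg i; have := hp0 i; have := hπ i; positivity
  have hE : 1 ≤ Real.exp (2 * (1 + C) * t) := Real.one_le_exp (by have := ht.1; positivity)
  calc ∑ i ∈ S, g i * ρ t i * G.π i ≤ ∑ i ∈ A ∪ (S \ A), g i * ρ t i * G.π i := by
        refine Finset.sum_le_sum_of_subset_of_nonneg (fun i hi => ?_) fun i _ _ => ?_
        · simp [hi]
        · have := hg i; have := hp i; have := hπ i; positivity
    _ = ∑ i ∈ A, g i * ρ t i * G.π i + ∑ i ∈ S \ A, g i * ρ 0 i * G.π i := by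
        rw [Finset.sum_union Finset.disjoint_sdiff]
        congr 1
        exact Finset.sum_congr rfl fun i hi => by rw [hA t i (Finset.mem_sdiff.1 hi).2]
    _ ≤ (∑ i ∈ A, g i * ρ 0 i * G.π i) * Real.exp (2 * (1 + C) * t) +
        (∑ i ∈ S \ A, g i * ρ 0 i * G.π i) * Real.exp (2 * (1 + C) * t) := by
        gcongr
        exact le_mul_of_one_le_right (Finset.sum_nonneg fun i _ => hnn i) hE
    _ = (∑ i ∈ A ∪ (S \ A), g i * ρ 0 i * G.π i) * Real.exp (2 * (1 + C) * t) := by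
        rw [Finset.sum_union Finset.disjoint_sdiff, add_mul]
    _ ≤ _ := by
        gcongr
        exact hs.sum_le_tsum _ fun i _ => hnn i

/-- Chebyshev's inequality: outside the ball the moment weight is at least `R + 1`. This tightness
excludes loss of mass in the limit. -/
lemma sub_le_sum_ball (hπ : ∀ i, 0 < G.π i) (hconn : G.graph.Connected) {ρ : V → ℝ}
    (hρ : ρ ∈ G.P0) {o : V} {B : ℝ}
    (hB : ∀ S : Finset V, ∑ i ∈ S, G.momentWeight o i * ρ i * G.π i ≤ B) (R : ℕ) :
    1 - B / (R + 1) ≤ ∑ i ∈ ball hconn o R, ρ i * G.π i := by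
  classical
  rw [sub_le_comm, sub_le_iff_le_add]
  refine hasSum_le_of_sum_le hρ.2 fun S => ?_
  have hnn : ∀ i, 0 ≤ ρ i * G.π i := fun i => mul_nonneg (hρ.1 i).le (hπ i).le
  set D := ball hconn o R
  have h1 : ∑ i ∈ S, ρ i * G.π i ≤ ∑ i ∈ S \ D, ρ i * G.π i + ∑ i ∈ D, ρ i * G.π i := by
    rw [← Finset.sum_union Finset.sdiff_disjoint]
    exact Finset.sum_le_sum_of_subset_of_nonneg (by simp) fun i _ _ => hnn i
  refine h1.trans (add_le_add_left ?_ _)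
  rw [le_div_iff₀ (by positivity)]
  refine le_trans ?_ (hB (S \ D))
  rw [Finset.sum_mul]
  refine Finset.sum_le_sum fun i hi => ?_
  have h2 : R + 1 ≤ G.graph.dist o i := by
    have := (Finset.mem_sdiff.1 hi).2
    rw [mem_ball] at this; omega
  have h3 : (R : ℝ) + 1 ≤ G.graph.dist o i := by exact_mod_cast h2
  have h4 : (R : ℝ) + 1 ≤ G.momentWeight o i := by
    unfold momentWeight
    nlinarith [sq_nonneg ((G.graph.dist o i : ℝ) - 1)]
  calc _ ≤ ρ i * G.π i * G.momentWeight o i := mul_le_mul_of_nonneg_left h4 (hnn i)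
    _ = _ := by ring

/-! ### Existence of solutions -/

lemma innerWeight_ball_eq (hconn : G.graph.Connected) {o i j : V} {n : ℕ}
    (hi : G.graph.dist o i ≤ n) (hj : G.graph.dist o j ≤ n) :
    G.innerWeight (ball hconn o n) i j = G.ω i j :=
  if_pos ⟨(mem_ball hconn).2 hi, (mem_ball hconn).2 hj⟩

lemma flowRate_innerWeight_ball (hconn : G.graph.Connected) {o i : V} {n : ℕ}
    (hi : G.graph.dist o i + 1 ≤ n) (Ψ ρ : V → ℝ) :
    G.flowRate (G.innerWeight (ball hconn o n)) Ψ ρ i = G.flowRate G.ω Ψ ρ i := by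
  refine Finset.sum_congr rfl fun j hj => ?_
  have := dist_le_succ hconn o (G.mem_nbr.1 hj)
  rw [innerWeight_ball_eq hconn (by omega) (by omega)]

lemma abs_flowRate_le (hπ : ∀ i, 0 < G.π i) {w : V → V → ℝ} (hw : G.IsWeight w) {Ψ ρ : V → ℝ}
    {C l : ℝ} (hC : ∀ i j, G.graph.Adj i j → |Ψ j - Ψ i| ≤ C) (hC0 : 0 ≤ C)
    (hl : 0 < l) (hlπ : ∀ i, l ≤ G.π i)
    (hρ : ρ ∈ G.P0) (i : V) : |G.flowRate w Ψ ρ i| ≤ (1 + C) * (2 / l) := by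
  have h1 := abs_flowRate_mul_pi_le hπ hC hw.nonneg hw.le hρ.1 i
  have h2 : ∑ j ∈ G.nbr i, G.ω i j * (ρ i + ρ j) ≤ G.π i * (2 / l) := by
    rw [π, Finset.sum_mul]
    refine Finset.sum_le_sum fun j _ => mul_le_mul_of_nonneg_left ?_ (G.omega_nonneg i j)
    have h3 := density_le hl hlπ hρ i
    have h4 := density_le hl hlπ hρ j
    calc _ ≤ 1 / l + 1 / l := add_le_add h3 h4
      _ = _ := by ring
  have h3 : |G.flowRate w Ψ ρ i| * G.π i ≤ (1 + C) * (2 / l) * G.π i := by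
    refine h1.trans ?_
    calc _ ≤ (1 + C) * (G.π i * (2 / l)) := by gcongr
      _ = _ := by ring
  exact le_of_mul_le_mul_right h3 (hπ i)

lemma tendsto_flowRate {α : Type*} {F : Filter α} {w : V → V → ℝ} {Ψ : V → ℝ} {f : α → V → ℝ}
    {ρ : V → ℝ} (hρ : ∀ i, 0 < ρ i) (hf : ∀ i, Tendsto (fun a => f a i) F (𝓝 (ρ i))) (i : V) :
    Tendsto (fun a => G.flowRate w Ψ (f a) i) F (𝓝 (G.flowRate w Ψ ρ i)) :=
  tendsto_finsetSum _ fun j _ => ((hf i).flux (hρ i) (hρ j) (hf j)).const_mul _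

lemma IsFlow.lipschitz (hπ : ∀ i, 0 < G.π i) {w : V → V → ℝ} (hw : G.IsWeight w) {Ψ : V → ℝ}
    {C l : ℝ} (hC : ∀ i j, G.graph.Adj i j → |Ψ j - Ψ i| ≤ C) (hC0 : 0 ≤ C)
    (hl : 0 < l) (hlπ : ∀ i, l ≤ G.π i) {T : ℝ} {ρ : ℝ → V → ℝ} (h : G.IsFlow w Ψ T ρ) (i : V)
    {s t : ℝ} (hs : s ∈ Set.Icc 0 T) (ht : t ∈ Set.Icc 0 T) :
    |ρ t i - ρ s i| ≤ (1 + C) * (2 / l) * |t - s| :=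
  (convex_Icc 0 T).norm_image_sub_le_of_norm_hasDerivWithin_le (f := fun t => ρ t i)
    (fun x hx => h.eqn x hx i)
    (fun x hx => abs_flowRate_le hπ hw hC hC0 hl hlπ (h.mem x hx) i) hs ht

variable (G) in
/-- Flows on the balls about `o`, all with the same initial value. -/
structure IsApprox (hconn : G.graph.Connected) (o : V) (Ψ ρ₀ : V → ℝ) (r : ℕ → ℝ → V → ℝ) :
    Prop where
  flow : ∀ n : ℕ, G.IsFlow (G.innerWeight (ball hconn o n)) Ψ n (r n)
  init : ∀ n, r n 0 = ρ₀
  frozen : ∀ n t, ∀ i ∉ ball hconn o n, r n t i = ρ₀ i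

lemma exists_isApprox [Nontrivial V] (hconn : G.graph.Connected) {o : V} {Ψ : V → ℝ}
    (hΨ : G.IsPotential o Ψ) {ρ₀ : V → ℝ} (hρ₀ : ρ₀ ∈ G.P0) :
    ∃ r, G.IsApprox hconn o Ψ ρ₀ r := by
  obtain ⟨C, hC0, hC⟩ := hΨ.exists_bound
  choose r h1 h2 h3 using fun n : ℕ =>
    exists_flow_innerWeight hconn hC0 hC hρ₀ (ball hconn o n) (T := n) n.cast_nonneg
  exact ⟨r, h1, h2, h3⟩

/-- For `n ≥ N` the weights of the flows `n` and `N` agree inside the ball of radius `N`, so the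
Hellinger comparison makes `√(r n t i)` a Cauchy sequence. -/
lemma IsApprox.exists_tendsto [Nontrivial V] {hconn : G.graph.Connected} {o : V} {Ψ : V → ℝ}
    (hΨ : G.IsPotential o Ψ) {ρ₀ : V → ℝ} {r : ℕ → ℝ → V → ℝ} (hr : G.IsApprox hconn o Ψ ρ₀ r)
    {t : ℝ} (ht : 0 ≤ t) (i : V) : ∃ x, Tendsto (fun n => r n t i) atTop (𝓝 x) := by
  obtain ⟨C, hC0, hC⟩ := hΨ.exists_bound
  have hπ := G.pi_pos hconn
  obtain ⟨K, A, hK, hA, h⟩ := exists_hellinger_flow_le hπ hconn hC0 hC o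
  have hcau : CauchySeq fun n => √(r n t i) := by
    refine Metric.cauchySeq_iff'.2 fun ε hε => ?_
    have hlim : Tendsto (fun n : ℕ => (2 * (A * t * Real.exp (K * t)) / G.π i) / (n : ℝ)) atTop
        (𝓝 0) := tendsto_const_div_atTop_nhds_zero_nat _
    -- `N > 2 d(o, i)` makes the cutoff at `i` at least 1/2; `N ≥ t` puts `t` in the time interval
    -- of both flows.
    obtain ⟨N, hN1, hN2, hN3⟩ := ((hlim.eventually (eventually_lt_nhds (pow_pos hε 2))).and
      ((eventually_ge_atTop (2 * G.graph.dist o i + 1)).and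
        (eventually_ge_atTop ⌈t⌉₊))).exists
    refine ⟨N, fun n hn => ?_⟩
    have htN : t ≤ N := (Nat.le_ceil t).trans (by exact_mod_cast hN3)
    have hnN : (N : ℝ) ≤ n := by exact_mod_cast hn
    have hN0 : 0 < N := by omega
    have hNr : (0 : ℝ) < N := by exact_mod_cast hN0
    have h1 := h _ _ N (r n) (r N) N (isWeight_innerWeight _) (isWeight_innerWeight _)
      ((hr.flow n).mono hnN) (hr.flow N) hN0
      (fun i j hi hj => by
        rw [innerWeight_ball_eq hconn (hi.trans hn) (hj.trans hn),
          innerWeight_ball_eq hconn hi hj])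
      (by rw [hr.init, hr.init]) t ⟨ht, htN⟩ i
    have h2 : 1 / 2 ≤ G.cutoff o N i := by
      refine le_trans ?_ (le_max_right _ _)
      have : 2 * (G.graph.dist o i : ℝ) + 1 ≤ N := by exact_mod_cast hN2
      have : (G.graph.dist o i : ℝ) / N ≤ 1 / 2 := by
        rw [div_le_iff₀ hNr]; linarith
      linarith
    have h3 : (√(r n t i) - √(r N t i)) ^ 2 < ε ^ 2 := by
      refine lt_of_le_of_lt ?_ hN1
      rw [div_right_comm, le_div_iff₀ (hπ i)]
      have h4 : 0 ≤ (√(r n t i) - √(r N t i)) ^ 2 * G.π i := mul_nonneg (sq_nonneg _) (hπ i).le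
      calc _ = 2 * (1 / 2 * ((√(r n t i) - √(r N t i)) ^ 2 * G.π i)) := by ring
        _ ≤ 2 * (A / N * t * Real.exp (K * t)) :=
            mul_le_mul_of_nonneg_left ((mul_le_mul_of_nonneg_right h2 h4).trans h1) zero_le_two
        _ = _ := by ring
    rw [Real.dist_eq]
    exact abs_lt_of_sq_lt_sq h3 hε.le
  obtain ⟨x, hx⟩ := cauchySeq_tendsto_of_complete hcau
  refine ⟨x ^ 2, (hx.pow 2).congr' ?_⟩
  filter_upwards [eventually_ge_atTop ⌈t⌉₊] with n hn
  have htn : t ≤ n := (Nat.le_ceil t).trans (by exact_mod_cast hn)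
  exact Real.sq_sqrt (((hr.flow n).mem t ⟨ht, htn⟩).1 i).le

/-- Positivity and moments pass to the pointwise limit by the uniform bounds. The equation passes in
integrated form, by dominated convergence with a constant bound on the rates, and is differentiated
at the end using continuity of the rate. -/
lemma IsApprox.exists_isSolution [Nontrivial V] {hconn : G.graph.Connected} {o : V} {Ψ : V → ℝ}
    (hΨ : G.IsPotential o Ψ) {ρ₀ : V → ℝ} (hρ₀ : ρ₀ ∈ G.P0star o) {r : ℕ → ℝ → V → ℝ}
    (hr : G.IsApprox hconn o Ψ ρ₀ r) :
    ∃ ρ, G.IsSolution o Ψ ρ₀ ρ ∧ ∀ t, 0 ≤ t → ∀ i, Tendsto (fun n => r n t i) atTop (𝓝 (ρ t i)) := by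
  obtain ⟨C, hC0, hC⟩ := hΨ.exists_bound
  obtain ⟨l, hl, -, hlπ⟩ := G.exists_pi_lower hconn
  have hπ := G.pi_pos hconn
  choose! ρ hlim using fun (t : ℝ) (ht : 0 ≤ t) i => hr.exists_tendsto hΨ ht i
  have hev : ∀ t : ℝ, 0 ≤ t → ∀ᶠ n : ℕ in atTop, t ∈ Set.Icc (0 : ℝ) n := by
    intro t ht
    filter_upwards [eventually_ge_atTop ⌈t⌉₊] with n hn
    exact ⟨ht, (Nat.le_ceil t).trans (by exact_mod_cast hn)⟩
  have hpos : ∀ t, 0 ≤ t → ∀ i, 0 < ρ t i := by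
    intro t ht i
    refine lt_of_lt_of_le (mul_pos (hρ₀.1.1 i) (Real.exp_pos (-(rateBound C * t)))) ?_
    refine ge_of_tendsto (hlim t ht i) ?_
    filter_upwards [hev t ht] with n hn
    have h1 := (hr.flow n).le_exp_mul (isWeight_innerWeight _) hπ hC0 hC i le_rfl ht hn.2
    rw [hr.init, sub_zero] at h1
    rw [Real.exp_neg, ← div_eq_mul_inv, div_le_iff₀ (Real.exp_pos _), mul_comm]
    exact h1
  have hmom0 : Summable fun i => G.momentWeight o i * ρ₀ i * G.π i := summable_weight hρ₀
  have hmomn : ∀ t : ℝ, 0 ≤ t → ∀ n : ℕ, t ≤ n → ∀ S : Finset V,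
      ∑ i ∈ S, G.momentWeight o i * r n t i * G.π i ≤
      (∑' i, G.momentWeight o i * ρ₀ i * G.π i) * Real.exp (2 * (1 + C) * t) := by
    intro t ht n hn S
    have h1 := (hr.flow n).sum_momentWeight_le hπ hconn hC0 hC (o := o)
      (by rw [hr.init]; exact hmom0) (fun t i hi => by rw [hr.frozen n t i hi, hr.init])
      ⟨ht, hn⟩ S
    rwa [hr.init] at h1
  have hmom : ∀ t : ℝ, 0 ≤ t → ∀ S : Finset V,
      ∑ i ∈ S, G.momentWeight o i * ρ t i * G.π i ≤
      (∑' i, G.momentWeight o i * ρ₀ i * G.π i) * Real.exp (2 * (1 + C) * t) := by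
    intro t ht S
    refine le_of_tendsto (tendsto_finsetSum S fun i _ => ((hlim t ht i).const_mul _).mul_const _) ?_
    filter_upwards [hev t ht] with n hn using hmomn t ht n hn.2 S
  have hmem : ∀ t, 0 ≤ t → ρ t ∈ G.P0star o := by
    intro t ht
    have hp := hpos t ht
    have hnn : ∀ i, 0 ≤ ρ t i * G.π i := fun i => mul_nonneg (hp i).le (hπ i).le
    have hle : ∀ S : Finset V, ∑ i ∈ S, ρ t i * G.π i ≤ 1 := by
      intro S
      refine le_of_tendsto (tendsto_finsetSum S fun i _ => (hlim t ht i).mul_const _) ?_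
      filter_upwards [hev t ht] with n hn
      have hm := (hr.flow n).mem t hn
      exact sum_le_hasSum S (fun i _ => mul_nonneg (hm.1 i).le (hπ i).le) hm.2
    have hsum := summable_of_sum_le hnn hle
    -- Pointwise convergence alone could lose mass at infinity; on each ball the approximations keep
    -- mass `1 - B/(R + 1)`, uniformly in `n`.
    have hge : 1 ≤ ∑' i, ρ t i * G.π i := by
      set B := (∑' i, G.momentWeight o i * ρ₀ i * G.π i) * Real.exp (2 * (1 + C) * t)
      have h1 : ∀ R : ℕ, 1 - B / (R + 1) ≤ ∑' i, ρ t i * G.π i := by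
        intro R
        refine le_trans ?_ (hsum.sum_le_tsum (ball hconn o R) fun i _ => hnn i)
        refine ge_of_tendsto (tendsto_finsetSum _ fun i _ => (hlim t ht i).mul_const _) ?_
        filter_upwards [hev t ht] with n hn
        exact sub_le_sum_ball hπ hconn ((hr.flow n).mem t hn) (hmomn t ht n hn.2) R
      have h2 : Tendsto (fun R : ℕ => 1 - B / ((R : ℝ) + 1)) atTop (𝓝 (1 - B * 0)) := by
        refine tendsto_const_nhds.sub ?_
        refine (tendsto_one_div_add_atTop_nhds_zero_nat.const_mul B).congr fun R => ?_
        ring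
      rw [mul_zero, sub_zero] at h2
      exact le_of_tendsto' h2 h1
    refine ⟨⟨hp, ?_⟩, ?_⟩
    · have : ∑' i, ρ t i * G.π i = 1 := le_antisymm (hsum.tsum_le_of_sum_le hle) hge
      exact this ▸ hsum.hasSum
    · refine Summable.of_nonneg_of_le (fun i => ?_) (fun i => ?_) (summable_of_sum_le (fun i => ?_)
        (hmom t ht))
      · have := hp i; have := hπ i; positivity
      · have h1 := hp i
        have h2 := hπ i
        unfold momentWeight
        gcongr
        linarith
      · have := hp i; have := hπ i; have := momentWeight_pos (G := G) o i; positivity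
  have hlip : ∀ i, ∀ s, 0 ≤ s → ∀ t, 0 ≤ t → |ρ t i - ρ s i| ≤ (1 + C) * (2 / l) * |t - s| := by
    intro i s hs t ht
    refine le_of_tendsto ((hlim t ht i).sub (hlim s hs i)).abs ?_
    filter_upwards [hev t ht, hev s hs] with n hn hn'
    exact (hr.flow n).lipschitz hπ (isWeight_innerWeight _) hC hC0 hl hlπ i hn' hn
  have hcont : ∀ i, ContinuousOn (fun t => ρ t i) (Set.Ici 0) := by
    intro i
    have : LipschitzOnWith ((1 + C) * (2 / l)).toNNReal (fun t => ρ t i) (Set.Ici 0) := by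
      refine LipschitzOnWith.of_dist_le_mul fun t ht s hs => ?_
      rw [Real.coe_toNNReal _ (by positivity)]
      exact hlip i s hs t ht
    exact this.continuousOn
  have hfcont : ∀ i, ContinuousOn (fun t => G.flowRate G.ω Ψ (ρ t) i) (Set.Ici 0) :=
    fun i t ht => tendsto_flowRate (hpos t ht) (fun j => hcont j t ht) i
  have hint : ∀ i, ∀ t, 0 ≤ t → ρ t i = ρ₀ i + ∫ s in (0 : ℝ)..t, G.flowRate G.ω Ψ (ρ s) i := by
    intro i t ht
    have hncont : ∀ n : ℕ, ContinuousOn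
        (fun s => G.flowRate (G.innerWeight (ball hconn o n)) Ψ (r n s) i) (Set.Icc 0 n) :=
      fun n s hs => tendsto_flowRate ((hr.flow n).mem s hs).1
        (fun j => ((hr.flow n).eqn s hs j).continuousWithinAt) i
    have h1 : ∀ᶠ n in atTop, r n t i = ρ₀ i +
        ∫ s in (0 : ℝ)..t, G.flowRate (G.innerWeight (ball hconn o n)) Ψ (r n s) i := by
      filter_upwards [hev t ht] with n hn
      have h2 := intervalIntegral.integral_eq_sub_of_hasDerivAt_of_le (a := 0) (b := t)
        (f := fun s => r n s i)
        (f' := fun s => G.flowRate (G.innerWeight (ball hconn o n)) Ψ (r n s) i) ht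
        (fun s hs => (((hr.flow n).eqn s ⟨hs.1, hs.2.trans hn.2⟩ i).continuousWithinAt).mono
          (Set.Icc_subset_Icc_right hn.2))
        (fun s hs => ((hr.flow n).eqn s ⟨hs.1.le, hs.2.le.trans hn.2⟩ i).hasDerivAt
          (Icc_mem_nhds hs.1 (hs.2.trans_le hn.2)))
        (((hncont n).mono (by rw [Set.uIcc_of_le ht]; exact Set.Icc_subset_Icc_right hn.2)
          ).intervalIntegrable)
      rw [h2, hr.init]; ring
    have h2 : Tendsto (fun n : ℕ => ∫ s in (0 : ℝ)..t,
        G.flowRate (G.innerWeight (ball hconn o n)) Ψ (r n s) i) atTop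
        (𝓝 (∫ s in (0 : ℝ)..t, G.flowRate G.ω Ψ (ρ s) i)) := by
      refine intervalIntegral.tendsto_integral_filter_of_dominated_convergence
        (fun _ => (1 + C) * (2 / l)) ?_ ?_ intervalIntegrable_const ?_
      · filter_upwards [hev t ht] with n hn
        rw [Set.uIoc_of_le ht]
        exact ((hncont n).mono (Set.Ioc_subset_Icc_self.trans
          (Set.Icc_subset_Icc_right hn.2))).aestronglyMeasurable measurableSet_Ioc
      · filter_upwards [hev t ht] with n hn
        refine Eventually.of_forall fun s hs => ?_
        rw [Set.uIoc_of_le ht] at hs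
        exact abs_flowRate_le hπ (isWeight_innerWeight _) hC hC0 hl hlπ
          ((hr.flow n).mem s ⟨hs.1.le, hs.2.trans hn.2⟩) i
      · refine Eventually.of_forall fun s hs => ?_
        rw [Set.uIoc_of_le ht] at hs
        refine (tendsto_flowRate (hpos s hs.1.le) (hlim s hs.1.le) i).congr' ?_
        -- Once the ball contains all neighbours of `i`, the truncated rate at `i` is the full rate.
        filter_upwards [eventually_ge_atTop (G.graph.dist o i + 1)] with n hn
        exact (flowRate_innerWeight_ball hconn hn Ψ _).symm
    have h3 := tendsto_nhds_unique (hlim t ht i) ((h2.const_add (ρ₀ i)).congr'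
      (h1.mono fun n hn => hn.symm))
    exact h3
  refine ⟨ρ, ⟨?_, hmem, ?_⟩, hlim⟩
  · funext i
    have := hint i 0 le_rfl
    simpa using this
  · intro t ht i
    rw [fokkerPlanck_eq_flowRate Ψ (hpos t ht)]
    have htmem : t ∈ Set.Icc 0 (t + 1) := ⟨ht, by linarith⟩
    have hFact : Fact (t ∈ Set.Icc 0 (t + 1)) := ⟨htmem⟩
    have hc1 : ContinuousOn (fun s => G.flowRate G.ω Ψ (ρ s) i) (Set.Icc 0 (t + 1)) :=
      (hfcont i).mono Set.Icc_subset_Ici_self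
    have h1 : HasDerivWithinAt (fun u => ∫ s in (0 : ℝ)..u, G.flowRate G.ω Ψ (ρ s) i)
        (G.flowRate G.ω Ψ (ρ t) i) (Set.Icc 0 (t + 1)) t := by
      refine intervalIntegral.integral_hasDerivWithinAt_right
        ((hc1.mono ?_).intervalIntegrable)
        (hc1.stronglyMeasurableAtFilter_nhdsWithin measurableSet_Icc t) (hc1 t htmem)
      rw [Set.uIcc_of_le ht]
      exact Set.Icc_subset_Icc_right (by linarith)
    have h2 : HasDerivWithinAt (fun u => ρ u i) (G.flowRate G.ω Ψ (ρ t) i)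
        (Set.Icc 0 (t + 1)) t :=
      (h1.const_add (ρ₀ i)).congr (fun u hu => hint i u hu.1) (hint i t ht)
    refine h2.mono_of_mem_nhdsWithin ?_
    have : Set.Icc 0 (t + 1) = Set.Ici 0 ∩ Set.Iic (t + 1) := rfl
    rw [this]
    exact inter_mem_nhdsWithin _ (Iic_mem_nhds (by linarith))

lemma IsSolution.isFlow {o : V} {Ψ ρ₀ : V → ℝ} {ρ : ℝ → V → ℝ} (h : G.IsSolution o Ψ ρ₀ ρ)
    (T : ℝ) : G.IsFlow G.ω Ψ T ρ :=
  ⟨fun t ht => (h.mem t ht.1).1, fun t ht i => by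
    rw [← fokkerPlanck_eq_flowRate Ψ (h.mem t ht.1).1.1]
    exact (h.eqn t ht.1 i).mono Set.Icc_subset_Ici_self⟩

lemma IsSolution.unique (hπ : ∀ i, 0 < G.π i) (hconn : G.graph.Connected) {o : V} {Ψ ρ₀ : V → ℝ}
    (hΨ : G.IsPotential o Ψ) {ρ ρ' : ℝ → V → ℝ} (h : G.IsSolution o Ψ ρ₀ ρ)
    (h' : G.IsSolution o Ψ ρ₀ ρ') {t : ℝ} (ht : 0 ≤ t) : ρ t = ρ' t := by
  obtain ⟨C, hC0, hC⟩ := hΨ.exists_bound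
  exact (h.isFlow t).unique hπ hconn hC0 hC (h'.isFlow t) (h.init.trans h'.init.symm) ⟨ht, le_rfl⟩

/-- By uniqueness every solution is the limit of the finite flows, so estimates proved by
differentiating finite sums carry over to it. -/
lemma IsSolution.tendsto_approx [Nontrivial V] {hconn : G.graph.Connected} {o : V} {Ψ : V → ℝ}
    (hΨ : G.IsPotential o Ψ) {ρ₀ : V → ℝ} (hρ₀ : ρ₀ ∈ G.P0star o) {r : ℕ → ℝ → V → ℝ}
    (hr : G.IsApprox hconn o Ψ ρ₀ r) {ρ : ℝ → V → ℝ} (h : G.IsSolution o Ψ ρ₀ ρ) {t : ℝ}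
    (ht : 0 ≤ t) (i : V) : Tendsto (fun n => r n t i) atTop (𝓝 (ρ t i)) := by
  obtain ⟨ρ', h1, h2⟩ := hr.exists_isSolution hΨ hρ₀
  rw [h.unique (G.pi_pos hconn) hconn hΨ h1 ht]
  exact h2 t ht i

end

end WeightedGraph

/-! ### The edge entropy -/

/-- The edge entropy `p log ((p + q) / q)`. -/
noncomputable def edgeEnt (p q : ℝ) : ℝ := p * (Real.log (p + q) - Real.log q)

lemma edgeEnt_nonneg {p q : ℝ} (hp : 0 < p) (hq : 0 < q) : 0 ≤ edgeEnt p q :=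
  mul_nonneg hp.le (sub_nonneg.2 (Real.log_le_log hq (by linarith)))

/-- Apply `log z ≤ z - 1` to `z = λ p X / r`. It exchanges a logarithm belonging to another edge for
the entropy of the edge `(r, p)` plus a small multiple of `p X`. -/
lemma mul_log_le_edgeEnt {r p X lam : ℝ} (hr : 0 < r) (hp : 0 < p) (hX : 0 < X) (hl : 0 < lam) :
    r * Real.log X ≤ edgeEnt r p - r * Real.log lam + lam * (p * X) := by
  have h1 := Real.log_le_sub_one_of_pos (show 0 < lam * p * X / r by positivity)
  rw [Real.log_div (by positivity) hr.ne', Real.log_mul (by positivity) hX.ne',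
    Real.log_mul hl.ne' hp.ne'] at h1
  have h2 : Real.log r ≤ Real.log (r + p) := Real.log_le_log hr (by linarith)
  have h3 := mul_le_mul_of_nonneg_left h1 hr.le
  have h4 : r * (lam * p * X / r - 1) = lam * (p * X) - r := by field_simp
  unfold edgeEnt
  nlinarith

/-- Used with `s` proportional to `t`; the term `2/√s` is the source of the `1/√t` singularity. -/
lemma log_le_mul_add {X s : ℝ} (hX : 0 < X) (hs : 0 < s) : Real.log X ≤ s * X + 2 / √s := by
  have h1 := Real.log_le_sub_one_of_pos (mul_pos hs hX)
  rw [Real.log_mul hs.ne' hX.ne'] at h1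
  have h2 : 0 < √s := Real.sqrt_pos.2 hs
  have h3 := Real.log_le_sub_one_of_pos (inv_pos.2 h2)
  rw [Real.log_inv, Real.log_sqrt hs.le] at h3
  have h4 : 2 / √s = 2 * (√s)⁻¹ := by ring
  rw [h4]
  linarith

/-- With `X = (p + q)/q`, the inflow `κp/2` into `q` yields the negative term `-(κ/2) p X`, of
higher order in `X` than the entropy `p log X` itself. The only comparably delicate term is `U log
X`, from the growth of `p`. -/
lemma edgeEnt_deriv_le {p q p' q' U D M κ : ℝ} (hp : 0 < p) (hq : 0 < q) (hD : 0 ≤ D)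
    (hU : 0 ≤ U) (hp' : p' ≤ D * U) (hq' : κ / 2 * p - M * q ≤ q') (hM : 0 ≤ M) (hκ : 0 ≤ κ) :
    p' * (Real.log (p + q) - Real.log q) + p * ((p' + q') / (p + q) - q' / q) ≤
      D * (U * Real.log ((p + q) / q)) + D * U + M * p + κ * p - κ / 2 * (p * ((p + q) / q)) := by
  have hX : Real.log (p + q) - Real.log q = Real.log ((p + q) / q) :=
    (Real.log_div (by positivity) hq.ne').symm
  have hlog : 0 ≤ Real.log ((p + q) / q) := Real.log_nonneg (by rw [le_div_iff₀ hq]; linarith)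
  have hDU : 0 ≤ D * U := mul_nonneg hD hU
  rw [hX]
  have e1 : p' * Real.log ((p + q) / q) ≤ D * U * Real.log ((p + q) / q) := by gcongr
  have e2 : p * ((p' + q') / (p + q) - q' / q) =
      p / (p + q) * p' - p ^ 2 / (q * (p + q)) * q' := by
    field_simp; ring
  have e3 : p / (p + q) * p' ≤ D * U := by
    have h1 : p / (p + q) ≤ 1 := by rw [div_le_one (by positivity)]; linarith
    have h2 : 0 ≤ p / (p + q) := by positivity
    nlinarith
  have e4 : p ^ 2 / (q * (p + q)) * (κ / 2 * p - M * q) ≤ p ^ 2 / (q * (p + q)) * q' := by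
    gcongr
  have e5 : κ / 2 * (p * ((p + q) / q)) - κ * p - M * p ≤
      p ^ 2 / (q * (p + q)) * (κ / 2 * p - M * q) := by
    have : p ^ 2 / (q * (p + q)) * (κ / 2 * p - M * q) -
        (κ / 2 * (p * ((p + q) / q)) - κ * p - M * p) = κ / 2 * (p * q / (p + q)) + M * (p * q / (p + q)) := by
      field_simp; ring
    have h2 : 0 ≤ κ / 2 * (p * q / (p + q)) + M * (p * q / (p + q)) := by positivity
    linarith
  rw [e2]
  linarith

/-! ### Smoothing of the total edge entropy -/

namespace WeightedGraph

noncomputable section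

variable {V : Type*} {G : WeightedGraph V}

open Classical in
variable (G) in
/-- The neighbours inside the set `A`. -/
def innerNbr (A : Finset V) (i : V) : Finset V := (G.nbr i).filter (· ∈ A)

lemma mem_innerNbr {A : Finset V} {i j : V} :
    j ∈ G.innerNbr A i ↔ G.graph.Adj i j ∧ j ∈ A := by
  simp [innerNbr, mem_nbr]

lemma sum_innerNbr_comm {A : Finset V} (f : V → V → ℝ) :
    ∑ i ∈ A, ∑ j ∈ G.innerNbr A i, f i j = ∑ i ∈ A, ∑ j ∈ G.innerNbr A i, f j i := by
  refine Finset.sum_comm' fun i j => ?_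
  simp only [mem_innerNbr, G.graph.adj_comm i j]
  tauto

lemma sum_nbr_eq_sum_innerNbr {A : Finset V} {i : V} {f : V → ℝ} (h : ∀ j ∉ A, f j = 0) :
    ∑ j ∈ G.nbr i, f j = ∑ j ∈ G.innerNbr A i, f j := by
  classical
  exact (Finset.sum_filter_of_ne fun j _ hj => by_contra fun hA => hj (h j hA)).symm

/-- Constants controlling the geometry of the graph. -/
structure Bounds (G : WeightedGraph V) (l P : ℝ) (N : ℕ) : Prop where
  pos : 0 < l
  le_omega : ∀ i j, G.graph.Adj i j → l ≤ G.ω i j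
  le_pi : ∀ i, l ≤ G.π i
  pi_le : ∀ i, G.π i ≤ P
  card_le : ∀ i, (G.nbr i).card ≤ N

lemma exists_bounds [Nontrivial V] (hconn : G.graph.Connected) : ∃ l P N, G.Bounds l P N := by
  obtain ⟨l, h1, h2, h3⟩ := G.exists_pi_lower hconn
  obtain ⟨P, -, h4⟩ := G.exists_pi_upper
  obtain ⟨N, hN⟩ := G.nbr_bound
  exact ⟨l, P, N, h1, h2, h3, h4, hN⟩

lemma flowRate_innerWeight_le (hπ : ∀ i, 0 < G.π i) {Ψ ρ : V → ℝ} {C : ℝ}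
    (hC0 : 0 ≤ C) (hC : ∀ i j, G.graph.Adj i j → |Ψ j - Ψ i| ≤ C) (hρ : ∀ i, 0 < ρ i)
    (A : Finset V) (i : V) :
    G.flowRate (G.innerWeight A) Ψ ρ i ≤ (1 + C) * (ρ i + ∑ j ∈ G.innerNbr A i, ρ j) := by
  set w := G.innerWeight A
  have hw : G.IsWeight w := isWeight_innerWeight A
  have h0 : ∀ j ∉ A, w i j / G.π i * flux (Ψ j - Ψ i) (ρ i) (ρ j) = 0 := fun j hj => by
    have : w i j = 0 := if_neg fun h => hj h.2
    rw [this]; simp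
  rw [flowRate, sum_nbr_eq_sum_innerNbr h0]
  have h1 : ∀ j ∈ G.innerNbr A i, w i j / G.π i * flux (Ψ j - Ψ i) (ρ i) (ρ j) ≤
      (1 + C) * (w i j / G.π i * ρ i + ρ j) := by
    intro j hj
    have hadj := (mem_innerNbr.1 hj).1
    have e1 := (abs_le.1 (abs_flux_le (hC i j hadj) (hρ i) (hρ j))).2
    have e2 : 0 ≤ w i j / G.π i := div_nonneg (hw.nonneg i j) (hπ i).le
    have e3 : w i j / G.π i ≤ 1 :=
      (div_le_one (hπ i)).2 ((hw.le i j).trans (G.omega_le_pi i j))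
    calc _ ≤ w i j / G.π i * ((1 + C) * (ρ i + ρ j)) := by gcongr
      _ = (1 + C) * (w i j / G.π i * ρ i + w i j / G.π i * ρ j) := by ring
      _ ≤ (1 + C) * (w i j / G.π i * ρ i + 1 * ρ j) := by
          have := (hρ j).le
          gcongr
      _ = _ := by rw [one_mul]
  refine (Finset.sum_le_sum h1).trans ?_
  rw [← Finset.mul_sum, Finset.sum_add_distrib, ← Finset.sum_mul, ← Finset.sum_div]
  have e1 : (∑ j ∈ G.innerNbr A i, w i j) / G.π i ≤ 1 :=
    (div_le_one (hπ i)).2 (hw.sum_le _ i)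
  have := (hρ i).le
  gcongr
  nlinarith

/-- Of all inflows into `j` only the one from `i` is kept; its relative weight is at least `l / P`.
-/
lemma le_flowRate_innerWeight {l P : ℝ} {N : ℕ} (hG : G.Bounds l P N) {Ψ ρ : V → ℝ} {C : ℝ}
    (hC0 : 0 ≤ C) (hC : ∀ i j, G.graph.Adj i j → |Ψ j - Ψ i| ≤ C) (hρ : ∀ i, 0 < ρ i)
    {A : Finset V} {i j : V} (hj : j ∈ A) (hi : i ∈ A) (hij : G.graph.Adj i j) :
    l / P / 2 * ρ i - rateBound C * ρ j ≤ G.flowRate (G.innerWeight A) Ψ ρ j := by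
  have hπ : ∀ i, 0 < G.π i := fun i => hG.pos.trans_le (hG.le_pi i)
  set w := G.innerWeight A with hwd
  have hw : G.IsWeight w := isWeight_innerWeight A
  have h1 : ∑ k ∈ G.nbr j, w j k / G.π j * (ρ k / 2 - rateBound C * ρ j) ≤ G.flowRate w Ψ ρ j := by
    refine Finset.sum_le_sum fun k hk => ?_
    exact mul_le_mul_of_nonneg_left (le_flux (hC j k (G.mem_nbr.1 hk)) (hρ j) (hρ k))
      (div_nonneg (hw.nonneg j k) (hπ j).le)
  refine le_trans ?_ h1
  simp only [mul_sub, Finset.sum_sub_distrib]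
  refine sub_le_sub ?_ ?_
  · have h2 : w j i / G.π j * (ρ i / 2) ≤ ∑ k ∈ G.nbr j, w j k / G.π j * (ρ k / 2) :=
      Finset.single_le_sum (f := fun k => w j k / G.π j * (ρ k / 2)) (fun k _ =>
        mul_nonneg (div_nonneg (hw.nonneg j k) (hπ j).le) (by have := hρ k; positivity))
        (G.mem_nbr.2 hij.symm)
    refine le_trans ?_ h2
    have h3 : w j i = G.ω j i := if_pos ⟨hj, hi⟩
    have h4 : l / P ≤ w j i / G.π j := by
      rw [h3]
      exact div_le_div₀ (G.omega_nonneg j i) (hG.le_omega j i hij.symm) (hπ j) (hG.pi_le j)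
    have := (hρ i).le
    calc _ = l / P * (ρ i / 2) := by ring
      _ ≤ _ := by gcongr
  · rw [← Finset.sum_mul, ← Finset.sum_div]
    have h2 : (∑ k ∈ G.nbr j, w j k) / G.π j ≤ 1 := (div_le_one (hπ j)).2 (hw.sum_le _ j)
    have h3 : 0 ≤ rateBound C * ρ j := mul_nonneg (rateBound_pos hC0).le (hρ j).le
    nlinarith

-- With `E` the total edge entropy, the aim is `(tE)' ≤ a tE + Q/√t`. Half of the negative term of
-- `edgeEnt_deriv_le` absorbs the neighbour contributions, the other half, multiplied by `t`,
-- absorbs `E` itself. As `tE` vanishes at `t = 0`, integration gives a bound independent of `A` and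
-- of the initial entropy.
set_option maxHeartbeats 1600000 in
lemma exists_edgeEnt_flow_le {l P : ℝ} {N : ℕ} (hG : G.Bounds l P N) {Ψ : V → ℝ} {C : ℝ}
    (hC0 : 0 ≤ C) (hC : ∀ i j, G.graph.Adj i j → |Ψ j - Ψ i| ≤ C) {T : ℝ} (hT : 0 ≤ T) :
    ∃ K : ℝ, 0 ≤ K ∧ ∀ (A : Finset V) (ρ : ℝ → V → ℝ), G.IsFlow (G.innerWeight A) Ψ T ρ →
      ∀ t ∈ Set.Ioc 0 T,
        ∑ i ∈ A, ∑ j ∈ G.innerNbr A i, edgeEnt (ρ t i) (ρ t j) ≤ K / √t := by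
  have hπ : ∀ i, 0 < G.π i := fun i => hG.pos.trans_le (hG.le_pi i)
  by_cases hV : IsEmpty V
  · refine ⟨0, le_rfl, fun A ρ _ t _ => ?_⟩
    rw [Finset.eq_empty_of_isEmpty A]; simp
  rw [not_isEmpty_iff] at hV
  obtain ⟨v⟩ := hV
  have hP : 0 < P := (hπ v).trans_le (hG.pi_le v)
  set κ := l / P with hκd
  have hl := hG.pos
  have hκ : 0 < κ := by positivity
  have hκ1 : κ ≤ 1 := (div_le_one hP).2 ((hG.le_pi v).trans (hG.pi_le v))
  set D := 1 + C with hD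
  have hD1 : 1 ≤ D := by linarith
  set M := rateBound C with hM
  have hM0 : 0 < M := rateBound_pos hC0
  -- Chosen so that the errors `λ ρ_i X` from `i` and its at most `N` neighbours, multiplied by `D`,
  -- total `κ/4`, half of the available `κ/2`.
  set lam := κ / (4 * D * (1 + N)) with hlam
  have hlam0 : 0 < lam := by positivity
  have hlam1 : lam ≤ 1 := by
    rw [hlam, div_le_one (by positivity)]
    have : (0 : ℝ) ≤ N := Nat.cast_nonneg _
    nlinarith [mul_nonneg (by linarith : 0 ≤ D) this]
  set L := -Real.log lam with hL
  have hL0 : 0 ≤ L := by have := Real.log_nonpos hlam0.le hlam1; linarith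
  set C3 := D * (L + 1) + D + M + κ with hC3
  have hC30 : 0 ≤ C3 := by positivity
  set c := κ / 4 with hc
  have hc0 : 0 < c := by positivity
  set Q := N * ((1 + N) / l) * (C3 * T * √T + 2 / √c) with hQ
  have hQ0 : 0 ≤ Q := by positivity
  set a := D * N with ha
  have ha0 : 0 ≤ a := by positivity
  refine ⟨2 * Q * Real.exp (a * T), by positivity, fun A ρ hρ t ht => ?_⟩
  set w := G.innerWeight A with hwd
  set E : ℝ → ℝ := fun t => ∑ i ∈ A, ∑ j ∈ G.innerNbr A i, edgeEnt (ρ t i) (ρ t j) with hE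
  set U : ℝ → V → ℝ := fun t i => ρ t i + ∑ k ∈ G.innerNbr A i, ρ t k with hU
  set f' : ℝ → V → V → ℝ := fun t i j =>
    G.flowRate w Ψ (ρ t) i * (Real.log (ρ t i + ρ t j) - Real.log (ρ t j)) +
      ρ t i * ((G.flowRate w Ψ (ρ t) i + G.flowRate w Ψ (ρ t) j) / (ρ t i + ρ t j) -
        G.flowRate w Ψ (ρ t) j / ρ t j) with hf'
  have hcard : ∀ i, ((G.innerNbr A i).card : ℝ) ≤ N := fun i => by
    classical
    exact_mod_cast (Finset.card_filter_le _ _).trans (hG.card_le i)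
  have hEd : ∀ t ∈ Set.Icc 0 T, HasDerivWithinAt E
      (∑ i ∈ A, ∑ j ∈ G.innerNbr A i, f' t i j) (Set.Icc 0 T) t := by
    intro t ht
    refine HasDerivWithinAt.fun_sum fun i _ => HasDerivWithinAt.fun_sum fun j _ => ?_
    have hp := (hρ.mem t ht).1
    have h1 := hρ.eqn t ht i
    have h2 := hρ.eqn t ht j
    exact h1.mul (((h1.add h2).log (add_pos (hp i) (hp j)).ne').sub
      (h2.log (hp j).ne'))
  have hedge : ∀ t ∈ Set.Ioc 0 T, ∀ i ∈ A, ∀ j ∈ G.innerNbr A i,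
      edgeEnt (ρ t i) (ρ t j) + t * f' t i j ≤
        D * ∑ k ∈ G.innerNbr A i, t * edgeEnt (ρ t k) (ρ t i) +
          (C3 * t + 2 / √(c * t)) * U t i := by
    intro t ht i hi j hj
    have hadj := (mem_innerNbr.1 hj).1
    have hjA := (mem_innerNbr.1 hj).2
    have hp := (hρ.mem t ⟨ht.1.le, ht.2⟩).1
    have hpi := hp i
    have hpj := hp j
    set X := (ρ t i + ρ t j) / ρ t j with hX
    have hX0 : 0 < X := by positivity
    have hU0 : ρ t i ≤ U t i := by
      have : 0 ≤ ∑ k ∈ G.innerNbr A i, ρ t k := Finset.sum_nonneg fun k _ => (hp k).le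
      simp only [hU]; linarith
    have h1 := edgeEnt_deriv_le hpi hpj (D := D) (U := U t i) (M := M) (κ := κ) (by positivity)
      (hpi.le.trans hU0) (flowRate_innerWeight_le hπ hC0 hC hp A i)
      (le_flowRate_innerWeight hG hC0 hC hp hjA hi hadj) hM0.le hκ.le
    rw [← hX] at h1
    -- Each density in `U` is traded separately, the one at `i` against the harmless self-entropy `ρ
    -- log 2`.
    have h2 : U t i * Real.log X ≤ ∑ k ∈ G.innerNbr A i, edgeEnt (ρ t k) (ρ t i) + L * U t i +
        ρ t i + (1 + N) * (lam * (ρ t i * X)) := by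
      have e1 := mul_log_le_edgeEnt hpi hpi hX0 hlam0
      have e2 : edgeEnt (ρ t i) (ρ t i) ≤ ρ t i := by
        have : Real.log (ρ t i + ρ t i) = Real.log 2 + Real.log (ρ t i) := by
          rw [← two_mul, Real.log_mul two_ne_zero hpi.ne']
        rw [edgeEnt, this]
        nlinarith [Real.log_two_lt_d9]
      have e3 : ∑ k ∈ G.innerNbr A i, ρ t k * Real.log X ≤ ∑ k ∈ G.innerNbr A i,
          (edgeEnt (ρ t k) (ρ t i) - ρ t k * Real.log lam + lam * (ρ t i * X)) :=
        Finset.sum_le_sum fun k _ => mul_log_le_edgeEnt (hp k) hpi hX0 hlam0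
      rw [Finset.sum_add_distrib, Finset.sum_sub_distrib, Finset.sum_const, nsmul_eq_mul,
        ← Finset.sum_mul, ← Finset.sum_mul] at e3
      have e4 : ((G.innerNbr A i).card : ℝ) * (lam * (ρ t i * X)) ≤ N * (lam * (ρ t i * X)) := by
        exact mul_le_mul_of_nonneg_right (hcard i) (by positivity)
      have e5 : U t i * Real.log X = ρ t i * Real.log X + ∑ k ∈ G.innerNbr A i, ρ t k * Real.log X := by
        rw [← Finset.sum_mul]; simp only [hU]; ring
      have e6 : L * U t i = -(ρ t i * Real.log lam) -
          (∑ k ∈ G.innerNbr A i, ρ t k) * Real.log lam := by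
        simp only [hU, hL]; ring
      rw [← Finset.sum_mul] at e5
      linarith
    have h3 : D * ((1 + N) * (lam * (ρ t i * X))) = κ / 4 * (ρ t i * X) := by
      rw [hlam]; field_simp
    have h4 : f' t i j ≤ D * ∑ k ∈ G.innerNbr A i, edgeEnt (ρ t k) (ρ t i) + C3 * U t i -
        c * (ρ t i * X) := by
      have e1 := mul_le_mul_of_nonneg_left h2 (by positivity : 0 ≤ D)
      have e2 : (D + M + κ) * ρ t i ≤ (D + M + κ) * U t i := by gcongr
      refine h1.trans ?_
      simp only [hC3, hc]
      linarith
    -- The slope `s = c t` matches the remaining negative term `-c ρ_i X` multiplied by `t`.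
    have h5 : edgeEnt (ρ t i) (ρ t j) ≤ c * t * (ρ t i * X) + 2 / √(c * t) * U t i := by
      have e1 := log_le_mul_add hX0 (mul_pos hc0 ht.1)
      have e2 : edgeEnt (ρ t i) (ρ t j) = ρ t i * Real.log X := by
        rw [edgeEnt, hX, Real.log_div (by positivity) hpj.ne']
      have e3 : 2 / √(c * t) * ρ t i ≤ 2 / √(c * t) * U t i := by gcongr
      rw [e2]
      have := mul_le_mul_of_nonneg_left e1 hpi.le
      linarith
    have h6 := mul_le_mul_of_nonneg_left h4 ht.1.le
    rw [← Finset.mul_sum]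
    linarith
  have hsum : ∀ t ∈ Set.Ioc 0 T, E t + t * ∑ i ∈ A, ∑ j ∈ G.innerNbr A i, f' t i j ≤
      a * (t * E t) + Q / √t := by
    intro t ht
    have htmem : t ∈ Set.Icc 0 T := ⟨ht.1.le, ht.2⟩
    have hp := (hρ.mem t htmem).1
    have hsq : 0 < √t := Real.sqrt_pos.2 ht.1
    have hb0 : 0 ≤ C3 * t + 2 / √(c * t) := by have := ht.1.le; positivity
    have hU0 : ∀ i, 0 ≤ U t i := fun i =>
      add_nonneg (hp i).le (Finset.sum_nonneg fun k _ => (hp k).le)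
    have hF0 : ∀ i, 0 ≤ ∑ k ∈ G.innerNbr A i, t * edgeEnt (ρ t k) (ρ t i) := fun i =>
      Finset.sum_nonneg fun k _ => mul_nonneg ht.1.le (edgeEnt_nonneg (hp k) (hp i))
    have hswap : t * E t = ∑ i ∈ A, ∑ k ∈ G.innerNbr A i, t * edgeEnt (ρ t k) (ρ t i) := by
      rw [← sum_innerNbr_comm fun i j => t * edgeEnt (ρ t i) (ρ t j)]
      simp only [hE, Finset.mul_sum]
    have hmass : ∑ i ∈ A, ρ t i ≤ 1 / l := by
      have h1 : ∑ i ∈ A, ρ t i * G.π i ≤ 1 :=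
        sum_le_hasSum A (fun i _ => mul_nonneg (hp i).le (hπ i).le) (hρ.mem t htmem).2
      rw [le_div_iff₀ hl, Finset.sum_mul]
      exact (Finset.sum_le_sum fun i _ => mul_le_mul_of_nonneg_left (hG.le_pi i) (hp i).le).trans h1
    have hUsum : ∑ i ∈ A, U t i ≤ (1 + N) / l := by
      have h1 : ∑ i ∈ A, ∑ k ∈ G.innerNbr A i, ρ t k ≤ N * ∑ i ∈ A, ρ t i := by
        rw [sum_innerNbr_comm fun _ k => ρ t k, Finset.mul_sum]
        refine Finset.sum_le_sum fun i _ => ?_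
        rw [Finset.sum_const, nsmul_eq_mul]
        exact mul_le_mul_of_nonneg_right (hcard i) (hp i).le
      simp only [hU, Finset.sum_add_distrib]
      calc _ ≤ (1 + N) * ∑ i ∈ A, ρ t i := by linarith
        _ ≤ (1 + N) * (1 / l) := by gcongr
        _ = _ := by ring
    have h1 : E t + t * ∑ i ∈ A, ∑ j ∈ G.innerNbr A i, f' t i j ≤
        ∑ i ∈ A, N * (D * ∑ k ∈ G.innerNbr A i, t * edgeEnt (ρ t k) (ρ t i) +
          (C3 * t + 2 / √(c * t)) * U t i) := by
      simp only [hE]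
      rw [Finset.mul_sum, ← Finset.sum_add_distrib]
      refine Finset.sum_le_sum fun i hi => ?_
      rw [Finset.mul_sum, ← Finset.sum_add_distrib]
      refine (Finset.sum_le_card_nsmul _ _ _ fun j hj => hedge t ht i hi j hj).trans ?_
      rw [nsmul_eq_mul]
      refine mul_le_mul_of_nonneg_right (hcard i) ?_
      exact add_nonneg (mul_nonneg (by positivity) (hF0 i))
        (mul_nonneg hb0 (hU0 i))
    rw [← Finset.mul_sum, Finset.sum_add_distrib, ← Finset.mul_sum, ← Finset.mul_sum,
      ← hswap] at h1
    have h2 : (C3 * t + 2 / √(c * t)) * ∑ i ∈ A, U t i ≤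
        (C3 * T * √T + 2 / √c) / √t * ((1 + N) / l) := by
      refine mul_le_mul ?_ hUsum (Finset.sum_nonneg fun i _ => hU0 i) (by positivity)
      rw [add_div, Real.sqrt_mul hc0.le, ← div_div]
      refine add_le_add ?_ le_rfl
      rw [le_div_iff₀ hsq]
      have := ht.2
      have := ht.1.le
      gcongr
    have h3 : (N : ℝ) * (D * (t * E t) + (C3 * t + 2 / √(c * t)) * ∑ i ∈ A, U t i) ≤
        N * (D * (t * E t) + (C3 * T * √T + 2 / √c) / √t * ((1 + N) / l)) := by gcongr
    refine h1.trans (h3.trans (le_of_eq ?_))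
    rw [ha, hQ]; ring
  -- Integrating factor `e^{-at}`, with `2Q√t` as primitive of the forcing `Q/√t`.
  have hH : AntitoneOn (fun t => Real.exp (-(a * t)) * (t * E t) - 2 * Q * √t) (Set.Icc 0 T) := by
    have hexp : ∀ t : ℝ, HasDerivAt (fun t => Real.exp (-(a * t))) (Real.exp (-(a * t)) * (-a)) t := by
      intro t
      have := ((hasDerivAt_id t).const_mul a).fun_neg.exp
      simpa using this
    refine antitoneOn_of_hasDerivWithinAt_nonpos (convex_Icc 0 T)
      (f' := fun t => (Real.exp (-(a * t)) * (-a)) * (t * E t) + Real.exp (-(a * t)) *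
        (1 * E t + t * ∑ i ∈ A, ∑ j ∈ G.innerNbr A i, f' t i j) - 2 * Q * (1 / (2 * √t)))
      (fun t ht => ?_) (fun t ht => ?_) fun t ht => ?_
    · refine ContinuousWithinAt.sub ?_ ?_
      · exact ((hexp t).continuousAt.continuousWithinAt).mul
          (continuousWithinAt_id.mul (hEd t ht).continuousWithinAt)
      · exact (continuous_const.mul Real.continuous_sqrt).continuousWithinAt
    · have ht' := interior_subset ht
      rw [interior_Icc] at ht
      have h1 := ((hexp t).hasDerivWithinAt (s := Set.Icc 0 T)).mul
        ((hasDerivWithinAt_id t _).mul (hEd t ht'))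
      have h2 := ((Real.hasDerivAt_sqrt ht.1.ne').const_mul (2 * Q)).hasDerivWithinAt
        (s := Set.Icc 0 T)
      exact (h1.sub h2).mono interior_subset
    · rw [interior_Icc] at ht
      have h1 := hsum t ⟨ht.1, ht.2.le⟩
      have h2 : Real.exp (-(a * t)) ≤ 1 :=
        Real.exp_le_one_iff.2 (by have := mul_nonneg ha0 ht.1.le; linarith)
      have h3 := Real.exp_pos (-(a * t))
      have h4 : 0 ≤ Q / √t := by positivity
      have h5 := mul_le_mul_of_nonneg_left h1 h3.le
      have h6 : 2 * Q * (1 / (2 * √t)) = Q / √t := by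
        field_simp
      have h7 := mul_le_mul_of_nonneg_right h2 h4
      rw [h6]
      simp only [mul_add] at h5
      linarith
  have h := hH ⟨le_rfl, hT⟩ ⟨ht.1.le, ht.2⟩ ht.1.le
  simp only [zero_mul, mul_zero, Real.sqrt_zero, sub_zero, sub_nonpos] at h
  rw [Real.exp_neg, inv_mul_le_iff₀ (Real.exp_pos _)] at h
  have hsq : 0 < √t := Real.sqrt_pos.2 ht.1
  rw [le_div_iff₀ hsq]
  have h1 : √t * (√t * E t) ≤ √t * (2 * Q * Real.exp (a * T)) := by
    calc √t * (√t * E t) = t * E t := by rw [← mul_assoc, Real.mul_self_sqrt ht.1.le]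
      _ ≤ Real.exp (a * t) * (2 * Q * √t) := h
      _ ≤ Real.exp (a * T) * (2 * Q * √t) := by
          have := ht.2
          gcongr
      _ = _ := by ring
  have h2 := le_of_mul_le_mul_left h1 hsq
  rwa [mul_comm] at h2

/-- The edge entropies of a solution are summable for positive times, with an explicit rate. -/
lemma IsSolution.exists_edgeEnt_le [Nontrivial V] (hconn : G.graph.Connected) {o : V} {Ψ : V → ℝ}
    (hΨ : G.IsPotential o Ψ) {ρ₀ : V → ℝ} (hρ₀ : ρ₀ ∈ G.P0star o) {ρ : ℝ → V → ℝ}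
    (h : G.IsSolution o Ψ ρ₀ ρ) {T : ℝ} (hT : 0 ≤ T) :
    ∃ K : ℝ, 0 ≤ K ∧ ∀ t ∈ Set.Ioc 0 T, ∀ S : Finset (V × V),
      (∀ e ∈ S, G.graph.Adj e.1 e.2) → ∑ e ∈ S, edgeEnt (ρ t e.1) (ρ t e.2) ≤ K / √t := by
  classical
  obtain ⟨C, hC0, hC⟩ := hΨ.exists_bound
  obtain ⟨l, P, N, hG⟩ := exists_bounds hconn
  obtain ⟨K, hK0, hK⟩ := exists_edgeEnt_flow_le hG hC0 hC hT
  obtain ⟨r, hr⟩ := exists_isApprox hconn hΨ hρ₀.1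
  refine ⟨K, hK0, fun t ht S hS => ?_⟩
  have hp := (h.mem t ht.1.le).1.1
  have hlim : ∀ i, Tendsto (fun n => r n t i) atTop (𝓝 (ρ t i)) :=
    fun i => h.tendsto_approx hΨ hρ₀ hr ht.1.le i
  refine le_of_tendsto (f := fun n => ∑ e ∈ S, edgeEnt (r n t e.1) (r n t e.2))
    (x := atTop) ?_ ?_
  · refine tendsto_finsetSum S fun e _ => ?_
    have h1 := hlim e.1
    have h2 := hlim e.2
    have := hp e.1
    have := hp e.2
    exact h1.mul (((h1.add h2).log (add_pos (hp e.1) (hp e.2)).ne').sub (h2.log (hp e.2).ne'))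
  -- Finitely many edges lie in one ball, hence are part of the sum controlled for all large `n`.
  · obtain ⟨m, hm⟩ : ∃ m : ℕ, ∀ e ∈ S, G.graph.dist o e.1 ≤ m ∧ G.graph.dist o e.2 ≤ m := by
      refine ⟨∑ e ∈ S, (G.graph.dist o e.1 + G.graph.dist o e.2), fun e he => ?_⟩
      have := Finset.single_le_sum (f := fun e : V × V => G.graph.dist o e.1 + G.graph.dist o e.2)
        (fun _ _ => Nat.zero_le _) he
      omega
    filter_upwards [eventually_ge_atTop m, eventually_ge_atTop ⌈T⌉₊] with n hn hn'
    have hTn : T ≤ n := (Nat.le_ceil T).trans (by exact_mod_cast hn')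
    have hf := (hr.flow n).mono hTn
    have hq := (hf.mem t ⟨ht.1.le, ht.2⟩).1
    refine le_trans ?_ (hK (ball hconn o n) (r n) hf t ht)
    rw [Finset.sum_sigma']
    have hinj : Set.InjOn (fun e : V × V => (⟨e.1, e.2⟩ : Σ _ : V, V)) S := by
      rintro ⟨a, b⟩ _ ⟨c, d⟩ _ h
      simpa using h
    rw [← Finset.sum_image (f := fun x : Σ _ : V, V => edgeEnt (r n t x.1) (r n t x.2)) hinj]
    refine Finset.sum_le_sum_of_subset_of_nonneg ?_ fun x _ _ => edgeEnt_nonneg (hq _) (hq _)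
    intro x hx
    obtain ⟨e, he, rfl⟩ := Finset.mem_image.1 hx
    rw [Finset.mem_sigma, mem_innerNbr, mem_ball, mem_ball]
    exact ⟨(hm e he).1.trans hn, hS e he, (hm e he).2.trans hn⟩

end

end WeightedGraph

/-! ### Dissipation and gradient flows -/

lemma mul_log_sub_le_edgeEnt {p q : ℝ} (hp : 0 < p) (hq : 0 < q) :
    (q - p) * (Real.log q - Real.log p) ≤ edgeEnt p q + edgeEnt q p := by
  have key : ∀ {p q : ℝ}, 0 < p → p ≤ q →
      (q - p) * (Real.log q - Real.log p) ≤ edgeEnt q p := by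
    intro p q hp h
    have h1 : Real.log q ≤ Real.log (q + p) := Real.log_le_log (hp.trans_le h) (by linarith)
    have h2 : Real.log p ≤ Real.log q := Real.log_le_log hp h
    exact mul_le_mul (by linarith) (by linarith) (by linarith) (hp.le.trans h)
  rcases le_total p q with h | h
  · linarith [key hp h, edgeEnt_nonneg hp hq]
  · have h1 := key hq h
    have h2 : (p - q) * (Real.log p - Real.log q) = (q - p) * (Real.log q - Real.log p) := by ring
    linarith [edgeEnt_nonneg hq hp]

lemma integrableOn_inv_sqrt : IntegrableOn (fun x : ℝ => (√x)⁻¹) (Set.Icc 0 1) := by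
  have h := intervalIntegral.intervalIntegrable_rpow' (a := 0) (b := 1) (r := -(1 / 2))
    (by norm_num)
  rw [intervalIntegrable_iff_integrableOn_Icc_of_le zero_le_one] at h
  refine h.congr_fun (fun x hx => ?_) measurableSet_Icc
  simp only
  rw [Real.rpow_neg hx.1, Real.sqrt_eq_rpow]

lemma integrableOn_inv_sqrt_one_sub :
    IntegrableOn (fun x : ℝ => (√(1 - x))⁻¹) (Set.Icc 0 1) := by
  have h := (intervalIntegrable_iff_integrableOn_Icc_of_le zero_le_one).2 integrableOn_inv_sqrt
  have h2 := (h.comp_sub_left 1).symm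
  simp only [sub_zero, sub_self] at h2
  exact (intervalIntegrable_iff_integrableOn_Icc_of_le zero_le_one).1 h2

namespace WeightedGraph

noncomputable section

variable {V : Type*} {G : WeightedGraph V}

/-- Split the gradient into potential and logarithm. The latter contributes `(q - p)(log q - log p)`
by the chain rule, which the two edge entropies dominate. -/
lemma logMean_mul_sq_grad_chem_le {Ψ ρ : V → ℝ} {C : ℝ}
    (hC : ∀ i j, G.graph.Adj i j → |Ψ j - Ψ i| ≤ C) (hρ : ∀ i, 0 < ρ i) {i j : V}
    (h : G.graph.Adj i j) :
    G.grad (chem Ψ ρ) i j ^ 2 * G.logMean ρ i j ≤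
      2 * C ^ 2 * (ρ i + ρ j) + 2 * (edgeEnt (ρ i) (ρ j) + edgeEnt (ρ j) (ρ i)) := by
  rw [G.grad_of_adj _ h, G.logMean_of_adj hρ h]
  simp only [chem]
  set s := Real.log (ρ j) - Real.log (ρ i) with hs
  have h1 : lm (ρ i) (ρ j) * s = ρ j - ρ i := lm_mul_log_sub (hρ i) (hρ j)
  have h2 := mul_log_sub_le_edgeEnt (hρ i) (hρ j)
  have h3 := lm_pos (hρ i) (hρ j)
  have h4 := lm_le_add (hρ i) (hρ j)
  have h5 : (Ψ j - Ψ i) ^ 2 ≤ C ^ 2 := by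
    rw [← sq_abs]; exact pow_le_pow_left₀ (abs_nonneg _) (hC i j h) 2
  calc _ = (Ψ j - Ψ i + s) ^ 2 * lm (ρ i) (ρ j) := by rw [hs]; ring
    _ ≤ (2 * (Ψ j - Ψ i) ^ 2 + 2 * s ^ 2) * lm (ρ i) (ρ j) := by
        gcongr; nlinarith [sq_nonneg (Ψ j - Ψ i - s)]
    _ = 2 * ((Ψ j - Ψ i) ^ 2 * lm (ρ i) (ρ j)) + 2 * (lm (ρ i) (ρ j) * s * s) := by ring
    _ ≤ 2 * (C ^ 2 * (ρ i + ρ j)) + 2 * (edgeEnt (ρ i) (ρ j) + edgeEnt (ρ j) (ρ i)) := by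
        rw [h1]; gcongr
    _ = _ := by ring

/-- The bound is integrable at `t = 0`; this is what puts the initial value at finite distance from
later densities. -/
lemma IsSolution.exists_dissipation_le [Nontrivial V] (hconn : G.graph.Connected) {o : V}
    {Ψ : V → ℝ} (hΨ : G.IsPotential o Ψ) {ρ₀ : V → ℝ} (hρ₀ : ρ₀ ∈ G.P0star o) {ρ : ℝ → V → ℝ}
    (h : G.IsSolution o Ψ ρ₀ ρ) {T : ℝ} (hT : 0 ≤ T) :
    ∃ K : ℝ, 0 ≤ K ∧ ∀ t ∈ Set.Ioc 0 T, G.grad (chem Ψ (ρ t)) ∈ G.L2 (ρ t) ∧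
      G.vecInner (ρ t) (G.grad (chem Ψ (ρ t))) (G.grad (chem Ψ (ρ t))) ≤ K * (1 + (√t)⁻¹) := by
  classical
  obtain ⟨C, hC0, hC⟩ := hΨ.exists_bound
  obtain ⟨P, hP, hPπ⟩ := G.exists_pi_upper
  obtain ⟨K, hK0, hK⟩ := h.exists_edgeEnt_le hconn hΨ hρ₀ hT
  refine ⟨2 * C ^ 2 + 2 * P * K, by positivity, fun t ht => ?_⟩
  have hρ := (h.mem t ht.1.le).1
  set E : V × V → ℝ := fun e => if G.graph.Adj e.1 e.2 then edgeEnt (ρ t e.1) (ρ t e.2) else 0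
    with hE
  have hE0 : 0 ≤ E := fun e => by
    simp only [hE]
    split_ifs
    · exact edgeEnt_nonneg (hρ.1 _) (hρ.1 _)
    · exact le_rfl
  have hEs : ∀ S : Finset (V × V), ∑ e ∈ S, E e ≤ K / √t := fun S => by
    rw [← Finset.sum_filter]
    exact hK t ht _ fun e he => (Finset.mem_filter.1 he).2
  have hEsum : Summable E := summable_of_sum_le hE0 hEs
  have hEle : ∑' e, E e ≤ K / √t := Real.tsum_le_of_sum_le hE0 hEs
  have hEsum' : Summable fun e : V × V => E e.swap := (Equiv.prodComm V V).summable_iff.2 hEsum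
  have hEeq : ∑' e : V × V, E e.swap = ∑' e, E e := (Equiv.prodComm V V).tsum_eq E
  have hF := G.summable_omega_fst (fun i => (hρ.1 i).le) hρ.2.summable
  have hS := G.summable_omega_snd (fun i => (hρ.1 i).le) hρ.2.summable
  have hFeq : ∑' e : V × V, G.ω e.1 e.2 * ρ t e.1 = 1 := by
    rw [G.tsum_omega_fst (fun i => (hρ.1 i).le) hρ.2.summable, hρ.2.tsum_eq]
  have hSeq : ∑' e : V × V, G.ω e.1 e.2 * ρ t e.2 = 1 := by
    rw [← hFeq, ← (Equiv.prodComm V V).tsum_eq]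
    exact tsum_congr fun e => by simp [G.ω_symm e.2 e.1]
  have hdom := ((hF.add hS).mul_left (2 * C ^ 2)).add ((hEsum.add hEsum').mul_left (2 * P))
  have hle : ∀ e : V × V,
      G.ω e.1 e.2 * G.grad (chem Ψ (ρ t)) e.1 e.2 ^ 2 * G.logMean (ρ t) e.1 e.2 ≤
        2 * C ^ 2 * (G.ω e.1 e.2 * ρ t e.1 + G.ω e.1 e.2 * ρ t e.2) +
          2 * P * (E e + E e.swap) := by
    intro e
    have hω := G.omega_nonneg e.1 e.2
    by_cases hadj : G.graph.Adj e.1 e.2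
    · have h1 := logMean_mul_sq_grad_chem_le hC hρ.1 hadj
      have h2 : E e + E e.swap =
          edgeEnt (ρ t e.1) (ρ t e.2) + edgeEnt (ρ t e.2) (ρ t e.1) := by
        simp [hE, hadj, hadj.symm]
      have h3 : 0 ≤ E e + E e.swap := add_nonneg (hE0 e) (hE0 e.swap)
      rw [← h2] at h1
      have h4 := mul_le_mul_of_nonneg_left h1 hω
      have h5 := mul_le_mul_of_nonneg_right ((G.omega_le_pi e.1 e.2).trans (hPπ e.1)) h3
      linarith
    · rw [G.ω_zero _ _ hadj]
      have h3 : 0 ≤ E e + E e.swap := add_nonneg (hE0 e) (hE0 e.swap)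
      simp only [zero_mul, add_zero, mul_zero, zero_add]
      positivity
  have hsum : G.grad (chem Ψ (ρ t)) ∈ G.L2 (ρ t) := by
    refine Summable.of_nonneg_of_le (fun e => ?_) hle hdom
    exact mul_nonneg (mul_nonneg (G.omega_nonneg _ _) (sq_nonneg _)) (G.logMean_nonneg _ _ _)
  refine ⟨hsum, ?_⟩
  have h1 := hsum.tsum_le_tsum hle hdom
  rw [((hF.add hS).mul_left _).tsum_add ((hEsum.add hEsum').mul_left _), tsum_mul_left,
    tsum_mul_left, hF.tsum_add hS, hEsum.tsum_add hEsum', hEeq, hFeq, hSeq] at h1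
  have h2 : G.vecInner (ρ t) (G.grad (chem Ψ (ρ t))) (G.grad (chem Ψ (ρ t))) = 1 / 2 *
      ∑' e : V × V, G.ω e.1 e.2 * G.grad (chem Ψ (ρ t)) e.1 e.2 ^ 2 *
        G.logMean (ρ t) e.1 e.2 := by
    rw [vecInner]
    congr 1
    exact tsum_congr fun e => by ring
  rw [h2]
  have h3 : 0 ≤ (√t)⁻¹ := by positivity
  have h4 : P * (∑' e, E e) ≤ P * (K / √t) := by gcongr
  have h5 : (0 : ℝ) ≤ C ^ 2 * (√t)⁻¹ := by positivity
  have h6 : (0 : ℝ) ≤ P * K := by positivity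
  rw [div_eq_mul_inv] at h4
  linarith

lemma IsSolution.chem_mem_potentials [Nontrivial V] (hconn : G.graph.Connected) {o : V}
    {Ψ : V → ℝ} (hΨ : G.IsPotential o Ψ) {ρ₀ : V → ℝ} (hρ₀ : ρ₀ ∈ G.P0star o) {ρ : ℝ → V → ℝ}
    (h : G.IsSolution o Ψ ρ₀ ρ) {t : ℝ} (ht : 0 < t) : chem Ψ (ρ t) ∈ G.potentials (ρ t) := by
  obtain ⟨K, -, hK⟩ := h.exists_dissipation_le hconn hΨ hρ₀ ht.le
  exact ⟨chem_mem_K (G.pi_pos hconn) hΨ (h.mem t ht.le).1, (hK t ⟨ht, le_rfl⟩).1⟩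

lemma summable_sq_chem [Nontrivial V] (hconn : G.graph.Connected) {o : V}
    {Ψ : V → ℝ} (hΨ : G.IsPotential o Ψ) {ρ : V → ℝ} (hρ : ρ ∈ G.P0star o) :
    Summable fun i => chem Ψ ρ i ^ 2 * ρ i * G.π i := by
  have hπ := G.pi_pos hconn
  have h := (((summable_sq_potential hΨ hconn hπ hρ).add hρ.1.2.summable).add
    (summable_sq_log hΨ hconn hρ)).mul_left 3
  refine Summable.of_nonneg_of_le (fun i => ?_) (fun i => ?_) h
  · have := hπ i; have := hρ.1.1 i; positivity
  · have h1 := hπ i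
    have h2 := hρ.1.1 i
    calc _ ≤ (3 * (Ψ i ^ 2 + 1 + Real.log (ρ i) ^ 2)) * ρ i * G.π i := by
          gcongr
          simp only [chem]
          nlinarith [sq_nonneg (Ψ i - 1), sq_nonneg (Ψ i - Real.log (ρ i)),
            sq_nonneg (Real.log (ρ i) - 1)]
      _ = _ := by ring

/-- If `ρ̂ ≤ ρ` at the first endpoint there is nothing to do. Otherwise `ρ̂ ≤ ρ` at the second one,
and `h` is moved there at the cost of its gradient. This admits the unbounded chemical potential in
Green's formula. -/
lemma summable_sq_mul_logMean {ρ h : V → ℝ} (hρ : ∀ i, 0 < ρ i)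
    (hs : Summable fun i => h i ^ 2 * ρ i * G.π i) (hg : G.grad h ∈ G.L2 ρ) :
    Summable fun e : V × V => G.ω e.1 e.2 * h e.1 ^ 2 * G.logMean ρ e.1 e.2 := by
  have h0 : ∀ i, 0 ≤ h i ^ 2 * ρ i := fun i => mul_nonneg (sq_nonneg _) (hρ i).le
  have hdom := ((G.summable_omega_fst h0 hs).add ((G.summable_omega_snd h0 hs).mul_left 2)).add
    (hg.mul_left 2)
  refine Summable.of_nonneg_of_le (fun e => ?_) (fun e => ?_) hdom
  · exact mul_nonneg (mul_nonneg (G.omega_nonneg _ _) (sq_nonneg _)) (G.logMean_nonneg _ _ _)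
  · have hω := G.omega_nonneg e.1 e.2
    by_cases hadj : G.graph.Adj e.1 e.2
    · rw [G.grad_of_adj h hadj, G.logMean_of_adj hρ hadj]
      have h1 := lm_pos (hρ e.1) (hρ e.2)
      have key : h e.1 ^ 2 * lm (ρ e.1) (ρ e.2) ≤ h e.1 ^ 2 * ρ e.1 +
          2 * (h e.2 ^ 2 * ρ e.2) + 2 * ((h e.2 - h e.1) ^ 2 * lm (ρ e.1) (ρ e.2)) := by
        have p1 := mul_nonneg (sq_nonneg (h e.1)) (hρ e.1).le
        have p2 := mul_nonneg (sq_nonneg (h e.2)) (hρ e.2).le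
        have p3 := mul_nonneg (sq_nonneg (h e.2 - h e.1)) h1.le
        rcases le_total (ρ e.2) (ρ e.1) with hle | hle
        · have := lm_le_right_of_le (hρ e.2) (hρ e.1) hle
          rw [lm_comm] at this
          have := mul_le_mul_of_nonneg_left this (sq_nonneg (h e.1))
          linarith
        · have := mul_le_mul_of_nonneg_left (lm_le_right_of_le (hρ e.1) (hρ e.2) hle)
            (sq_nonneg (h e.2))
          have h3 : h e.1 ^ 2 ≤ 2 * h e.2 ^ 2 + 2 * (h e.2 - h e.1) ^ 2 := by
            nlinarith [sq_nonneg (2 * h e.2 - h e.1)]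
          have := mul_le_mul_of_nonneg_right h3 h1.le
          linarith
      have := mul_le_mul_of_nonneg_left key hω
      linarith
    · rw [G.ω_zero _ _ hadj]; simp

lemma potentials_mul_const {ρ p : V → ℝ} (hp : p ∈ G.potentials ρ) (c : ℝ) :
    (fun i => c * p i) ∈ G.potentials ρ ∧ G.B ρ (fun i => c * p i) = fun i => c * G.B ρ p i := by
  have hg : ∀ i j, G.grad (fun i => c * p i) i j = c * G.grad p i j := fun i j => by
    unfold grad; split_ifs <;> ring
  have hB : G.B ρ (fun i => c * p i) = fun i => c * G.B ρ p i := by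
    funext i
    simp only [B, wdiv, hg, mul_neg, Finset.mul_sum]
    congr 1
    exact Finset.sum_congr rfl fun j _ => by ring
  refine ⟨⟨?_, ?_⟩, hB⟩
  · refine (hp.1.mul_left |c|).congr fun i => ?_
    rw [hB, abs_mul]; ring
  · refine (hp.2.mul_left (c ^ 2)).congr fun e => ?_
    rw [hg]; ring

lemma potentials_of_bounded (hπ : ∀ i, 0 < G.π i) {ρ q : V → ℝ} (hρ : ρ ∈ G.P0) {C : ℝ}
    (hq : ∀ i, |q i| ≤ C) : q ∈ G.potentials ρ := by
  have hg : ∀ i j, |G.grad q i j| ≤ 2 * C := fun i j => by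
    unfold grad
    split_ifs
    · calc _ ≤ |q j| + |q i| := abs_sub _ _
        _ ≤ _ := by linarith [hq i, hq j]
    · simpa using (abs_nonneg _).trans (hq i)
  have hs := G.summable_omega_logMean hρ
  refine ⟨?_, ?_⟩
  · have h1 := (G.hasSum_rows (f := fun i j => G.ω i j * G.logMean ρ i j)
      (fun i j h => by rw [G.omega_eq_zero h, zero_mul]) hs).summable.mul_left (2 * C)
    refine Summable.of_nonneg_of_le (fun i => mul_nonneg (abs_nonneg _) (hπ i).le) (fun i => ?_) h1
    rw [← abs_of_pos (hπ i), ← abs_mul, G.B_mul_pi hπ, Finset.mul_sum]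
    refine (Finset.abs_sum_le_sum_abs _ _).trans (Finset.sum_le_sum fun j _ => ?_)
    have h2 := G.omega_nonneg i j
    have h3 := G.logMean_nonneg ρ i j
    rw [abs_neg, abs_mul, abs_mul, abs_of_nonneg h2, abs_of_nonneg h3]
    calc _ ≤ G.ω i j * (2 * C) * G.logMean ρ i j := by gcongr; exact hg i j
      _ = _ := by ring
  · refine Summable.of_nonneg_of_le (fun e => ?_) (fun e => ?_) (hs.mul_left ((2 * C) ^ 2))
    · exact mul_nonneg (mul_nonneg (G.omega_nonneg _ _) (sq_nonneg _)) (G.logMean_nonneg _ _ _)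
    · have h2 := G.omega_nonneg e.1 e.2
      have h3 := G.logMean_nonneg ρ e.1 e.2
      calc _ ≤ G.ω e.1 e.2 * (2 * C) ^ 2 * G.logMean ρ e.1 e.2 := by
            gcongr ?_ * ?_ * ?_
            rw [← sq_abs]
            exact pow_le_pow_left₀ (abs_nonneg _) (hg _ _) 2
        _ = _ := by ring

lemma IsSolution.hasDerivAt {o : V} {Ψ ρ₀ : V → ℝ} {ρ : ℝ → V → ℝ} (h : G.IsSolution o Ψ ρ₀ ρ)
    {t : ℝ} (ht : 0 < t) (i : V) :
    HasDerivAt (fun s => ρ s i) (G.fokkerPlanck Ψ (ρ t) i) t :=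
  (h.eqn t ht.le i).hasDerivAt (Ici_mem_nhds ht)

lemma IsSolution.velocity_eq {o : V} {Ψ ρ₀ : V → ℝ} {ρ : ℝ → V → ℝ} (h : G.IsSolution o Ψ ρ₀ ρ)
    {t : ℝ} (ht : 0 < t) :
    (fun i => deriv (fun s => ρ s i) t) = G.B (ρ t) (fun i => - chem Ψ (ρ t) i) := by
  rw [B_neg]
  funext i
  rw [(h.hasDerivAt ht i).deriv, fokkerPlanck_eq_neg_B Ψ (h.mem t ht.le).1.1]

lemma IsSolution.continuousOn_fokkerPlanck {o : V} {Ψ ρ₀ : V → ℝ} {ρ : ℝ → V → ℝ}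
    (h : G.IsSolution o Ψ ρ₀ ρ) (i : V) :
    ContinuousOn (fun t => G.fokkerPlanck Ψ (ρ t) i) (Set.Ici 0) := by
  have h1 : ContinuousOn (fun t => G.flowRate G.ω Ψ (ρ t) i) (Set.Ici 0) := fun t ht =>
    tendsto_flowRate (h.mem t ht).1.1 (fun j => (h.eqn t ht j).continuousWithinAt) i
  exact h1.congr fun t ht => fokkerPlanck_eq_flowRate Ψ (h.mem t ht).1.1 i

lemma normSq_B_const_mul [Nonempty V] (hπ : ∀ i, 0 < G.π i) (hconn : G.graph.Connected)
    {ρ p : V → ℝ} (hρ : ρ ∈ G.P0) (hp : p ∈ G.potentials ρ) (c : ℝ) :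
    G.normSq ρ (fun i => c * G.B ρ p i) =
      ENNReal.ofReal (c ^ 2 * G.vecInner ρ (G.grad p) (G.grad p)) := by
  obtain ⟨h1, h2⟩ := potentials_mul_const hp c
  have hg : ∀ i j, G.grad (fun i => c * p i) i j = c * G.grad p i j := fun i j => by
    unfold grad; split_ifs <;> ring
  rw [← h2, normSq, if_pos (G.B_mem_tangent hπ hρ h1), G.metric_B hπ hconn hρ h1 h1]
  congr 1
  simp only [vecInner]
  rw [mul_left_comm]
  congr 1
  rw [← tsum_mul_left]
  exact tsum_congr fun e => by rw [hg]; ring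

/-- The time `s + τ(t - s)` is at least `|t - s| τ` or `|t - s| (1 - τ)`, according to the direction
of travel. -/
lemma inv_sqrt_segment_le {s t τ : ℝ} (hs : 0 ≤ s) (ht : 0 ≤ t) (hst : s ≠ t)
    (hτ : τ ∈ Set.Ioo (0 : ℝ) 1) :
    0 < s + τ * (t - s) ∧ (√(s + τ * (t - s)))⁻¹ ≤
      (√|t - s|)⁻¹ * ((√τ)⁻¹ + (√(1 - τ))⁻¹) := by
  have hδ : 0 < |t - s| := abs_pos.2 (sub_ne_zero.2 hst.symm)
  have h1 : 0 ≤ (√τ)⁻¹ := by positivity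
  have h2 : 0 ≤ (√(1 - τ))⁻¹ := by positivity
  have h3 : 0 ≤ (√|t - s|)⁻¹ := by positivity
  have hτ1 : 0 < 1 - τ := sub_pos.2 hτ.2
  rcases lt_or_gt_of_ne hst with h | h
  · have e : |t - s| * τ ≤ s + τ * (t - s) := by rw [abs_of_pos (by linarith)]; linarith
    have hp : 0 < |t - s| * τ := mul_pos hδ hτ.1
    refine ⟨hp.trans_le e, ?_⟩
    calc _ ≤ (√(|t - s| * τ))⁻¹ := by gcongr
      _ = (√|t - s|)⁻¹ * (√τ)⁻¹ := by rw [Real.sqrt_mul hδ.le, mul_inv]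
      _ ≤ _ := by gcongr; linarith
  · have e : |t - s| * (1 - τ) ≤ s + τ * (t - s) := by
      rw [abs_of_neg (by linarith)]; linarith
    have hp : 0 < |t - s| * (1 - τ) := mul_pos hδ hτ1
    refine ⟨hp.trans_le e, ?_⟩
    calc _ ≤ (√(|t - s| * (1 - τ)))⁻¹ := by gcongr
      _ = (√|t - s|)⁻¹ * (√(1 - τ))⁻¹ := by rw [Real.sqrt_mul hδ.le, mul_inv]
      _ ≤ _ := by gcongr; linarith

lemma W2sq_self_lt_top [Nonempty V] (hπ : ∀ i, 0 < G.π i) {ρ : V → ℝ} (hρ : ρ ∈ G.P0) :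
    G.W2sq ρ ρ < ⊤ := by
  have hc : G.IsCurve ρ ρ (fun _ => ρ) := ⟨fun _ _ => hρ, fun i => contDiffOn_const, rfl, rfl⟩
  refine (iInf₂_le (fun _ => ρ) hc).trans_lt ?_
  have h0 : (fun _ : V => (0 : ℝ)) ∈ G.potentials ρ :=
    potentials_of_bounded hπ hρ (C := 0) (by simp)
  have hB : G.B ρ (fun _ => 0) = fun _ => 0 := by
    funext i; simp [B, wdiv, grad]
  have ht : (fun _ : V => (0 : ℝ)) ∈ G.tangent ρ := hB ▸ G.B_mem_tangent hπ hρ h0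
  have hz : G.normSq ρ (fun _ => 0) < ⊤ := by
    rw [normSq, if_pos ht]
    exact ENNReal.ofReal_lt_top
  simpa using hz

/-- The competitor is the solution itself, run affinely from time `s` to time `t`; its action is the
time integral of the dissipation up to the factor `(t - s)²`. -/
lemma IsSolution.W2_lt_top [Nontrivial V] (hconn : G.graph.Connected) {o : V}
    {Ψ : V → ℝ} (hΨ : G.IsPotential o Ψ) {ρ₀ : V → ℝ} (hρ₀ : ρ₀ ∈ G.P0star o) {ρ : ℝ → V → ℝ}
    (h : G.IsSolution o Ψ ρ₀ ρ) {s t : ℝ} (hs : 0 ≤ s) (ht : 0 ≤ t) :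
    G.W2 (ρ s) (ρ t) < ⊤ := by
  have hπ := G.pi_pos hconn
  refine ENNReal.rpow_lt_top_of_nonneg (by norm_num) (ne_of_lt ?_)
  rcases eq_or_ne s t with rfl | hst
  · exact W2sq_self_lt_top hπ (h.mem s hs).1
  set x : ℝ → ℝ := fun τ => s + τ * (t - s) with hx
  have hx0 : ∀ τ ∈ Set.Icc (0 : ℝ) 1, 0 ≤ x τ := fun τ hτ => by
    have : x τ = (1 - τ) * s + τ * t := by simp only [hx]; ring
    rw [this]
    exact add_nonneg (mul_nonneg (sub_nonneg.2 hτ.2) hs) (mul_nonneg hτ.1 ht)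
  have hxT : ∀ τ ∈ Set.Icc (0 : ℝ) 1, x τ ≤ s + t := fun τ hτ => by
    have : x τ = (1 - τ) * s + τ * t := by simp only [hx]; ring
    rw [this]
    have := mul_le_mul_of_nonneg_right hτ.2 ht
    have := mul_nonneg hτ.1 hs
    linarith
  have hmaps : Set.MapsTo x (Set.Icc 0 1) (Set.Ici 0) := hx0
  have hxd : ∀ τ, HasDerivAt x (t - s) τ := fun τ => by
    exact (((hasDerivAt_id τ).mul_const (t - s)).const_add s).congr_deriv (one_mul _)
  have hd : ∀ i, ∀ τ ∈ Set.Icc (0 : ℝ) 1, HasDerivWithinAt (fun τ => ρ (x τ) i)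
      ((t - s) * G.fokkerPlanck Ψ (ρ (x τ)) i) (Set.Icc 0 1) τ := fun i τ hτ =>
    (h.eqn (x τ) (hx0 τ hτ) i).scomp τ (hxd τ).hasDerivWithinAt hmaps
  have hu := uniqueDiffOn_Icc (zero_lt_one' ℝ)
  have hdw : ∀ i, ∀ τ ∈ Set.Icc (0 : ℝ) 1, derivWithin (fun τ => ρ (x τ) i) (Set.Icc 0 1) τ =
      (t - s) * G.fokkerPlanck Ψ (ρ (x τ)) i := fun i τ hτ => (hd i τ hτ).derivWithin (hu τ hτ)
  have hc : G.IsCurve (ρ s) (ρ t) (fun τ => ρ (x τ)) := by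
    refine ⟨fun τ hτ => (h.mem _ (hx0 τ hτ)).1, fun i => ?_, by simp [hx], by simp [hx]⟩
    rw [contDiffOn_one_iff_derivWithin hu]
    refine ⟨fun τ hτ => (hd i τ hτ).differentiableWithinAt, ?_⟩
    refine ContinuousOn.congr ?_ (hdw i)
    refine continuousOn_const.mul ((h.continuousOn_fokkerPlanck i).comp ?_ hmaps)
    exact fun τ _ => (hxd τ).continuousAt.continuousWithinAt
  refine (iInf₂_le _ hc).trans_lt ?_
  obtain ⟨K, hK0, hK⟩ := h.exists_dissipation_le hconn hΨ hρ₀ (add_nonneg hs ht)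
  set g : ℝ → ℝ := fun τ => (t - s) ^ 2 *
    (K * (1 + (√|t - s|)⁻¹ * ((√τ)⁻¹ + (√(1 - τ))⁻¹))) with hg
  have hgint : IntegrableOn g (Set.Icc 0 1) := by
    have h1 : IntegrableOn (fun τ : ℝ => (√τ)⁻¹ + (√(1 - τ))⁻¹) (Set.Icc 0 1) :=
      integrableOn_inv_sqrt.add integrableOn_inv_sqrt_one_sub
    have h2 : IntegrableOn (fun _ : ℝ => (1 : ℝ)) (Set.Icc 0 1) := integrableOn_const (by simp)
    exact ((Integrable.add h2 (h1.const_mul _)).const_mul K).const_mul _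
  refine lt_of_le_of_lt ?_ hgint.setLIntegral_lt_top
  -- The endpoints are removed: at time zero the velocity need not be a tangent vector.
  rw [setLIntegral_congr Ioo_ae_eq_Icc.symm, setLIntegral_congr Ioo_ae_eq_Icc.symm]
  refine setLIntegral_mono_ae' measurableSet_Ioo (Eventually.of_forall fun τ hτ => ?_)
  have hτ' : τ ∈ Set.Icc (0 : ℝ) 1 := Set.Ioo_subset_Icc_self hτ
  obtain ⟨h1, h2⟩ := inv_sqrt_segment_le hs ht hst hτ
  have hp := h.chem_mem_potentials hconn hΨ hρ₀ h1
  have hmem := (h.mem (x τ) h1.le).1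
  have e : (fun i => derivWithin (fun τ => ρ (x τ) i) (Set.Icc 0 1) τ) =
      fun i => -(t - s) * G.B (ρ (x τ)) (chem Ψ (ρ (x τ))) i := by
    funext i
    rw [hdw i τ hτ', fokkerPlanck_eq_neg_B Ψ hmem.1]
    ring
  rw [e, normSq_B_const_mul hπ hconn hmem hp, neg_sq]
  refine ENNReal.ofReal_le_ofReal ?_
  simp only [hg]
  gcongr
  refine ((hK (x τ) ⟨h1, hxT τ hτ'⟩).2).trans ?_
  gcongr

/-- The velocity is `B_ρ` of minus the first variation, so pairing it with `B_ρ q` is Green's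
formula for `q` against the first variation. -/
theorem IsSolution.isGradientFlow [Nontrivial V] (hconn : G.graph.Connected) {o : V}
    {Ψ : V → ℝ} (hΨ : G.IsPotential o Ψ) {ρ₀ : V → ℝ} (hρ₀ : ρ₀ ∈ G.P0star o) {ρ : ℝ → V → ℝ}
    (h : G.IsSolution o Ψ ρ₀ ρ) : G.IsGradientFlow o (G.freeEnergy Ψ) ρ₀ ρ := by
  have hπ := G.pi_pos hconn
  have hneg : ∀ t, 0 < t → (fun i => -chem Ψ (ρ t) i) ∈ G.potentials (ρ t) := fun t ht => by
    have := (potentials_mul_const (h.chem_mem_potentials hconn hΨ hρ₀ ht) (-1)).1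
    simpa using this
  refine ⟨h.init, h.mem, fun i t ht => (h.eqn t ht i).continuousWithinAt,
    fun t ht i => (h.hasDerivAt ht i).differentiableAt, fun s t hs ht =>
      h.W2_lt_top hconn hΨ hρ₀ hs ht, fun t ht => ?_, fun t ht => ?_⟩
  · rw [h.velocity_eq ht]
    exact G.B_mem_tangent hπ (h.mem t ht.le).1 (hneg t ht)
  · have hmem := h.mem t ht.le
    refine ⟨chem Ψ (ρ t), isFirstVariation_freeEnergy hΨ hconn hmem, ?_⟩
    rintro σ ⟨⟨q, hq, rfl⟩, -⟩
    have hp := h.chem_mem_potentials hconn hΨ hρ₀ ht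
    have hs := G.hasSum_B_mul (ρ := ρ t) (p := q) (q := chem Ψ (ρ t)) hπ
      (G.summable_mul_of_sq (a := fun e => G.grad q e.1 e.2) (b := fun e => chem Ψ (ρ t) e.1)
        hq.2 (summable_sq_mul_logMean hmem.1.1 (summable_sq_chem hconn hΨ hmem) hp.2))
    have hs' : HasSum (fun i => chem Ψ (ρ t) i * G.B (ρ t) q i * G.π i)
        (G.vecInner (ρ t) (G.grad q) (G.grad (chem Ψ (ρ t)))) :=
      hs.congr_fun fun i => by ring
    refine ⟨hs'.summable, ?_⟩
    rw [hs'.tsum_eq, h.velocity_eq ht, G.metric_B hπ hconn hmem.1 (hneg t ht) hq,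
      G.vecInner_comm _ (G.grad q), vecInner, vecInner, ← mul_neg, ← tsum_neg]
    congr 1
    refine tsum_congr fun e => ?_
    have : G.grad (fun i => -chem Ψ (ρ t) i) e.1 e.2 = -G.grad (chem Ψ (ρ t)) e.1 e.2 := by
      unfold grad; split_ifs <;> ring
    rw [this]; ring

lemma summable_grad_mul_single [DecidableEq V] (ρ p : V → ℝ) (k : V) :
    (Summable fun e : V × V =>
      G.ω e.1 e.2 * G.grad p e.1 e.2 * (Pi.single k 1 : V → ℝ) e.1 * G.logMean ρ e.1 e.2) ∧
    (Summable fun e : V × V =>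
      G.ω e.1 e.2 * G.grad (Pi.single k 1) e.1 e.2 * p e.1 * G.logMean ρ e.1 e.2) := by
  set N := insert k (G.nbr k)
  have key : ∀ e : V × V, e ∉ N ×ˢ N → G.graph.Adj e.1 e.2 → e.1 ≠ k ∧ e.2 ≠ k := by
    rintro ⟨i, j⟩ he hadj
    constructor
    · rintro rfl
      exact he (Finset.mem_product.2 ⟨Finset.mem_insert_self _ _,
        Finset.mem_insert_of_mem (G.mem_nbr.2 hadj)⟩)
    · rintro rfl
      exact he (Finset.mem_product.2 ⟨Finset.mem_insert_of_mem (G.mem_nbr.2 hadj.symm),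
        Finset.mem_insert_self _ _⟩)
  constructor <;> refine summable_of_ne_finset_zero (s := N ×ˢ N) fun e he => ?_ <;>
    by_cases hadj : G.graph.Adj e.1 e.2
  · simp [(key e he hadj).1]
  · simp [G.ω_zero _ _ hadj]
  · simp [G.grad_of_adj _ hadj, (key e he hadj).1, (key e he hadj).2]
  · simp [G.ω_zero _ _ hadj]

/-- Self-adjointness of `B_ρ` against a point mass: only finitely many edges matter, so no
integrability of `p` is required. -/
lemma hasSum_chem_mul_B_single [DecidableEq V] (hπ : ∀ i, 0 < G.π i) (ρ p : V → ℝ) (k : V) :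
    HasSum (fun i => p i * G.B ρ (Pi.single k 1) i * G.π i) (G.B ρ p k * G.π k) := by
  obtain ⟨h1, h2⟩ := summable_grad_mul_single (G := G) ρ p k
  have e1 := G.hasSum_B_mul hπ h1
  have e2 := G.hasSum_B_mul hπ h2
  have e3 : HasSum (fun i => G.B ρ p i * (Pi.single k 1 : V → ℝ) i * G.π i)
      (G.B ρ p k * G.π k) := by
    have := hasSum_single (f := fun i => G.B ρ p i * (Pi.single k 1 : V → ℝ) i * G.π i) k
      (fun i hi => by simp [hi])
    simpa using this
  rw [G.vecInner_comm, e1.unique e3] at e2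
  exact e2.congr_fun fun i => by ring

/-- The first variation is unique, hence equals `Ψ + 1 + log ρ`. Testing with the tangent vector
generated by the potential `δ_k` gives the equation at `k` for `t > 0`. -/
theorem IsGradientFlow.isSolution [Nontrivial V] (hconn : G.graph.Connected) {o : V}
    {Ψ : V → ℝ} (hΨ : G.IsPotential o Ψ) {ρ₀ : V → ℝ} {ρ : ℝ → V → ℝ}
    (h : G.IsGradientFlow o (G.freeEnergy Ψ) ρ₀ ρ) : G.IsSolution o Ψ ρ₀ ρ := by
  classical
  have hπ := G.pi_pos hconn
  have hderiv : ∀ t, 0 < t → ∀ k, deriv (fun s => ρ s k) t = G.fokkerPlanck Ψ (ρ t) k := by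
    intro t ht k
    have hmem := h.mem t ht.le
    obtain ⟨f, hf, hgrad⟩ := h.gradient t ht
    rw [hf.unique hπ hmem.1.1 (isFirstVariation_freeEnergy hΨ hconn hmem)] at hgrad
    obtain ⟨⟨p, hp, hpe⟩, -⟩ := h.velocity t ht
    have hδ : (Pi.single k 1 : V → ℝ) ∈ G.potentials (ρ t) := by
      refine potentials_of_bounded hπ hmem.1 (C := 1) fun i => ?_
      by_cases hi : i = k
      · subst hi; simp
      · simp [hi]
    have h1 := (hgrad _ (G.B_mem_tangent hπ hmem.1 hδ)).2
    rw [(hasSum_chem_mul_B_single hπ (ρ t) (chem Ψ (ρ t)) k).tsum_eq, ← hpe,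
      G.metric_B hπ hconn hmem.1 hp hδ] at h1
    have e1 := G.hasSum_B_mul hπ (summable_grad_mul_single (G := G) (ρ t) p k).1
    have e3 : HasSum (fun i => G.B (ρ t) p i * (Pi.single k 1 : V → ℝ) i * G.π i)
        (G.B (ρ t) p k * G.π k) := by
      have := hasSum_single (f := fun i => G.B (ρ t) p i * (Pi.single k 1 : V → ℝ) i * G.π i) k
        (fun i hi => by simp [hi])
      simpa using this
    rw [e1.unique e3, ← neg_mul] at h1
    have h2 := mul_right_cancel₀ (hπ k).ne' h1
    rw [fokkerPlanck_eq_neg_B Ψ hmem.1.1, ← h2, hpe]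
  refine ⟨h.init, h.mem, fun t ht k => ?_⟩
  rcases eq_or_lt_of_le ht with rfl | ht'
  -- At `t = 0` nothing is assumed about derivatives; the right derivative is the limit of the
  -- rates, which exists by continuity of the coordinates.
  · refine hasDerivWithinAt_Ici_of_tendsto_deriv (s := Set.Ioi 0)
      (fun t ht => (h.diff t ht k).differentiableWithinAt)
      ((h.cont k 0 (Set.mem_Ici.2 le_rfl)).mono Set.Ioi_subset_Ici_self) self_mem_nhdsWithin ?_
    have h1 : Tendsto (fun t => G.flowRate G.ω Ψ (ρ t) k) (𝓝[>] 0)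
        (𝓝 (G.flowRate G.ω Ψ (ρ 0) k)) :=
      tendsto_flowRate (h.mem 0 le_rfl).1.1 (fun i =>
        (h.cont i 0 (Set.mem_Ici.2 le_rfl)).mono Set.Ioi_subset_Ici_self) k
    rw [fokkerPlanck_eq_flowRate Ψ (h.mem 0 le_rfl).1.1]
    refine h1.congr' ?_
    filter_upwards [self_mem_nhdsWithin] with t ht
    rw [hderiv t ht, fokkerPlanck_eq_flowRate Ψ (h.mem t (le_of_lt ht)).1.1]
  · have h1 := (h.diff t ht' k).hasDerivAt
    rw [hderiv t ht' k] at h1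
    exact h1.hasDerivWithinAt

end

end WeightedGraph

/-! ### A family of relative entropies -/

/-- The entropy density `x² / (x + a)`, for `a = c m` a multiple of the reference density. -/
noncomputable def softSq (a x : ℝ) : ℝ := x ^ 2 / (x + a)

/-- The derivative of `softSq a`. -/
noncomputable def softSlope (a x : ℝ) : ℝ := 1 - (a / (x + a)) ^ 2

lemma softSq_nonneg {a x : ℝ} (ha : 0 ≤ a) (hx : 0 ≤ x) : 0 ≤ softSq a x := by
  unfold softSq; positivity

lemma softSq_le {a x : ℝ} (ha : 0 ≤ a) (hx : 0 < x) : softSq a x ≤ x := by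
  unfold softSq
  rw [div_le_iff₀ (by positivity)]
  nlinarith [mul_nonneg ha hx.le]

lemma sub_min_le_softSq {a x : ℝ} (ha : 0 ≤ a) (hx : 0 < x) : x - min x a ≤ 2 * softSq a x := by
  have h0 := softSq_nonneg ha hx.le
  rcases le_total x a with h | h
  · rw [min_eq_left h]; linarith
  · rw [min_eq_right h]
    unfold softSq
    rw [← mul_div_assoc, le_div_iff₀ (by positivity)]
    nlinarith [mul_nonneg ha hx.le]

lemma hasDerivAt_softSq {a x : ℝ} (h : x + a ≠ 0) : HasDerivAt (softSq a) (softSlope a x) x := by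
  have h1 := ((hasDerivAt_id x).pow 2).div ((hasDerivAt_id x).add_const a) h
  refine h1.congr_deriv ?_
  unfold softSlope
  simp only [id, Pi.pow_apply]
  field_simp
  push_cast
  ring

lemma softSlope_mem {a x : ℝ} (ha : 0 ≤ a) (hx : 0 < x) :
    0 ≤ softSlope a x ∧ softSlope a x ≤ 1 := by
  have h0 : 0 ≤ a / (x + a) := by positivity
  have h1 : a / (x + a) ≤ 1 := (div_le_one (by positivity)).2 (by linarith)
  unfold softSlope
  constructor <;> nlinarith

lemma softSlope_pos {a x : ℝ} (ha : 0 ≤ a) (hx : 0 < x) : 0 < softSlope a x := by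
  have h0 : 0 ≤ a / (x + a) := by positivity
  have h1 : a / (x + a) < 1 := (div_lt_one (by positivity)).2 (by linarith)
  unfold softSlope
  nlinarith

lemma softSlope_zero {a : ℝ} (ha : a ≠ 0) : softSlope a 0 = 0 := by
  simp [softSlope, ha]

lemma Filter.Tendsto.softSlope {α : Type*} {l : Filter α} {f : α → ℝ} {a x : ℝ} (h : x + a ≠ 0)
    (hf : Tendsto f l (𝓝 x)) : Tendsto (fun y => _root_.softSlope a (f y)) l
      (𝓝 (_root_.softSlope a x)) :=
  ((tendsto_const_nhds.div (hf.add_const a) h).pow 2).const_sub 1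

/-- The hypothesis compares the relative densities `p/a < q/b`. Both the flux towards `p` and the
difference of slopes, a monotone function of relative density, have that sign. -/
lemma flux_mul_softSlope_pos {a b c p q : ℝ} (ha : 0 < a) (hb : 0 < b) (hc : 0 < c) (hp : 0 < p)
    (hq : 0 < q) (h : p * b < q * a) :
    0 < flux (Real.log a - Real.log b) p q * (softSlope (c * b) q - softSlope (c * a) p) := by
  refine mul_pos ?_ ?_
  · rw [flux_eq_mul hp hq]
    refine mul_pos (lm_pos hp hq) ?_
    have := Real.log_lt_log (mul_pos hp hb) h
    rw [Real.log_mul hp.ne' hb.ne', Real.log_mul hq.ne' ha.ne'] at this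
    linarith
  · have h1 : c * b / (q + c * b) < c * a / (p + c * a) := by
      rw [div_lt_div_iff₀ (by positivity) (by positivity)]
      nlinarith
    have h2 : 0 ≤ c * b / (q + c * b) := by positivity
    unfold softSlope
    nlinarith

lemma flux_mul_softSlope_symm {a b c p q : ℝ} :
    flux (Real.log b - Real.log a) q p * (softSlope (c * a) p - softSlope (c * b) q) =
      flux (Real.log a - Real.log b) p q * (softSlope (c * b) q - softSlope (c * a) p) := by
  have h := flux_neg (Real.log a - Real.log b) p q
  rw [neg_sub] at h
  rw [h]; ring

lemma flux_mul_softSlope_pos_of_ne {a b c p q : ℝ} (ha : 0 < a) (hb : 0 < b) (hc : 0 < c)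
    (hp : 0 < p) (hq : 0 < q) (h : p * b ≠ q * a) :
    0 < flux (Real.log a - Real.log b) p q * (softSlope (c * b) q - softSlope (c * a) p) := by
  rcases lt_or_gt_of_ne h with h | h
  · exact flux_mul_softSlope_pos ha hb hc hp hq h
  · rw [← flux_mul_softSlope_symm]
    exact flux_mul_softSlope_pos hb ha hc hq hp h

lemma flux_mul_softSlope_nonneg {a b c p q : ℝ} (ha : 0 < a) (hb : 0 < b) (hc : 0 < c)
    (hp : 0 < p) (hq : 0 < q) :
    0 ≤ flux (Real.log a - Real.log b) p q * (softSlope (c * b) q - softSlope (c * a) p) := by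
  by_cases h : p * b = q * a
  · have : c * b / (q + c * b) = c * a / (p + c * a) := by
      rw [div_eq_div_iff (by positivity) (by positivity)]
      linear_combination c * h
    simp [softSlope, this]
  · exact (flux_mul_softSlope_pos_of_ne ha hb hc hp hq h).le

namespace WeightedGraph

noncomputable section

variable {V : Type*} {G : WeightedGraph V}

/-! ### The Gibbs density -/

lemma partition_pos [Nontrivial V] (hconn : G.graph.Connected) {o : V} {Ψ : V → ℝ}
    (hΨ : G.IsPotential o Ψ) : 0 < ∑' j, G.π j * Real.exp (-Ψ j) := by
  have hπ := G.pi_pos hconn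
  have hs : Summable fun j => G.π j * Real.exp (-Ψ j) :=
    (summable_exp_neg hΨ hconn hπ).congr fun i => mul_comm _ _
  exact hs.tsum_pos (fun i => mul_nonneg (hπ i).le (Real.exp_pos _).le) o
    (mul_pos (hπ o) (Real.exp_pos _))

lemma gibbs_mem_P0star [Nontrivial V] (hconn : G.graph.Connected) {o : V} {Ψ : V → ℝ}
    (hΨ : G.IsPotential o Ψ) : G.gibbs Ψ ∈ G.P0star o := by
  have hπ := G.pi_pos hconn
  have hZ := partition_pos hconn hΨ
  have hs : Summable fun j => G.π j * Real.exp (-Ψ j) :=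
    (summable_exp_neg hΨ hconn hπ).congr fun i => mul_comm _ _
  refine ⟨⟨fun i => div_pos (Real.exp_pos _) hZ, ?_⟩, ?_⟩
  · have := hs.hasSum.div_const (∑' j, G.π j * Real.exp (-Ψ j))
    rw [div_self hZ.ne'] at this
    refine this.congr_fun fun i => ?_
    rw [gibbs]; ring
  · refine (hΨ.moment.div_const (∑' j, G.π j * Real.exp (-Ψ j))).congr fun i => ?_
    rw [gibbs]; ring

lemma log_gibbs [Nontrivial V] (hconn : G.graph.Connected) {o : V} {Ψ : V → ℝ}
    (hΨ : G.IsPotential o Ψ) (i j : V) :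
    Real.log (G.gibbs Ψ i) - Real.log (G.gibbs Ψ j) = Ψ j - Ψ i := by
  have hZ := (partition_pos hconn hΨ).ne'
  rw [gibbs, gibbs, Real.log_div (Real.exp_pos _).ne' hZ, Real.log_div (Real.exp_pos _).ne' hZ,
    Real.log_exp, Real.log_exp]
  ring

/-! ### Decay of the relative entropies -/

variable (G) in
/-- The relative entropy `∑ π ρ² / (ρ + c ρ*)`. -/
def softEnt (Ψ : V → ℝ) (c : ℝ) (ρ : V → ℝ) : ℝ :=
  ∑' i, softSq (c * G.gibbs Ψ i) (ρ i) * G.π i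

variable (G) in
/-- The first variation of `softEnt`. -/
def softVar (Ψ : V → ℝ) (c : ℝ) (ρ : V → ℝ) (i : V) : ℝ := softSlope (c * G.gibbs Ψ i) (ρ i)

lemma abs_omega_grad_chem_le {Ψ ρ : V → ℝ} {C : ℝ}
    (hC : ∀ i j, G.graph.Adj i j → |Ψ j - Ψ i| ≤ C) (hρ : ∀ i, 0 < ρ i) (i j : V) :
    |G.ω i j * G.grad (chem Ψ ρ) i j * G.logMean ρ i j| ≤
      (1 + C) * (G.ω i j * ρ i + G.ω i j * ρ j) := by
  by_cases hadj : G.graph.Adj i j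
  · rw [mul_assoc, grad_chem_mul_logMean Ψ hρ hadj, abs_mul, abs_of_nonneg (G.omega_nonneg i j)]
    calc _ ≤ G.ω i j * ((1 + C) * (ρ i + ρ j)) :=
          mul_le_mul_of_nonneg_left (abs_flux_le (hC i j hadj) (hρ i) (hρ j)) (G.omega_nonneg i j)
      _ = _ := by ring
  · simp [G.ω_zero _ _ hadj]

lemma summable_omega_grad_chem_mul {o : V} {Ψ : V → ℝ} (hΨ : G.IsPotential o Ψ) {ρ : V → ℝ} (hρ : ρ ∈ G.P0)
    {a : V × V → ℝ} {B : ℝ} (ha : ∀ e, |a e| ≤ B) :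
    Summable fun e : V × V =>
      G.ω e.1 e.2 * G.grad (chem Ψ ρ) e.1 e.2 * a e * G.logMean ρ e.1 e.2 := by
  obtain ⟨C, hC0, hC⟩ := hΨ.exists_bound
  have h := (((G.summable_omega_fst (fun i => (hρ.1 i).le) hρ.2.summable).add
    (G.summable_omega_snd (fun i => (hρ.1 i).le) hρ.2.summable)).mul_left (1 + C)).mul_right B
  refine Summable.of_norm_bounded h fun e => ?_
  rw [mul_right_comm, norm_mul]
  have h1 := abs_omega_grad_chem_le hC hρ.1 e.1 e.2
  exact mul_le_mul h1 (ha e) (norm_nonneg _) ((abs_nonneg _).trans h1)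

section
variable [Nontrivial V] {o : V} {Ψ : V → ℝ}

lemma summable_softSq (hconn : G.graph.Connected) (hΨ : G.IsPotential o Ψ) {c : ℝ} (hc : 0 ≤ c)
    {ρ : V → ℝ} (hρ : ρ ∈ G.P0) : Summable fun i => softSq (c * G.gibbs Ψ i) (ρ i) * G.π i := by
  have hm := (gibbs_mem_P0star hconn hΨ).1.1
  refine Summable.of_nonneg_of_le (fun i => ?_) (fun i => ?_) hρ.2.summable
  · exact mul_nonneg (softSq_nonneg (mul_nonneg hc (hm i).le) (hρ.1 i).le) (G.pi_pos hconn i).le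
  · exact mul_le_mul_of_nonneg_right (softSq_le (mul_nonneg hc (hm i).le) (hρ.1 i))
      (G.pi_pos hconn i).le

lemma omega_grad_chem_softVar (hconn : G.graph.Connected) (hΨ : G.IsPotential o Ψ) {ρ : V → ℝ}
    (hρ : ∀ i, 0 < ρ i) (c : ℝ) (i j : V) :
    G.ω i j * G.grad (chem Ψ ρ) i j * G.grad (G.softVar Ψ c ρ) i j * G.logMean ρ i j =
      G.ω i j * (flux (Real.log (G.gibbs Ψ i) - Real.log (G.gibbs Ψ j)) (ρ i) (ρ j) *
        (softSlope (c * G.gibbs Ψ j) (ρ j) - softSlope (c * G.gibbs Ψ i) (ρ i))) := by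
  by_cases hadj : G.graph.Adj i j
  · rw [log_gibbs hconn hΨ, ← grad_chem_mul_logMean Ψ hρ hadj, G.grad_of_adj (G.softVar Ψ c ρ) hadj]
    simp only [softVar]; ring
  · simp [G.ω_zero _ _ hadj]

lemma abs_softVar_le (hconn : G.graph.Connected) (hΨ : G.IsPotential o Ψ) {ρ : V → ℝ}
    (hρ : ∀ i, 0 < ρ i) {c : ℝ} (hc : 0 ≤ c) (i : V) : |G.softVar Ψ c ρ i| ≤ 1 := by
  have h := softSlope_mem (mul_nonneg hc ((gibbs_mem_P0star hconn hΨ).1.1 i).le) (hρ i)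
  exact abs_le.2 ⟨by linarith [h.1, show softSlope (c * G.gibbs Ψ i) (ρ i) = G.softVar Ψ c ρ i from rfl],
    h.2⟩

/-- All edges dissipate nonnegatively, so vanishing total dissipation forces vanishing on each edge.
The factor 2 undoes the 1/2 in `vecInner`. -/
lemma edge_dissipation_le (hconn : G.graph.Connected) (hΨ : G.IsPotential o Ψ) {ρ : V → ℝ}
    (hρ : ρ ∈ G.P0) {c : ℝ} (hc : 0 < c) (i j : V) :
    0 ≤ G.ω i j * (flux (Real.log (G.gibbs Ψ i) - Real.log (G.gibbs Ψ j)) (ρ i) (ρ j) *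
        (softSlope (c * G.gibbs Ψ j) (ρ j) - softSlope (c * G.gibbs Ψ i) (ρ i))) ∧
    G.ω i j * (flux (Real.log (G.gibbs Ψ i) - Real.log (G.gibbs Ψ j)) (ρ i) (ρ j) *
        (softSlope (c * G.gibbs Ψ j) (ρ j) - softSlope (c * G.gibbs Ψ i) (ρ i))) ≤
      2 * G.vecInner ρ (G.grad (chem Ψ ρ)) (G.grad (G.softVar Ψ c ρ)) := by
  have hm := (gibbs_mem_P0star hconn hΨ).1.1
  have hnn : ∀ i j, 0 ≤ G.ω i j * (flux (Real.log (G.gibbs Ψ i) - Real.log (G.gibbs Ψ j))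
      (ρ i) (ρ j) * (softSlope (c * G.gibbs Ψ j) (ρ j) - softSlope (c * G.gibbs Ψ i) (ρ i))) :=
    fun i j => mul_nonneg (G.omega_nonneg i j)
      (flux_mul_softSlope_nonneg (hm i) (hm j) hc (hρ.1 i) (hρ.1 j))
  refine ⟨hnn i j, ?_⟩
  have hs := summable_omega_grad_chem_mul hΨ hρ
    (a := fun e => G.grad (G.softVar Ψ c ρ) e.1 e.2) (B := 2) fun e => by
      unfold grad
      split_ifs
      · calc _ ≤ |G.softVar Ψ c ρ e.2| + |G.softVar Ψ c ρ e.1| := abs_sub _ _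
          _ ≤ _ := by
            linarith [abs_softVar_le hconn hΨ hρ.1 hc.le e.1, abs_softVar_le hconn hΨ hρ.1 hc.le e.2]
      · simp
  have h := hs.le_tsum (i, j) fun e _ => by
    rw [omega_grad_chem_softVar hconn hΨ hρ.1]; exact hnn _ _
  simp only at h
  rw [omega_grad_chem_softVar hconn hΨ hρ.1] at h
  refine h.trans (le_of_eq ?_)
  rw [vecInner]; ring

/-- Termwise differentiation: the slope is bounded by one, and on `(0, t + 1)` the rates are
dominated by a multiple of the density at time `t + 1`, by `IsFlow.le_exp_mul`. -/
lemma IsSolution.hasDerivAt_softEnt (hconn : G.graph.Connected) (hΨ : G.IsPotential o Ψ)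
    {ρ₀ : V → ℝ} {ρ : ℝ → V → ℝ} (h : G.IsSolution o Ψ ρ₀ ρ) {c : ℝ} (hc : 0 < c) {t : ℝ}
    (ht : 0 < t) :
    HasDerivAt (fun t => G.softEnt Ψ c (ρ t))
      (-G.vecInner (ρ t) (G.grad (chem Ψ (ρ t))) (G.grad (G.softVar Ψ c (ρ t)))) t := by
  have hπ := G.pi_pos hconn
  have hm := (gibbs_mem_P0star hconn hΨ).1.1
  obtain ⟨C, hC0, hC⟩ := hΨ.exists_bound
  have hb0 : (0 : ℝ) ≤ t + 1 := by linarith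
  have hρb := (h.mem (t + 1) hb0).1
  set A := Real.exp (rateBound C * (t + 1)) with hA
  have hle : ∀ y ∈ Set.Ioo 0 (t + 1), ∀ i, ρ y i ≤ A * ρ (t + 1) i := fun y hy i => by
    refine ((h.isFlow (t + 1)).le_exp_mul isWeight_omega hπ hC0 hC i hy.1.le hy.2.le le_rfl).trans ?_
    have := (hρb.1 i).le
    have := (rateBound_pos hC0).le
    have := hy.1.le
    rw [hA]
    gcongr
    linarith
  have hu : Summable fun i =>
      (1 + C) * (A * ∑ j ∈ G.nbr i, G.ω i j * (ρ (t + 1) i + ρ (t + 1) j)) :=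
    ((summable_sum_omega_add (fun i => (hρb.1 i).le) hρb.2.summable).mul_left A).mul_left (1 + C)
  have hd := hasDerivAt_tsum_of_isPreconnected
    (g := fun i t => softSq (c * G.gibbs Ψ i) (ρ t i) * G.π i)
    (g' := fun i t => G.softVar Ψ c (ρ t) i * G.flowRate G.ω Ψ (ρ t) i * G.π i) hu
    isOpen_Ioo (convex_Ioo 0 (t + 1)).isPreconnected (fun i y hy => ?_) (fun i y hy => ?_)
    (y₀ := t) ⟨ht, by linarith⟩
    (summable_softSq hconn hΨ hc.le (h.mem t ht.le).1) (y := t) ⟨ht, by linarith⟩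
  · refine hd.congr_deriv ?_
    have hρ := (h.mem t ht.le).1
    have hg := G.hasSum_B_mul (ρ := ρ t) (p := chem Ψ (ρ t)) (q := G.softVar Ψ c (ρ t)) hπ
      (summable_omega_grad_chem_mul hΨ hρ (a := fun e => G.softVar Ψ c (ρ t) e.1)
        fun e => abs_softVar_le hconn hΨ hρ.1 hc.le e.1)
    rw [← hg.neg.tsum_eq]
    refine tsum_congr fun i => ?_
    rw [← fokkerPlanck_eq_flowRate Ψ hρ.1, fokkerPlanck_eq_neg_B Ψ hρ.1]
    ring
  · have hρ := (h.mem y hy.1.le).1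
    have h1 := h.hasDerivAt hy.1 i
    rw [fokkerPlanck_eq_flowRate Ψ hρ.1] at h1
    have h2 : ρ y i + c * G.gibbs Ψ i ≠ 0 := (add_pos (hρ.1 i) (mul_pos hc (hm i))).ne'
    exact ((hasDerivAt_softSq h2).comp y h1).mul_const _
  · have hρ := (h.mem y hy.1.le).1
    have h1 := abs_flowRate_mul_pi_le hπ hC G.omega_nonneg (fun _ _ => le_rfl) hρ.1 i
    rw [norm_mul, norm_mul, Real.norm_of_nonneg (hπ i).le, Real.norm_eq_abs, Real.norm_eq_abs,
      mul_assoc]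
    have h2 := abs_softVar_le hconn hΨ hρ.1 hc.le i
    have h3 : 0 ≤ |G.flowRate G.ω Ψ (ρ y) i| * G.π i := mul_nonneg (abs_nonneg _) (hπ i).le
    refine (mul_le_of_le_one_left h3 h2).trans (h1.trans ?_)
    gcongr
    rw [Finset.mul_sum]
    refine Finset.sum_le_sum fun j _ => ?_
    calc _ ≤ G.ω i j * (A * ρ (t + 1) i + A * ρ (t + 1) j) :=
          mul_le_mul_of_nonneg_left (add_le_add (hle y hy i) (hle y hy j)) (G.omega_nonneg i j)
      _ = _ := by ring

lemma vecInner_softVar_nonneg (hconn : G.graph.Connected) (hΨ : G.IsPotential o Ψ) {ρ : V → ℝ}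
    (hρ : ρ ∈ G.P0) {c : ℝ} (hc : 0 < c) :
    0 ≤ G.vecInner ρ (G.grad (chem Ψ ρ)) (G.grad (G.softVar Ψ c ρ)) := by
  have h := edge_dissipation_le hconn hΨ hρ hc o o
  linarith [h.1, h.2]

lemma IsSolution.softEnt_antitoneOn (hconn : G.graph.Connected) (hΨ : G.IsPotential o Ψ)
    {ρ₀ : V → ℝ} {ρ : ℝ → V → ℝ} (h : G.IsSolution o Ψ ρ₀ ρ) {c : ℝ} (hc : 0 < c) :
    AntitoneOn (fun t => G.softEnt Ψ c (ρ t)) (Set.Ioi 0) := by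
  have hd := fun t (ht : t ∈ Set.Ioi (0 : ℝ)) => h.hasDerivAt_softEnt hconn hΨ hc ht
  refine antitoneOn_of_hasDerivWithinAt_nonpos (convex_Ioi 0)
    (fun t ht => (hd t ht).continuousAt.continuousWithinAt)
    (fun t ht => (hd t (interior_subset ht)).hasDerivWithinAt) fun t ht => ?_
  have ht' : 0 < t := interior_subset ht
  exact neg_nonpos.2 (vecInner_softVar_nonneg hconn hΨ (h.mem t ht'.le).1 hc)

/-- The densities at times `t ≥ 1` are uniformly integrable with respect to the Gibbs density. -/
lemma IsSolution.exists_sub_le_tsum_min (hconn : G.graph.Connected) (hΨ : G.IsPotential o Ψ)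
    {ρ₀ : V → ℝ} {ρ : ℝ → V → ℝ} (h : G.IsSolution o Ψ ρ₀ ρ) {ε : ℝ} (hε : 0 < ε) :
    ∃ c : ℝ, 1 < c ∧ ∀ t, 1 ≤ t → 1 - ε ≤ ∑' i, min (ρ t i) (c * G.gibbs Ψ i) * G.π i := by
  have hπ := G.pi_pos hconn
  have hm := (gibbs_mem_P0star hconn hΨ).1.1
  have hρ1 := (h.mem 1 zero_le_one).1
  -- At the single time 1 the functional is small for large `c`; monotonicity in time then carries
  -- the smallness to all `t ≥ 1` with the same `c`.
  have hlim : Tendsto (fun c : ℝ => G.softEnt Ψ c (ρ 1)) atTop (𝓝 (∑' _ : V, (0 : ℝ))) := by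
    refine tendsto_tsum_of_dominated_convergence hρ1.2.summable (fun i => ?_) ?_
    · have h1 : Tendsto (fun c : ℝ => ρ 1 i + c * G.gibbs Ψ i) atTop atTop :=
        tendsto_atTop_add_const_left _ _ (tendsto_id.atTop_mul_const (hm i))
      have h2 := (h1.const_div_atTop (ρ 1 i ^ 2)).mul_const (G.π i)
      rwa [zero_mul] at h2
    · filter_upwards [eventually_ge_atTop 0] with c hc i
      have h0 := mul_nonneg hc (hm i).le
      rw [Real.norm_of_nonneg (mul_nonneg (softSq_nonneg h0 (hρ1.1 i).le) (hπ i).le)]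
      exact mul_le_mul_of_nonneg_right (softSq_le h0 (hρ1.1 i)) (hπ i).le
  rw [tsum_zero] at hlim
  obtain ⟨c, hc1, hc2⟩ := ((hlim.eventually_lt_const (half_pos hε)).and (eventually_gt_atTop 1)).exists
  refine ⟨c, hc2, fun t ht => ?_⟩
  have hc0 : 0 < c := by linarith
  have ht0 : 0 < t := by linarith
  have hρ := (h.mem t ht0.le).1
  have h1 : G.softEnt Ψ c (ρ t) ≤ ε / 2 :=
    (h.softEnt_antitoneOn hconn hΨ hc0 (Set.mem_Ioi.2 one_pos) ht0 ht).trans hc1.le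
  have hmin : Summable fun i => min (ρ t i) (c * G.gibbs Ψ i) * G.π i := by
    refine Summable.of_nonneg_of_le (fun i => ?_) (fun i => ?_) hρ.2.summable
    · exact mul_nonneg (le_min (hρ.1 i).le (mul_pos hc0 (hm i)).le) (hπ i).le
    · exact mul_le_mul_of_nonneg_right (min_le_left _ _) (hπ i).le
  have h2 : ∑' i, (ρ t i * G.π i - min (ρ t i) (c * G.gibbs Ψ i) * G.π i) ≤
      ∑' i, 2 * (softSq (c * G.gibbs Ψ i) (ρ t i) * G.π i) := by
    refine (hρ.2.summable.sub hmin).tsum_le_tsum (fun i => ?_)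
      ((summable_softSq hconn hΨ hc0.le hρ).mul_left 2)
    rw [← sub_mul, ← mul_assoc]
    exact mul_le_mul_of_nonneg_right (sub_min_le_softSq (mul_pos hc0 (hm i)).le (hρ.1 i)) (hπ i).le
  rw [hρ.2.summable.tsum_sub hmin, hρ.2.tsum_eq, tsum_mul_left] at h2
  unfold softEnt at h1
  linarith

/-! ### Identification of the limit -/

/-- A nonincreasing functional bounded below has vanishing increments over unit intervals, and the
mean value theorem turns each increment into a dissipation. -/
lemma IsSolution.exists_seq_dissipation (hconn : G.graph.Connected) (hΨ : G.IsPotential o Ψ)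
    {ρ₀ : V → ℝ} {ρ : ℝ → V → ℝ} (h : G.IsSolution o Ψ ρ₀ ρ) :
    ∃ s : ℕ → ℝ, (∀ n, 1 ≤ s n) ∧ Tendsto (fun n =>
      G.vecInner (ρ (s n)) (G.grad (chem Ψ (ρ (s n)))) (G.grad (G.softVar Ψ 1 (ρ (s n))))) atTop
        (𝓝 0) := by
  set T : ℝ → ℝ := fun t => G.softEnt Ψ 1 (ρ t) with hT
  have hd := fun t (ht : 0 < t) => h.hasDerivAt_softEnt hconn hΨ one_pos ht
  have hanti : Antitone fun n : ℕ => T (n + 1) := fun m n hmn =>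
    h.softEnt_antitoneOn hconn hΨ one_pos (Set.mem_Ioi.2 (by positivity))
      (Set.mem_Ioi.2 (by positivity)) (by gcongr)
  have hm := (gibbs_mem_P0star hconn hΨ).1.1
  have hbdd : BddBelow (Set.range fun n : ℕ => T (n + 1)) := by
    refine ⟨0, ?_⟩
    rintro _ ⟨n, rfl⟩
    refine tsum_nonneg fun i => mul_nonneg (softSq_nonneg ?_ ?_) (G.pi_pos hconn i).le
    · simpa using (hm i).le
    · exact ((h.mem (n + 1) (by positivity)).1.1 i).le
  have hlim := tendsto_atTop_ciInf hanti hbdd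
  have hdiff := hlim.sub (hlim.comp (tendsto_add_atTop_nat 1))
  rw [sub_self] at hdiff
  have hex : ∀ n : ℕ, ∃ s ∈ Set.Ioo ((n : ℝ) + 1) (n + 2),
      -G.vecInner (ρ s) (G.grad (chem Ψ (ρ s))) (G.grad (G.softVar Ψ 1 (ρ s))) =
        (T (n + 2) - T (n + 1)) / ((n + 2 : ℝ) - (n + 1)) := by
    intro n
    have hn : (0 : ℝ) ≤ n := n.cast_nonneg
    refine exists_hasDerivAt_eq_slope T _ (by linarith) (fun t ht => ?_) fun t ht => ?_
    · exact (hd t (by linarith [ht.1])).continuousAt.continuousWithinAt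
    · exact hd t (by linarith [ht.1])
  choose s hs hs' using hex
  refine ⟨s, fun n => ?_, hdiff.congr fun n => ?_⟩
  · have hn : (0 : ℝ) ≤ n := n.cast_nonneg
    linarith [(hs n).1]
  · have := hs' n
    simp only [Function.comp]
    push_cast
    have e : ((n : ℝ) + 2 - (n + 1)) = 1 := by ring
    rw [e, div_one] at this
    rw [show (n : ℝ) + 1 + 1 = n + 2 by ring]
    linarith

/-- A limit of positive densities along which the dissipation vanishes is a multiple of the
Gibbs density. -/
lemma mul_gibbs_eq_of_tendsto (hconn : G.graph.Connected) (hΨ : G.IsPotential o Ψ) {α : Type*}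
    {F : Filter α} [F.NeBot] {x : α → V → ℝ} (hx : ∀ a, x a ∈ G.P0) {r : V → ℝ}
    (hr : ∀ i, Tendsto (fun a => x a i) F (𝓝 (r i)))
    (hD : Tendsto (fun a => G.vecInner (x a) (G.grad (chem Ψ (x a)))
      (G.grad (G.softVar Ψ 1 (x a)))) F (𝓝 0)) (hne : ∃ i, r i ≠ 0) (i j : V) :
    r i * G.gibbs Ψ j = r j * G.gibbs Ψ i := by
  have hm := (gibbs_mem_P0star hconn hΨ).1.1
  obtain ⟨C, hC0, hC⟩ := hΨ.exists_bound
  obtain ⟨l, hl, hlω, -⟩ := G.exists_pi_lower hconn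
  have hr0 : ∀ i, 0 ≤ r i := fun i => ge_of_tendsto' (hr i) fun a => ((hx a).1 i).le
  have hslope : ∀ i, Tendsto (fun a => softSlope (1 * G.gibbs Ψ i) (x a i)) F
      (𝓝 (softSlope (1 * G.gibbs Ψ i) (r i))) := fun i =>
    (hr i).softSlope (by have := hm i; have := hr0 i; rw [one_mul]; positivity)
  have hedge : ∀ i j, Tendsto (fun a => G.ω i j *
      (flux (Real.log (G.gibbs Ψ i) - Real.log (G.gibbs Ψ j)) (x a i) (x a j) *
        (softSlope (1 * G.gibbs Ψ j) (x a j) - softSlope (1 * G.gibbs Ψ i) (x a i)))) F (𝓝 0) := by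
    intro i j
    have h2 := hD.const_mul 2
    rw [mul_zero] at h2
    exact squeeze_zero (fun a => (edge_dissipation_le hconn hΨ (hx a) one_pos i j).1)
      (fun a => (edge_dissipation_le hconn hΨ (hx a) one_pos i j).2) h2
  -- The limit flux is not available at zero density, so the lower bound `q/2 - M p` replaces it: if
  -- `r i = 0 < r j`, the dissipation on the edge stays away from zero.
  have hstep : ∀ i j, G.graph.Adj i j → 0 < r j → 0 < r i := by
    intro i j hadj hj
    by_contra hi
    have hi0 : r i = 0 := le_antisymm (not_lt.1 hi) (hr0 i)
    have hs := (hslope j).sub (hslope i)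
    rw [hi0, softSlope_zero (by rw [one_mul]; exact (hm i).ne'), sub_zero] at hs
    have hpos : 0 < softSlope (1 * G.gibbs Ψ j) (r j) :=
      softSlope_pos (by rw [one_mul]; exact (hm j).le) hj
    have hlow := ((((hr j).div_const 2).sub ((hr i).const_mul (rateBound C))).mul hs).const_mul
      (G.ω i j)
    rw [hi0, mul_zero, sub_zero] at hlow
    have hle := le_of_tendsto_of_tendsto hlow (hedge i j) (by
      filter_upwards [hs.eventually (lt_mem_nhds hpos)] with a ha
      refine mul_le_mul_of_nonneg_left (mul_le_mul_of_nonneg_right ?_ ha.le) (G.omega_nonneg i j)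
      rw [log_gibbs hconn hΨ]
      exact le_flux (hC i j hadj) ((hx a).1 i) ((hx a).1 j))
    have : 0 < G.ω i j := hl.trans_le (hlω i j hadj)
    have : 0 < G.ω i j * (r j / 2 * softSlope (1 * G.gibbs Ψ j) (r j)) := by positivity
    linarith
  have hpos : ∀ i, 0 < r i := by
    obtain ⟨k, hk⟩ := hne
    have hk' : 0 < r k := lt_of_le_of_ne (hr0 k) hk.symm
    intro i
    obtain ⟨w⟩ := hconn.preconnected i k
    induction w with
    | nil => exact hk'
    | cons h _ ih => exact hstep _ _ h (ih hk hk')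
  -- With both limits positive the flux is continuous there, and the limiting edge dissipation
  -- vanishes only if the relative densities agree.
  have hadj : ∀ i j, G.graph.Adj i j → r i * G.gibbs Ψ j = r j * G.gibbs Ψ i := by
    intro i j hadj
    by_contra hne
    have h1 := ((((hr i).flux (c := Real.log (G.gibbs Ψ i) - Real.log (G.gibbs Ψ j)) (hpos i)
      (hpos j) (hr j)).mul ((hslope j).sub (hslope i))).const_mul (G.ω i j))
    have h2 := tendsto_nhds_unique h1 (hedge i j)
    have h3 := flux_mul_softSlope_pos_of_ne (hm i) (hm j) one_pos (hpos i) (hpos j) hne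
    have h4 : 0 < G.ω i j := hl.trans_le (hlω i j hadj)
    exact (mul_pos h4 h3).ne' h2
  obtain ⟨w⟩ := hconn.preconnected i j
  induction w with
  | nil => rfl
  | @cons u v x h _ ih =>
    have h1 := hadj u v h
    have h2 := hm v
    refine mul_right_cancel₀ h2.ne' ?_
    linear_combination G.gibbs Ψ x * h1 + G.gibbs Ψ u * ih

lemma tendsto_tsum_min (hconn : G.graph.Connected) (hΨ : G.IsPotential o Ψ) {α : Type*}
    {F : Filter α} {x : α → V → ℝ} (hx : ∀ a, x a ∈ G.P0) {r : V → ℝ}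
    (hr : ∀ i, Tendsto (fun a => x a i) F (𝓝 (r i))) {c : ℝ} (hc : 0 ≤ c) :
    Tendsto (fun a => ∑' i, min (x a i) (c * G.gibbs Ψ i) * G.π i) F
      (𝓝 (∑' i, min (r i) (c * G.gibbs Ψ i) * G.π i)) := by
  have hm := (gibbs_mem_P0star hconn hΨ).1
  have hπ := G.pi_pos hconn
  refine tendsto_tsum_of_dominated_convergence (hm.2.summable.mul_left c) (fun i => ?_)
    (Eventually.of_forall fun a i => ?_)
  · exact ((hr i).min tendsto_const_nhds).mul_const _
  · have h0 : 0 ≤ min (x a i) (c * G.gibbs Ψ i) :=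
      le_min ((hx a).1 i).le (mul_nonneg hc (hm.1 i).le)
    rw [Real.norm_of_nonneg (mul_nonneg h0 (hπ i).le), ← mul_assoc]
    exact mul_le_mul_of_nonneg_right (min_le_right _ _) (hπ i).le

/-- An ultrafilter gives limits at all vertices at once, since densities lie in `[0, 1/l]`. The
limit is `k ρ*`, and the truncated masses `∑ π min(ρ, cρ*)`, which pass to the limit, determine `k`.
-/
lemma IsSolution.exists_ultrafilter_tendsto (hconn : G.graph.Connected) (hΨ : G.IsPotential o Ψ)
    {ρ₀ : V → ℝ} {ρ : ℝ → V → ℝ} (h : G.IsSolution o Ψ ρ₀ ρ) :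
    ∃ (s : ℕ → ℝ) (U : Ultrafilter ℕ), (∀ n, 1 ≤ s n) ∧
      ∀ i, Tendsto (fun n => ρ (s n) i) U (𝓝 (G.gibbs Ψ i)) := by
  obtain ⟨s, hs1, hsD⟩ := h.exists_seq_dissipation hconn hΨ
  obtain ⟨l, hl, -, hlπ⟩ := G.exists_pi_lower hconn
  have hπ := G.pi_pos hconn
  have hm := (gibbs_mem_P0star hconn hΨ).1
  set U : Ultrafilter ℕ := Filter.hyperfilter ℕ
  have hU : (U : Filter ℕ) ≤ atTop := Nat.cofinite_eq_atTop ▸ Filter.hyperfilter_le_cofinite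
  have hmem : ∀ n, ρ (s n) ∈ G.P0 := fun n => (h.mem (s n) (by linarith [hs1 n])).1
  have hex : ∀ i, ∃ r, Tendsto (fun n => ρ (s n) i) U (𝓝 r) := fun i => by
    obtain ⟨r, -, hr⟩ := (isCompact_Icc (a := (0 : ℝ)) (b := 1 / l)).ultrafilter_le_nhds
      (U.map fun n => ρ (s n) i) (by
        rw [Filter.le_principal_iff]
        refine Filter.mem_map.2 (Filter.Eventually.of_forall (f := (U : Filter ℕ)) fun n => ?_)
        exact ⟨((hmem n).1 i).le, density_le hl hlπ (hmem n) i⟩)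
    exact ⟨r, hr⟩
  choose r hr using hex
  have hbd : ∀ ε, 0 < ε → ∃ c : ℝ, 1 < c ∧
      1 - ε ≤ ∑' i, min (r i) (c * G.gibbs Ψ i) * G.π i := fun ε hε => by
    obtain ⟨c, hc, hc'⟩ := h.exists_sub_le_tsum_min hconn hΨ hε
    exact ⟨c, hc, ge_of_tendsto' (tendsto_tsum_min hconn hΨ hmem hr (by linarith))
      fun n => hc' _ (hs1 n)⟩
  have hne : ∃ i, r i ≠ 0 := by
    by_contra hall
    push Not at hall
    obtain ⟨c, hc, hc'⟩ := hbd (1 / 2) (by norm_num)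
    have : ∀ i, min (r i) (c * G.gibbs Ψ i) * G.π i = 0 := fun i => by
      rw [hall i, min_eq_left (mul_nonneg (by linarith) (hm.1 i).le), zero_mul]
    rw [tsum_congr this, tsum_zero] at hc'
    norm_num at hc'
  have hprop := mul_gibbs_eq_of_tendsto hconn hΨ hmem hr (hsD.mono_left hU) hne
  set k := r o / G.gibbs Ψ o with hk
  have hrk : ∀ i, r i = k * G.gibbs Ψ i := fun i => by
    have := hprop i o
    have := (hm.1 o).ne'
    rw [hk]
    field_simp
    linarith
  have hmin : ∀ c, ∑' i, min (r i) (c * G.gibbs Ψ i) * G.π i = min k c := fun c => by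
    have : ∀ i, min (r i) (c * G.gibbs Ψ i) * G.π i = min k c * (G.gibbs Ψ i * G.π i) := fun i => by
      rw [hrk, ← min_mul_of_nonneg _ _ (hm.1 i).le, mul_assoc]
    rw [tsum_congr this, tsum_mul_left, hm.2.tsum_eq, mul_one]
  -- Any truncation level above 1 would do: `min k 2 ≤ 1` excludes `k > 1`.
  have hk1 : k ≤ 1 := by
    have hlim := tendsto_tsum_min hconn hΨ hmem hr (c := 2) (by norm_num)
    have h1 : ∑' i, min (r i) (2 * G.gibbs Ψ i) * G.π i ≤ 1 := le_of_tendsto' hlim fun n => by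
        rw [← (hmem n).2.tsum_eq]
        have hle : ∀ i, min (ρ (s n) i) (2 * G.gibbs Ψ i) * G.π i ≤ ρ (s n) i * G.π i := fun i =>
          mul_le_mul_of_nonneg_right (min_le_left _ _) (hπ i).le
        refine Summable.tsum_le_tsum hle ?_ (hmem n).2.summable
        refine Summable.of_nonneg_of_le (fun i => mul_nonneg (le_min ((hmem n).1 i).le ?_) (hπ i).le)
          hle (hmem n).2.summable
        have := hm.1 i
        positivity
    rw [hmin] at h1
    rcases min_le_iff.1 h1 with h1 | h1
    · exact h1
    · norm_num at h1
  -- Uniform integrability: for each `ε` some truncation level retains mass `1 - ε` in the limit.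
  have hk2 : 1 ≤ k := by
    refine le_of_forall_pos_le_add fun ε hε => ?_
    obtain ⟨c, hc, hc'⟩ := hbd ε hε
    rw [hmin] at hc'
    linarith [min_le_left k c]
  refine ⟨s, U, hs1, fun i => ?_⟩
  have := hr i
  rwa [hrk, le_antisymm hk1 hk2, one_mul] at this

end

end

end WeightedGraph

/-! ### Relative entropy at `c = 1` against the distance to the Gibbs density -/

lemma softSq_sub_eq {m x : ℝ} (h : x + m ≠ 0) :
    softSq m x - (3 * x - m) / 4 = (x - m) ^ 2 / (4 * (x + m)) := by
  unfold softSq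
  field_simp
  ring

/-- The right side is `|x - m| / 4`, since `|x - m| = (x - m) + 2 (m - min x m)`. The subtracted
affine function is the tangent of `softSq m` at `x = m`. -/
lemma softSq_sub_le {m x : ℝ} (hm : 0 < m) (hx : 0 < x) :
    softSq m x - (3 * x - m) / 4 ≤ ((x - m) + 2 * (m - min x m)) / 4 := by
  rw [softSq_sub_eq (by positivity), div_le_div_iff₀ (by positivity) (by norm_num)]
  rcases le_total x m with h | h
  · rw [min_eq_left h]; nlinarith [mul_nonneg hx.le (sub_nonneg.2 h)]
  · rw [min_eq_right h]; nlinarith [mul_nonneg hm.le (sub_nonneg.2 h)]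

lemma sq_sub_le_softSq {l m x : ℝ} (hm : 0 < m) (hx : 0 < x) (hml : m ≤ 1 / l) (hxl : x ≤ 1 / l) :
    (x - m) ^ 2 ≤ 8 * (1 / l) * (softSq m x - (3 * x - m) / 4) := by
  have h0 : 0 < x + m := by positivity
  rw [softSq_sub_eq h0.ne', ← mul_div_assoc, le_div_iff₀ (by positivity)]
  have : 4 * (x + m) ≤ 8 * (1 / l) := by linarith
  nlinarith [sq_nonneg (x - m)]

namespace WeightedGraph

noncomputable section

variable {V : Type*} {G : WeightedGraph V}

/-! ### Convergence to the Gibbs density -/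

lemma lrNorm_le_of_sq (hπ : ∀ i, 0 < G.π i) {f : V → ℝ} (hf : ∀ i, |f i| ≤ 1)
    (hs : Summable fun i => f i ^ 2 * G.π i) {r : ℝ≥0∞} (hr : 2 ≤ r) (hr' : r ≠ ⊤) :
    G.lrNorm f r ≤ ENNReal.ofReal (∑' i, f i ^ 2 * G.π i) ^ (1 / r.toReal) := by
  have hr0 : r ≠ 0 := by
    rintro rfl
    norm_num at hr
  have hr2 : (2 : ℝ) ≤ r.toReal := by
    have := ENNReal.toReal_mono hr' hr
    simpa using this
  let _ : MeasurableSpace V := ⊤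
  rw [lrNorm, eLpNorm_eq_lintegral_rpow_enorm_toReal hr0 hr', lintegral_sum_measure]
  gcongr
  rw [ENNReal.ofReal_tsum_of_nonneg (fun i => mul_nonneg (sq_nonneg _) (hπ i).le) hs]
  refine ENNReal.tsum_le_tsum fun i => ?_
  rw [lintegral_smul_measure, lintegral_dirac' _ measurable_from_top, smul_eq_mul, mul_comm,
    ENNReal.ofReal_mul (sq_nonneg _)]
  gcongr
  have h1 : ‖f i‖ₑ ≤ 1 := by
    rw [← ofReal_norm, Real.norm_eq_abs]
    exact ENNReal.ofReal_le_one.2 (hf i)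
  calc ‖f i‖ₑ ^ r.toReal ≤ ‖f i‖ₑ ^ (2 : ℝ) := ENNReal.rpow_le_rpow_of_exponent_ge h1 hr2
    _ = ENNReal.ofReal (f i ^ 2) := by
        rw [← ofReal_norm, Real.norm_eq_abs, ← sq_abs, ENNReal.ofReal_pow (abs_nonneg _)]
        norm_cast

lemma lrNorm_top_le {f : V → ℝ} {B : ℝ} (hf : ∀ i, |f i| ≤ B) :
    G.lrNorm f ⊤ ≤ ENNReal.ofReal B := by
  let _ : MeasurableSpace V := ⊤
  rw [lrNorm, eLpNorm_exponent_top]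
  exact eLpNormEssSup_le_of_ae_bound (Eventually.of_forall hf)

/-- As `π ≥ l`, the `ℓ²` norm controls the supremum. Once that is at most one, `|f|^r ≤ f²` for
finite `r ≥ 2`. -/
lemma tendsto_lrNorm {l : ℝ} (hl : 0 < l) (hlπ : ∀ i, l ≤ G.π i) {f : ℝ → V → ℝ}
    (hs : ∀ᶠ t in atTop, Summable fun i => f t i ^ 2 * G.π i)
    (hlim : Tendsto (fun t => ∑' i, f t i ^ 2 * G.π i) atTop (𝓝 0)) {r : ℝ≥0∞} (hr : 2 ≤ r) :
    Tendsto (fun t => G.lrNorm (f t) r) atTop (𝓝 0) := by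
  have hπ : ∀ i, 0 < G.π i := fun i => hl.trans_le (hlπ i)
  have hsup : ∀ᶠ t in atTop, ∀ i, |f t i| ≤ √((∑' i, f t i ^ 2 * G.π i) / l) := by
    filter_upwards [hs] with t ht i
    refine Real.abs_le_sqrt ?_
    rw [le_div_iff₀ hl]
    have h1 := ht.le_tsum i fun j _ => mul_nonneg (sq_nonneg _) (hπ j).le
    exact (mul_le_mul_of_nonneg_left (hlπ i) (sq_nonneg _)).trans h1
  have hsup0 : Tendsto (fun t => √((∑' i, f t i ^ 2 * G.π i) / l)) atTop (𝓝 0) := by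
    have := (hlim.div_const l).sqrt
    rwa [zero_div, Real.sqrt_zero] at this
  rcases eq_or_ne r ⊤ with rfl | hr'
  · refine tendsto_of_tendsto_of_tendsto_of_le_of_le' tendsto_const_nhds
      (by simpa using ENNReal.tendsto_ofReal hsup0) (Eventually.of_forall fun _ => zero_le) ?_
    filter_upwards [hsup] with t ht using lrNorm_top_le ht
  · have hr0 : 0 < 1 / r.toReal := by
      have := ENNReal.toReal_mono hr' hr
      have h2 : (2 : ℝ) ≤ r.toReal := by simpa using this
      positivity
    have hup : Tendsto (fun t => ENNReal.ofReal (∑' i, f t i ^ 2 * G.π i) ^ (1 / r.toReal)) atTop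
        (𝓝 0) := by
      have := (ENNReal.tendsto_ofReal hlim).ennrpow_const (1 / r.toReal)
      rwa [ENNReal.ofReal_zero, ENNReal.zero_rpow_of_pos hr0] at this
    refine tendsto_of_tendsto_of_tendsto_of_le_of_le' tendsto_const_nhds hup
      (Eventually.of_forall fun _ => zero_le) ?_
    filter_upwards [hsup, hs, hsup0.eventually_le_const one_pos] with t h1 h2 h3
    exact lrNorm_le_of_sq hπ (fun i => (h1 i).trans h3) h2 hr hr'

section
variable [Nontrivial V] {o : V} {Ψ : V → ℝ}

/-- Both densities have mass one, so the tangent line sums to `(3 - 1)/4 = 1/2`, the value of the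
functional at equilibrium. -/
lemma hasSum_softSq_sub (hconn : G.graph.Connected) (hΨ : G.IsPotential o Ψ) {ρ : V → ℝ}
    (hρ : ρ ∈ G.P0) :
    HasSum (fun i => (softSq (G.gibbs Ψ i) (ρ i) - (3 * ρ i - G.gibbs Ψ i) / 4) * G.π i)
      (G.softEnt Ψ 1 ρ - 1 / 2) := by
  have hm := (gibbs_mem_P0star hconn hΨ).1
  have h1 := (summable_softSq hconn hΨ zero_le_one hρ).hasSum.sub
    (((hρ.2.mul_left 3).sub hm.2).div_const 4)
  rw [softEnt]
  norm_num at h1 ⊢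
  refine h1.congr_fun fun i => ?_
  ring

lemma summable_sq_sub_gibbs (hconn : G.graph.Connected) (hΨ : G.IsPotential o Ψ) {l : ℝ}
    (hl : 0 < l) (hlπ : ∀ i, l ≤ G.π i) {ρ : V → ℝ} (hρ : ρ ∈ G.P0) :
    (Summable fun i => (ρ i - G.gibbs Ψ i) ^ 2 * G.π i) ∧
      ∑' i, (ρ i - G.gibbs Ψ i) ^ 2 * G.π i ≤ 8 * (1 / l) * (G.softEnt Ψ 1 ρ - 1 / 2) := by
  have hm := (gibbs_mem_P0star hconn hΨ).1
  have hπ := G.pi_pos hconn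
  have h := (hasSum_softSq_sub hconn hΨ hρ).mul_left (8 * (1 / l))
  have hle : ∀ i, (ρ i - G.gibbs Ψ i) ^ 2 * G.π i ≤ 8 * (1 / l) *
      ((softSq (G.gibbs Ψ i) (ρ i) - (3 * ρ i - G.gibbs Ψ i) / 4) * G.π i) := fun i => by
    rw [← mul_assoc]
    exact mul_le_mul_of_nonneg_right (sq_sub_le_softSq (hm.1 i) (hρ.1 i)
      (density_le hl hlπ hm i) (density_le hl hlπ hρ i)) (hπ i).le
  have hs := Summable.of_nonneg_of_le (fun i => mul_nonneg (sq_nonneg _) (hπ i).le) hle h.summable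
  exact ⟨hs, (hs.tsum_le_tsum hle h.summable).trans_eq h.tsum_eq⟩

lemma softEnt_sub_le (hconn : G.graph.Connected) (hΨ : G.IsPotential o Ψ) {ρ : V → ℝ}
    (hρ : ρ ∈ G.P0) :
    G.softEnt Ψ 1 ρ - 1 / 2 ≤ (1 - ∑' i, min (ρ i) (1 * G.gibbs Ψ i) * G.π i) / 2 := by
  have hm := (gibbs_mem_P0star hconn hΨ).1
  have hπ := G.pi_pos hconn
  have hmin : Summable fun i => min (ρ i) (1 * G.gibbs Ψ i) * G.π i := by
    refine Summable.of_nonneg_of_le (fun i => ?_) (fun i => ?_) hρ.2.summable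
    · refine mul_nonneg (le_min (hρ.1 i).le ?_) (hπ i).le
      rw [one_mul]; exact (hm.1 i).le
    · exact mul_le_mul_of_nonneg_right (min_le_left _ _) (hπ i).le
  have h := ((hρ.2.sub hm.2).add ((hm.2.sub hmin.hasSum).mul_left 2)).div_const 4
  have hle := hasSum_le (fun i => ?_) (hasSum_softSq_sub hconn hΨ hρ) h
  · linarith
  · have := mul_le_mul_of_nonneg_right (softSq_sub_le (hm.1 i) (hρ.1 i)) (hπ i).le
    rw [one_mul]
    linarith

/-- Along the ultrafilter the overlap with `ρ*` tends to one, so the excess becomes small at some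
time `s n`, and monotonicity keeps it small afterwards. -/
lemma IsSolution.tendsto_softEnt (hconn : G.graph.Connected) (hΨ : G.IsPotential o Ψ)
    {ρ₀ : V → ℝ} {ρ : ℝ → V → ℝ} (h : G.IsSolution o Ψ ρ₀ ρ) :
    Tendsto (fun t => G.softEnt Ψ 1 (ρ t) - 1 / 2) atTop (𝓝 0) := by
  have hm := (gibbs_mem_P0star hconn hΨ).1
  have hπ := G.pi_pos hconn
  obtain ⟨l, hl, -, hlπ⟩ := G.exists_pi_lower hconn
  obtain ⟨s, U, hs1, hlim⟩ := h.exists_ultrafilter_tendsto hconn hΨ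
  have hmem : ∀ n, ρ (s n) ∈ G.P0 := fun n => (h.mem (s n) (by linarith [hs1 n])).1
  have h1 := tendsto_tsum_min hconn hΨ hmem hlim zero_le_one
  have h2 : ∑' i, min (G.gibbs Ψ i) (1 * G.gibbs Ψ i) * G.π i = 1 := by
    simp only [one_mul, min_self]
    exact hm.2.tsum_eq
  rw [h2] at h1
  have h3 := (h1.const_sub 1).div_const 2
  rw [sub_self, zero_div] at h3
  rw [Metric.tendsto_atTop]
  intro ε hε
  obtain ⟨n, hn⟩ := (h3.eventually_lt_const hε).exists
  refine ⟨s n, fun t ht => ?_⟩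
  have hsn : 0 < s n := by linarith [hs1 n]
  have ht0 : 0 < t := hsn.trans_le ht
  have h4 := h.softEnt_antitoneOn hconn hΨ one_pos hsn ht0 ht
  simp only at h4
  have h5 := softEnt_sub_le hconn hΨ (hmem n)
  have h6 : 0 ≤ 8 * (1 / l) * (G.softEnt Ψ 1 (ρ t) - 1 / 2) :=
    (tsum_nonneg fun i => mul_nonneg (sq_nonneg _) (hπ i).le).trans
      (summable_sq_sub_gibbs hconn hΨ hl hlπ (h.mem t ht0.le).1).2
  have h7 : 0 ≤ G.softEnt Ψ 1 (ρ t) - 1 / 2 := nonneg_of_mul_nonneg_right h6 (by positivity)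
  rw [Real.dist_eq, sub_zero, abs_of_nonneg h7]
  linarith

theorem IsSolution.tendsto_lrNorm (hconn : G.graph.Connected) (hΨ : G.IsPotential o Ψ)
    {ρ₀ : V → ℝ} {ρ : ℝ → V → ℝ} (h : G.IsSolution o Ψ ρ₀ ρ) {r : ℝ≥0∞} (hr : 2 ≤ r) :
    Tendsto (fun t => G.lrNorm (fun i => ρ t i - G.gibbs Ψ i) r) atTop (𝓝 0) := by
  have hπ := G.pi_pos hconn
  obtain ⟨l, hl, -, hlπ⟩ := G.exists_pi_lower hconn
  have hs : ∀ᶠ t in atTop, (Summable fun i => (ρ t i - G.gibbs Ψ i) ^ 2 * G.π i) ∧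
      ∑' i, (ρ t i - G.gibbs Ψ i) ^ 2 * G.π i ≤
        8 * (1 / l) * (G.softEnt Ψ 1 (ρ t) - 1 / 2) := by
    filter_upwards [eventually_ge_atTop 0] with t ht
    exact summable_sq_sub_gibbs hconn hΨ hl hlπ (h.mem t ht).1
  refine WeightedGraph.tendsto_lrNorm hl hlπ (hs.mono fun t ht => ht.1) ?_ hr
  have h1 := (h.tendsto_softEnt hconn hΨ).const_mul (8 * (1 / l))
  rw [mul_zero] at h1
  exact tendsto_of_tendsto_of_tendsto_of_le_of_le' tendsto_const_nhds h1
    (Eventually.of_forall fun t => tsum_nonneg fun i => mul_nonneg (sq_nonneg _) (hπ i).le)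
    (hs.mono fun t ht => ht.2)

end

end

end WeightedGraph

theorem theorem1 {V : Type*} [Infinite V] (G : WeightedGraph V) (hconn : G.graph.Connected)
    (o : V) (Ψ : V → ℝ) (hΨ : G.IsPotential o Ψ) :
    -- the metric `g` is well defined
    (∀ ρ ∈ G.P0, ∀ p ∈ G.potentials ρ, ∀ q ∈ G.potentials ρ,
      G.B ρ p ∈ G.tangent ρ ∧
      (G.B ρ p = G.B ρ q ↔ ∃ c : ℝ, ∀ i, p i = q i + c) ∧
      G.metric ρ (G.B ρ p) (G.B ρ q) = G.vecInner ρ (G.grad p) (G.grad q) ∧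
      ((Summable fun i => G.B ρ p i * q i * G.π i) →
        G.metric ρ (G.B ρ p) (G.B ρ q) = ∑' i, G.B ρ p i * q i * G.π i)) ∧
    -- (1) the free energy, its first variation, and the equation as `ρ' = - B_ρ (δF/δρ)`
    (∀ ρ ∈ G.P0star o,
      (Summable fun i => G.π i * Ψ i * ρ i) ∧
      (Summable fun i => G.π i * ρ i * Real.log (ρ i)) ∧
      G.IsFirstVariation (G.freeEnergy Ψ) ρ (fun i => Ψ i + 1 + Real.log (ρ i)) ∧
      (fun i => Ψ i + 1 + Real.log (ρ i)) ∈ G.K ρ ∧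
      ∀ i,
        G.fokkerPlanck Ψ ρ i = - G.B ρ (fun i => Ψ i + 1 + Real.log (ρ i)) i ∧
        G.fokkerPlanck Ψ ρ i = ∑ j ∈ G.nbr i, G.ω i j / G.π i *
          ((Ψ j + Real.log (ρ j)) - (Ψ i + Real.log (ρ i))) * G.logMean ρ i j) ∧
    -- (1) the Fokker-Planck equation is the gradient flow of the free energy
    (∀ ρ₀ ∈ G.P0star o, ∀ ρ : ℝ → V → ℝ,
      G.IsSolution o Ψ ρ₀ ρ ↔ G.IsGradientFlow o (G.freeEnergy Ψ) ρ₀ ρ) ∧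
    -- (2) unique global solution
    (∀ ρ₀ ∈ G.P0star o, (∃ ρ, G.IsSolution o Ψ ρ₀ ρ) ∧
      ∀ ρ ρ', G.IsSolution o Ψ ρ₀ ρ → G.IsSolution o Ψ ρ₀ ρ' → ∀ t, 0 ≤ t → ρ t = ρ' t) ∧
    -- (3) convergence to the Gibbs density
    G.gibbs Ψ ∈ G.P0star o ∧
    (∀ ρ₀ ∈ G.P0star o, ∀ ρ, G.IsSolution o Ψ ρ₀ ρ → ∀ r : ℝ≥0∞, 2 ≤ r →
      Tendsto (fun t => G.lrNorm (fun i => ρ t i - G.gibbs Ψ i) r) atTop (𝓝 0)) := by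
  have hπ := G.pi_pos hconn
  refine ⟨fun ρ hρ p hp q hq => ⟨G.B_mem_tangent hπ hρ hp, G.B_eq_iff hπ hconn hρ hp hq,
    G.metric_B hπ hconn hρ hp hq, fun hs => ?_⟩, fun ρ hρ => ?_, fun ρ₀ hρ₀ ρ => ?_,
    fun ρ₀ hρ₀ => ?_, WeightedGraph.gibbs_mem_P0star hconn hΨ,
    fun ρ₀ _ ρ h r hr => h.tendsto_lrNorm hconn hΨ hr⟩
  · rw [G.metric_B hπ hconn hρ hp hq, G.vecInner_eq_tsum hπ hρ hp.2 hq.2 hs]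
  · exact ⟨WeightedGraph.summable_potential_energy hΨ hconn hπ hρ,
      WeightedGraph.summable_entropy hΨ hconn hρ,
      WeightedGraph.isFirstVariation_freeEnergy hΨ hconn hρ,
      WeightedGraph.chem_mem_K hπ hΨ hρ.1,
      fun i => ⟨WeightedGraph.fokkerPlanck_eq_neg_B Ψ hρ.1.1 i,
        WeightedGraph.fokkerPlanck_eq_sum Ψ hρ.1.1 i⟩⟩
  · exact ⟨fun h => h.isGradientFlow hconn hΨ hρ₀, fun h => h.isSolution hconn hΨ⟩
  · obtain ⟨r, hr⟩ := WeightedGraph.exists_isApprox hconn hΨ hρ₀.1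
    obtain ⟨ρ, hρ, -⟩ := hr.exists_isSolution hΨ hρ₀
    exact ⟨⟨ρ, hρ⟩, fun ρ ρ' h h' t ht => h.unique hπ hconn hΨ h' ht⟩
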